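/- Let $\zeta_5=e^{2\pi i/5}$, identify $\mathbb R^2$ with $\mathbb C$, and let $\sigma_2(\sum_{j=0}^3a_j\zeta_5^j)=\sum_{j=0}^3a_j\zeta_5^{2j}$ and $z^\star=(\sigma_2(z),\sum_{j=0}^3 a_j \bmod 5)\in\mathbb R^2\times\mathbb Z/5\mathbb Z$ for $z=\sum_{j=0}^3a_j\zeta_5^j\in\mathbb Z[\zeta_5]$ ($a_j\in\mathbb Z$). Let $P$ be the convex hull of the fifth roots of unity, $\tau=(1+\sqrt5)/2$, let $W^{(1)},W^{(2)},W^{(3)},W^{(4)}$ be the pentagons $P,-P,\tau P,-\tau P$ in any fixed order (the order $P,-\tau P,\tau P,-P$ is that of the vertex sets of Penrose tilings), and let $W=\bigcup_{j=1}^4W^{(j)}\times\{j \bmod 5\}$. For $u\in\mathbb R^2$ put $\Lambda^u=\{z\in\mathbb Z[\zeta_5] : z^\star\in(u,0)+W\}$, and call $u$ generic if no $z^\star$, $z\in\mathbb Z[\zeta_5]$, lies on the boundary of $(u,0)+W$. The sets $t+\Lambda^u$ with $t\in\mathbb R^2$ and $u$ generic are called Penrose model sets (PMS). A $\mathbb Z[\zeta_5]$-direction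 is a unit vector parallel to a nonzero element of $\mathbb Z[\zeta_5]$. For a direction $u$, let $\mathcal L_u$ be the set of lines parallel to $u$, and for a finite set $F\subset\mathbb R^2$ let $X_uF:\mathcal L_u\to\mathbb N_0$, $X_uF(\ell)=\operatorname{card}(F\cap\ell)$. Let $u_1,u_2$ be two fixed non-parallel $\mathbb Z[\zeta_5]$-directions. - **Consistency.** Given $p_i:\mathcal L_{u_i}\to\mathbb N_0$ ($i=1,2$) with finite supports that consist of lines through points of $\mathbb Z[\zeta_5]$, decide whether there is a finite set $F$, contained in a PMS, with $X_{u_i}F=p_i$ for $i=1,2$. - **Reconstruction.** Given such $p_1,p_2$; in the case that such an $F$ exists, construct one. - **Uniqueness.** Given a finite subset $F$ of a PMS, decide whether there is a finite set $F'\ne F$, contained in a (possibly different) PMS, with $X_{u_i}F'=X_{u_i}F$ for $i=1,2$. Encoding: $p_i$ is given by a list of pairwise distinct lines that contains its support, each line given by the integer coordinates $(a_0,\dots,a_3)$ of some point of $\mathbb Z[\zeta_5]$ on it, together with the value of $p_i$ there. A finite subset of a PMS is given (as input or output) as $\{t+z_1,\dots,t+z_n\}$ by the two real coordinates of some $t\in\mathbb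 R^2$ and the integer coordinates of distinct $z_1,\dots,z_n\in\mathbb Z[\zeta_5]$. The size of an input is the total binary length of its integers, where each of the two real coordinates of $t$ counts $1$. The real RAM has memory cells that hold real numbers; the arithmetic operations $+,-,\times,/$, comparisons, the loading of real algebraic constants, and indirect addressing through cells that hold natural numbers each cost one step (there is no rounding operation). **Theorem.** For any two non-parallel $\mathbb Z[\zeta_5]$-directions $u_1,u_2$, each of the problems Consistency, Reconstruction and Uniqueness can be solved in polynomial time in the real RAM model: for each of them there are a real RAM program and a polynomial $q$ such that, on every encoded input of size $s$, the program halts after at most $q(s)$ steps with a correct result. -/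

import Mathlib

namespace PenroseTomography

noncomputable section

/-! ### The ring `ℤ[ζ₅]`, directions, lines and X-rays -/

/-- `ζ₅ = exp (2πi/5)`. The Euclidean plane is identified with `ℂ`. -/
def zeta : ℂ := Complex.exp (2 * Real.pi * Complex.I / 5)

/-- Coordinates `(a₀, a₁, a₂, a₃)` of elements of `ℤ[ζ₅]` in the `ℤ`-basis `1, ζ₅, ζ₅², ζ₅³`. -/
abbrev Coords : Type := Fin 4 → ℤ

/-- The element `∑ aⱼ ζ₅ʲ` of `ℤ[ζ₅]`. -/
def point (a : Coords) : ℂ := ∑ j : Fin 4, (a j : ℂ) * zeta ^ (j : ℕ)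

/-- The first part of the star map: `σ₂(∑ aⱼ ζ₅ʲ) = ∑ aⱼ ζ₅²ʲ`, where `σ₂ : ζ₅ ↦ ζ₅²`. -/
def conj2 (a : Coords) : ℂ := ∑ j : Fin 4, (a j : ℂ) * zeta ^ (2 * (j : ℕ))

/-- The second part of the star map: `∑ aⱼ (mod 5)`, an element of the cyclic group `C₅`. -/
def residue (a : Coords) : ZMod 5 := ∑ j : Fin 4, (a j : ZMod 5)

/-- The set `ℤ[ζ₅]`. -/
def cycloInts : Set ℂ := Set.range point

/-- A `ℤ[ζ₅]`-direction: a unit vector parallel to a nonzero element of `ℤ[ζ₅]`. -/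
def IsCycloDirection (u : ℂ) : Prop :=
  ‖u‖ = 1 ∧ ∃ z ∈ cycloInts, z ≠ 0 ∧ ∃ s : ℝ, z = (s : ℂ) * u

/-- The line through `z` in direction `u`. -/
def line (u z : ℂ) : Set ℂ := {w | ∃ s : ℝ, w = z + (s : ℂ) * u}

/-- The set of all lines in direction `u`, as a type. -/
abbrev Lines (u : ℂ) : Type := {ℓ : Set ℂ // ∃ z, ℓ = line u z}

/-- The line in direction `u` through the element of `ℤ[ζ₅]` with coordinates `a`. -/
def cycloLine (u : ℂ) (a : Coords) : Lines u := ⟨line u (point a), point a, rfl⟩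

/-- The (discrete parallel) X-ray of a finite set in direction `u`. -/
def xray (u : ℂ) (F : Finset ℂ) : Lines u → ℕ := fun ℓ => ((F : Set ℂ) ∩ ℓ.1).ncard

/-! ### Penrose model sets -/

/-- The regular pentagon `P`: the convex hull of the fifth roots of unity. -/
def pentagon : Set ℂ := convexHull ℝ {z : ℂ | z ^ 5 = 1}

/-- The four pentagons `P`, `-P`, `τP`, `-τP`, where `τ` is the golden ratio. -/
def pentagons : Fin 4 → Set ℂ :=
  ![pentagon,
    (fun z => -z) '' pentagon,
    (fun z => (Real.goldenRatio : ℂ) * z) '' pentagon,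
    (fun z => -((Real.goldenRatio : ℂ) * z)) '' pentagon]

/-- The fibre over `c ∈ C₅` of the window: the pentagon number `π i` sits over the residue class
of `i + 1`, for `i = 0, 1, 2, 3`, and the fibre over `0` is empty. -/
def window (π : Equiv.Perm (Fin 4)) (c : ZMod 5) : Set ℂ :=
  {w | ∃ i : Fin 4, c = ((i : ℕ) + 1 : ZMod 5) ∧ w ∈ pentagons (π i)}

/-- The model set `{z ∈ ℤ[ζ₅] | z⋆ ∈ (u, 0) + W}`. -/
def modelSet (π : Equiv.Perm (Fin 4)) (u : ℂ) : Set ℂ :=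
  {z | ∃ a : Coords, z = point a ∧ conj2 a - u ∈ window π (residue a)}

/-- `u` is generic: no element of `ℤ[ζ₅]⋆` lies on the boundary of the shifted window
`(u, 0) + W`. As `C₅` is discrete, the boundary is taken fibre by fibre. -/
def IsGeneric (π : Equiv.Perm (Fin 4)) (u : ℂ) : Prop :=
  ∀ a : Coords, conj2 a - u ∉ frontier (window π (residue a))

/-- Penrose model sets: the translates `t + Λ` of the generic model sets. -/
def IsPenroseModelSet (π : Equiv.Perm (Fin 4)) (S : Set ℂ) : Prop :=
  ∃ u t : ℂ, IsGeneric π u ∧ S = (fun z => t + z) '' modelSet π u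

/-- `F` is contained in some Penrose model set. -/
def InPenrose (π : Equiv.Perm (Fin 4)) (F : Finset ℂ) : Prop :=
  ∃ S : Set ℂ, IsPenroseModelSet π S ∧ (F : Set ℂ) ⊆ S

/-! ### The real RAM -/

/-- The memory: countably many cells, each of which holds an arbitrary real number. -/
abbrev Memory : Type := ℕ → ℝ

/-- The elementary instructions: loading an algebraic constant, the four arithmetic operations,
and indirect addressing. The arguments are the addresses of cells. -/
inductive Instr : Type
  | const (d : ℕ) (c : {c : ℝ // IsAlgebraic ℚ c})
  | add (d a b : ℕ)
  | sub (d a b : ℕ)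
  | mul (d a b : ℕ)
  | div (d a b : ℕ)
  | load (d a : ℕ)
  | store (a b : ℕ)

/-- The effect of an instruction. Division by zero, and indirect addressing through a cell
whose content is not a natural number, have no result: the machine is stuck there. -/
inductive Step : Instr → Memory → Memory → Prop
  | const (M : Memory) (d : ℕ) (c : {c : ℝ // IsAlgebraic ℚ c}) :
      Step (Instr.const d c) M (Function.update M d c.1)
  | add (M : Memory) (d a b : ℕ) : Step (Instr.add d a b) M (Function.update M d (M a + M b))
  | sub (M : Memory) (d a b : ℕ) : Step (Instr.sub d a b) M (Function.update M d (M a - M b))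
  | mul (M : Memory) (d a b : ℕ) : Step (Instr.mul d a b) M (Function.update M d (M a * M b))
  | div (M : Memory) (d a b : ℕ) : M b ≠ 0 →
      Step (Instr.div d a b) M (Function.update M d (M a / M b))
  | load (M : Memory) (d a k : ℕ) : M a = (k : ℝ) →
      Step (Instr.load d a) M (Function.update M d (M k))
  | store (M : Memory) (a b k : ℕ) : M a = (k : ℝ) →
      Step (Instr.store a b) M (Function.update M k (M b))

/-- Comparisons of the contents of two cells. -/
inductive Test : Type
  | lt (a b : ℕ)
  | le (a b : ℕ)
  | eq (a b : ℕ)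

/-- The outcome of a comparison. -/
def Test.Holds : Test → Memory → Prop
  | Test.lt a b, M => M a < M b
  | Test.le a b, M => M a ≤ M b
  | Test.eq a b, M => M a = M b

/-- Programs, built from instructions by sequencing, branching (`cond`) and while-loops. -/
inductive Prog : Type
  | skip
  | instr (I : Instr)
  | seq (P Q : Prog)
  | cond (T : Test) (P Q : Prog)
  | loop (T : Test) (P : Prog)

/-- `Exec P M n N`: started with memory `M`, the program `P` halts with memory `N` after `n`
steps, where each instruction and each comparison costs one step. -/
inductive Exec : Prog → Memory → ℕ → Memory → Prop
  | skip (M : Memory) : Exec Prog.skip M 0 M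
  | instr {I : Instr} {M N : Memory} : Step I M N → Exec (Prog.instr I) M 1 N
  | seq {P Q : Prog} {M N K : Memory} {m n : ℕ} :
      Exec P M m N → Exec Q N n K → Exec (Prog.seq P Q) M (m + n) K
  | condTrue {T : Test} {P Q : Prog} {M N : Memory} {n : ℕ} :
      T.Holds M → Exec P M n N → Exec (Prog.cond T P Q) M (n + 1) N
  | condFalse {T : Test} {P Q : Prog} {M N : Memory} {n : ℕ} :
      ¬ T.Holds M → Exec Q M n N → Exec (Prog.cond T P Q) M (n + 1) N
  | loopTrue {T : Test} {P : Prog} {M N K : Memory} {m n : ℕ} :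
      T.Holds M → Exec P M m N → Exec (Prog.loop T P) N n K →
      Exec (Prog.loop T P) M (m + n + 1) K
  | loopFalse {T : Test} {P : Prog} {M : Memory} :
      ¬ T.Holds M → Exec (Prog.loop T P) M 1 M

/-- The initial memory for the input word `w`: its length in cell `0`, its letters in the
cells `1, …, w.length`, and zeros elsewhere. -/
def initial (w : List ℝ) : Memory
  | 0 => (w.length : ℝ)
  | i + 1 => w.getD i 0

/-- The memory shows the output word `w` (in the format of the input). -/
def Shows (M : Memory) (w : List ℝ) : Prop :=
  M 0 = (w.length : ℝ) ∧ ∀ i : Fin w.length, M (i + 1) = w.get i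

/-- The memory shows the answer to a yes/no question: `1` for yes and `0` for no, in cell `0`. -/
def Answers (M : Memory) (Q : Prop) : Prop := (Q → M 0 = 1) ∧ (¬ Q → M 0 = 0)

/-- An algorithmic problem: its (encoded) instances, the input word and the input size of each
of them, and the condition that the final memory has to satisfy. -/
structure Problem : Type 1 where
  Inst : Type
  word : Inst → List ℝ
  size : Inst → ℕ
  Solved : Inst → Memory → Prop

/-- The problem can be solved in polynomial time in the real RAM model. -/
def Problem.InPolyTime (X : Problem) : Prop :=
  ∃ (P : Prog) (q : Polynomial ℕ), ∀ x : X.Inst, ∃ (n : ℕ) (M : Memory),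
    Exec P (initial (X.word x)) n M ∧ n ≤ q.eval (X.size x) ∧ X.Solved x M

/-! ### Encodings -/

/-- The coordinates as a word of four numbers. -/
def coordsWord (a : Coords) : List ℝ := List.ofFn fun j => (a j : ℝ)

/-- The binary length of the coordinates (with one bit for each sign). -/
def coordsSize (a : Coords) : ℕ := ∑ j : Fin 4, ((a j).natAbs.size + 1)

/-- `p` is a function on the lines in direction `u` with finite support, and each line of
the support passes through a point of `ℤ[ζ₅]`. -/
def IsData (u : ℂ) (p : Lines u → ℕ) : Prop :=
  (Function.support p).Finite ∧ ∀ ℓ ∈ Function.support p, ∃ z ∈ cycloInts, z ∈ ℓ.1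

/-- The list `l` encodes `p`: its entries `(a, n)` stand for pairwise distinct lines, `n` is the
value of `p` at the line through the point with coordinates `a`, and every line where `p` is
not zero is listed. -/
def EncodesData (u : ℂ) (p : Lines u → ℕ) (l : List (Coords × ℕ)) : Prop :=
  (l.map fun e => cycloLine u e.1).Nodup ∧ (∀ e ∈ l, p (cycloLine u e.1) = e.2) ∧
    ∀ ℓ : Lines u, p ℓ ≠ 0 → ∃ e ∈ l, ℓ = cycloLine u e.1

/-- The word of an encoded function: the number of lines, then for each line four coordinates
and the value. -/
def dataWord (l : List (Coords × ℕ)) : List ℝ :=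
  (l.length : ℝ) :: l.flatMap fun e => coordsWord e.1 ++ [(e.2 : ℝ)]

/-- The total binary length of an encoded function. -/
def dataSize (l : List (Coords × ℕ)) : ℕ :=
  (l.map fun e => coordsSize e.1 + (e.2.size + 1)).sum

/-- `t` and the list `l` encode the finite set `F`: its elements are the points `t + z`, where
`z` runs through the elements of `ℤ[ζ₅]` with coordinates in `l` (without repetition). -/
def EncodesSet (F : Finset ℂ) (t : ℂ) (l : List Coords) : Prop :=
  l.Nodup ∧ (F : Set ℂ) = {w | ∃ a ∈ l, w = t + point a}

/-- The word of an encoded finite set: the two Cartesian coordinates of `t`, then the coordinates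
of the elements. -/
def setWord (t : ℂ) (l : List Coords) : List ℝ :=
  t.re :: t.im :: l.flatMap coordsWord

/-- The size of an encoded finite set: `2` for the real numbers that give `t`, and the
total binary length of the coordinates. -/
def setSize (l : List Coords) : ℕ := 2 + (l.map coordsSize).sum

/-! ### The three problems -/

/-- Encoded pairs of functions `p₁`, `p₂` as they are given in the problems Consistency
and Reconstruction. -/
structure DataInstance (u₁ u₂ : ℂ) : Type where
  p₁ : Lines u₁ → ℕ
  p₂ : Lines u₂ → ℕ
  isData₁ : IsData u₁ p₁
  isData₂ : IsData u₂ p₂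
  l₁ : List (Coords × ℕ)
  l₂ : List (Coords × ℕ)
  encodes₁ : EncodesData u₁ p₁ l₁
  encodes₂ : EncodesData u₂ p₂ l₂

/-- Encoded finite subsets of Penrose model sets, as they are given in the problem Uniqueness. -/
structure SetInstance (π : Equiv.Perm (Fin 4)) : Type where
  F : Finset ℂ
  inPenrose : InPenrose π F
  t : ℂ
  l : List Coords
  encodes : EncodesSet F t l

/-- `F` is a finite subset of a Penrose model set with X-rays `p₁` and `p₂`. -/
def IsSolution (π : Equiv.Perm (Fin 4)) (u₁ u₂ : ℂ) (p₁ : Lines u₁ → ℕ) (p₂ : Lines u₂ → ℕ)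
    (F : Finset ℂ) : Prop :=
  InPenrose π F ∧ xray u₁ F = p₁ ∧ xray u₂ F = p₂

/-- Consistency: decide whether a finite subset of a Penrose model set has the given X-rays. -/
def consistency (π : Equiv.Perm (Fin 4)) (u₁ u₂ : ℂ) : Problem where
  Inst := DataInstance u₁ u₂
  word x := dataWord x.l₁ ++ dataWord x.l₂
  size x := dataSize x.l₁ + dataSize x.l₂
  Solved x M := Answers M (∃ F, IsSolution π u₁ u₂ x.p₁ x.p₂ F)

/-- Reconstruction: if a finite subset of a Penrose model set has the given X-rays, construct
one. -/
def reconstruction (π : Equiv.Perm (Fin 4)) (u₁ u₂ : ℂ) : Problem where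
  Inst := DataInstance u₁ u₂
  word x := dataWord x.l₁ ++ dataWord x.l₂
  size x := dataSize x.l₁ + dataSize x.l₂
  Solved x M := (∃ F, IsSolution π u₁ u₂ x.p₁ x.p₂ F) →
    ∃ (F : Finset ℂ) (t : ℂ) (l : List Coords),
      IsSolution π u₁ u₂ x.p₁ x.p₂ F ∧ EncodesSet F t l ∧ Shows M (setWord t l)

/-- Uniqueness: decide whether a different finite subset of a (possibly different) Penrose model
set has the same X-rays as the given one. -/
def uniqueness (π : Equiv.Perm (Fin 4)) (u₁ u₂ : ℂ) : Problem where
  Inst := SetInstance π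
  word x := setWord x.t x.l
  size x := setSize x.l
  Solved x M := Answers M
    (∃ F : Finset ℂ, F ≠ x.F ∧ InPenrose π F ∧ xray u₁ F = xray u₁ x.F ∧ xray u₂ F = xray u₂ x.F)

end

end PenroseTomography

open PenroseTomography

/-!
# Discrete tomography of Penrose model sets in polynomial time

Let `p₁` and `p₂` be the prescribed X-rays. A solution is a subset of the *grid* of the
intersections of the listed lines in the direction `u₁` (the rows) with those in the direction
`u₂` (the columns). By Cramer's rule the grid points have coordinates `X e / D`, with a fixed
denominator `D` and with numerators `X e` that are integer linear functions of the input
(`exists_grid`).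

A finite set `F` is contained in a Penrose model set if and only if, after a translation, it
consists of elements `z` of `ℤ[ζ₅]` with `z⋆` in the interior of a shifted window: almost every
shift is generic, because the boundaries of the pentagons are null sets (`inPenrose_iff`). So one
has to find a grid point `e₀`, which fixes the class modulo `ℤ[ζ₅]`, its residue class `r` modulo
`5`, and the centre of the window. Each point of `F` contributes five strict linear inequalities
for the centre. By Fourier–Motzkin elimination, a bounded and solvable system of this kind is
solved by a point that is determined by six of the boundary lines (`exists_six`). Hence there are
only polynomially many candidates `(e₀, r, k₁, …, k₆)`, and it suffices to try them all
(`exists_allowed`).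

For each candidate, the cells that lie in the window are known, and one asks for a matrix of zeros
and ones with given row sums and column sums that vanishes at the other cells. It is found by
orienting the edges of a bipartite graph with bounded indegrees, with an algorithm in which
overloaded vertices hand edges down to lower neighbours or are raised (`orientState_load_le`); a
potential bounds the number of rounds. `Describes.solvable_iff` combines these parts. For
Uniqueness, a different set with the same X-rays misses some point `f` of the given set
(`exists_ne_iff`), so that one solves the problem once for each `f`, with the cell of `f`
excluded.

The machine part is organized around the predicate `Comp`, "computable in polynomial time", for
functions between products of real numbers, natural numbers, propositions and arrays. Its closure
rules are used by `fun_prop`; those for loops rest on `Comp.withIter`. Natural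
numbers count in unary; real numbers are free. The machine cannot round, so remainders are found
by the subtraction of the numbers `D * 2 ^ t` for decreasing `t` (`rmod`), where the number of
digits of the input bounds `t`. This bound is found by doubling until the sum of the squares of
the input letters is reached (`exists_readInput`).
-/

/-! ### Arrays in the memory of the real RAM -/

namespace PenroseTomography

noncomputable section

open Function

/-- A store: a sequence of arrays of real numbers; `σ (k, i)` is the entry `i` of the array `k`. -/
abbrev Store : Type := ℕ × ℕ → ℝ

/-- The address of the entry `i` of the array `k`, where `B` is the start of the array area. The
array `0` is the low memory itself. -/
def addr (B : ℕ) (c : ℕ × ℕ) : ℕ := if c.1 = 0 then c.2 else B + 2 ^ c.1 * (2 * c.2 + 1)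

/-- The entries that are kept in the memory: the array `0` stops at the address `B`, and its first
four cells are used as registers. -/
def Valid (B : ℕ) (c : ℕ × ℕ) : Prop := c.1 = 0 → 4 ≤ c.2 ∧ c.2 < B

/-- The memory `M` holds the store `σ`, and register `0` holds the start `B` of the array area. -/
structure Lay (B : ℕ) (σ : Store) (M : Memory) : Prop where
  base : 4 ≤ B
  reg : M 0 = B
  mem : ∀ c, Valid B c → M (addr B c) = σ c

theorem two_pow_mul_odd_inj {a b i j : ℕ} (h : 2 ^ a * (2 * i + 1) = 2 ^ b * (2 * j + 1)) :
    a = b ∧ i = j := by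
  induction a generalizing b with
  | zero =>
    cases b with
    | zero => simp at h; exact ⟨rfl, by omega⟩
    | succ b => rw [pow_succ, mul_comm (2 ^ b) 2, mul_assoc] at h; omega
  | succ a ih =>
    cases b with
    | zero => rw [pow_succ, mul_comm (2 ^ a) 2, mul_assoc] at h; omega
    | succ b =>
      rw [pow_succ, pow_succ, mul_comm (2 ^ a) 2, mul_comm (2 ^ b) 2, mul_assoc, mul_assoc] at h
      have := ih (b := b) (by omega)
      exact ⟨by omega, this.2⟩

theorem addr_inj {B : ℕ} {c c' : ℕ × ℕ} (hc : Valid B c) (hc' : Valid B c')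
    (h : addr B c = addr B c') : c = c' := by
  obtain ⟨k, i⟩ := c
  obtain ⟨k', i'⟩ := c'
  simp only [addr, Valid] at *
  split_ifs at h with h1 h2 h2
  · simp [h1, h2, h]
  · have := hc h1; omega
  · have := hc' h2; omega
  · obtain ⟨rfl, rfl⟩ := two_pow_mul_odd_inj (Nat.add_left_cancel h); rfl

theorem four_le_addr {B : ℕ} (hB : 4 ≤ B) {c : ℕ × ℕ} (hc : Valid B c) : 4 ≤ addr B c := by
  unfold addr
  split_ifs with h
  · exact (hc h).1
  · omega

theorem Lay.set {B : ℕ} {σ : Store} {M : Memory} (h : Lay B σ M) {c : ℕ × ℕ} (hc : Valid B c)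
    (x : ℝ) : Lay B (update σ c x) (update M (addr B c) x) := by
  have h4 := four_le_addr h.base hc
  refine ⟨h.base, ?_, fun c' hc' => ?_⟩
  · rw [update_of_ne (by omega), h.reg]
  · by_cases e : c' = c
    · subst e; simp
    · rw [update_of_ne e, update_of_ne (fun h' => e (addr_inj hc' hc h')), h.mem _ hc']

theorem Lay.setReg {B : ℕ} {σ : Store} {M : Memory} (h : Lay B σ M) {r : ℕ} (hr : r ≠ 0)
    (hr' : r < 4) (x : ℝ) : Lay B σ (update M r x) := by
  refine ⟨h.base, ?_, fun c' hc' => ?_⟩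
  · rw [update_of_ne (Ne.symm hr), h.reg]
  · have := four_le_addr h.base hc'
    rw [update_of_ne (by omega), h.mem _ hc']

/-- A straight-line program. -/
def straight : List Instr → Prog
  | [] => Prog.skip
  | I :: l => Prog.seq (Prog.instr I) (straight l)

theorem exec_nil (M : Memory) : Exec (straight []) M 0 M := Exec.skip M

theorem exec_cons {I : Instr} {l : List Instr} {M N K : Memory} {n : ℕ} (h : Step I M N)
    (h' : Exec (straight l) N n K) : Exec (straight (I :: l)) M (1 + n) K :=
  Exec.seq (Exec.instr h) h'

/-- A natural number as a constant of the machine. -/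
def natConst (n : ℕ) : {c : ℝ // IsAlgebraic ℚ c} := ⟨n, isAlgebraic_natCast n⟩

/-- Load the entry `(k, 0)` into the register `r`. -/
def ldreg (r k : ℕ) : Prog :=
  straight [Instr.const r (natConst (2 ^ k)), Instr.add r r 0, Instr.load r r]

theorem exec_ldreg {B : ℕ} {σ : Store} {M : Memory} (h : Lay B σ M) {r k : ℕ} (hr : r ≠ 0)
    (hr' : r < 4) (hk : k ≠ 0) :
    Exec (ldreg r k) M 3 (update M r (σ (k, 0))) := by
  have e : M (2 ^ k + B) = σ (k, 0) := by
    rw [← h.mem (k, 0) (fun h => absurd h hk), addr, if_neg hk]; congr 1; ring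
  refine exec_cons (n := 1 + (1 + 0)) (Step.const M r (natConst (2 ^ k)))
    (exec_cons (n := 1 + 0) (Step.add _ r r 0) (exec_cons (n := 0)
    (Step.load _ r r (2 ^ k + B) ?_) ?_))
  · simp [natConst, hr.symm, h.reg]
  · have : 2 ^ k + B ≠ r := by have := h.base; have := Nat.one_le_two_pow (n := k); omega
    simp only [update_of_ne this, e, update_idem]
    exact exec_nil _

/-- Store the register `r` into the entry `(k, 0)`, with `r'` as an auxiliary register. -/
def streg (r r' k : ℕ) : Prog :=
  straight [Instr.const r' (natConst (2 ^ k)), Instr.add r' r' 0, Instr.store r' r]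

theorem exec_streg {B : ℕ} {σ : Store} {M : Memory} (h : Lay B σ M) {r r' k : ℕ} (hr : r' ≠ 0)
    (hr' : r' < 4) (hk : k ≠ 0) (hne : r ≠ r') :
    ∃ N, Exec (streg r r' k) M 3 N ∧ Lay B (update σ (k, 0) (M r)) N := by
  have hv : Valid B (k, 0) := fun h => absurd h hk
  have e : addr B (k, 0) = 2 ^ k + B := by rw [addr, if_neg hk]; ring
  refine ⟨_, exec_cons (Step.const ..) (exec_cons (Step.add ..) (exec_cons
    (Step.store _ _ _ (2 ^ k + B) ?_) (exec_nil _))), ?_⟩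
  · simp [natConst, hr.symm, h.reg]
  · rw [← e]
    simp only [update_idem, update_of_ne hne]
    exact (h.setReg hr hr' _).set hv _

/-- Started with a memory that holds `σ`, the program `P` halts after at most `n` steps with a
memory that holds `σ'`. -/
def RunsTo (B : ℕ) (P : Prog) (σ : Store) (n : ℕ) (σ' : Store) : Prop :=
  ∀ M, Lay B σ M → ∃ m ≤ n, ∃ M', Exec P M m M' ∧ Lay B σ' M'

theorem RunsTo.mono {B : ℕ} {P : Prog} {σ σ' : Store} {n n' : ℕ} (h : RunsTo B P σ n σ')
    (hn : n ≤ n') : RunsTo B P σ n' σ' := fun M hM => by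
  obtain ⟨m, hm, H⟩ := h M hM
  exact ⟨m, hm.trans hn, H⟩

theorem RunsTo.congr {B : ℕ} {P : Prog} {σ σ' σ'' : Store} {n : ℕ} (h : RunsTo B P σ n σ')
    (e : σ' = σ'') : RunsTo B P σ n σ'' := e ▸ h

theorem RunsTo.skip (B : ℕ) (σ : Store) : RunsTo B Prog.skip σ 0 σ := fun M hM =>
  ⟨0, le_rfl, M, Exec.skip M, hM⟩

theorem RunsTo.seq {B : ℕ} {P Q : Prog} {σ σ' σ'' : Store} {n m : ℕ} (h : RunsTo B P σ n σ')
    (h' : RunsTo B Q σ' m σ'') : RunsTo B (Prog.seq P Q) σ (n + m) σ'' := fun M hM => by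
  obtain ⟨n', hn, M', e, hM'⟩ := h M hM
  obtain ⟨m', hm, M'', e', hM''⟩ := h' M' hM'
  exact ⟨n' + m', add_le_add hn hm, M'', Exec.seq e e', hM''⟩

/-- `d := c` -/
def setC (d : ℕ) (c : {c : ℝ // IsAlgebraic ℚ c}) : Prog :=
  Prog.seq (Prog.instr (Instr.const 1 c)) (streg 1 2 d)

theorem runsTo_setC (B : ℕ) (σ : Store) {d : ℕ} (hd : d ≠ 0) (c : {c : ℝ // IsAlgebraic ℚ c}) :
    RunsTo B (setC d c) σ 4 (update σ (d, 0) c) := fun M hM => by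
  obtain ⟨N, e, hN⟩ := exec_streg (r := 1) (r' := 2) (k := d)
    (hM.setReg (r := 1) (by simp) (by simp) c) (by simp) (by simp) hd (by simp)
  refine ⟨4, le_rfl, N, Exec.seq (m := 1) (Exec.instr (Step.const ..)) e, ?_⟩
  simpa using hN

/-- The four arithmetic operations. -/
inductive Op : Type
  | add | sub | mul | div

/-- The value of an arithmetic operation. -/
def Op.val : Op → ℝ → ℝ → ℝ
  | add, x, y => x + y
  | sub, x, y => x - y
  | mul, x, y => x * y
  | div, x, y => x / y

/-- The machine instruction for an arithmetic operation on registers. -/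
def Op.instr : Op → ℕ → ℕ → ℕ → Instr
  | add => Instr.add
  | sub => Instr.sub
  | mul => Instr.mul
  | div => Instr.div

/-- `d := a ∘ b` for an arithmetic operation `∘` -/
def arith (o : Op) (d a b : ℕ) : Prog :=
  Prog.seq (ldreg 1 a) (Prog.seq (ldreg 2 b)
    (Prog.seq (Prog.instr (o.instr 1 1 2)) (streg 1 2 d)))

theorem runsTo_arith (B : ℕ) (σ : Store) (o : Op) {d a b : ℕ} (hd : d ≠ 0) (ha : a ≠ 0)
    (hb : b ≠ 0) (hdiv : o = Op.div → σ (b, 0) ≠ 0) :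
    RunsTo B (arith o d a b) σ 10 (update σ (d, 0) (o.val (σ (a, 0)) (σ (b, 0)))) := fun M hM => by
  have h1 := hM.setReg (r := 1) (by simp) (by simp) (σ (a, 0))
  have h2 := h1.setReg (r := 2) (by simp) (by simp) (σ (b, 0))
  obtain ⟨N, e, hN⟩ := exec_streg (r := 1) (r' := 2) (k := d)
    (h2.setReg (r := 1) (by simp) (by simp) (o.val (σ (a, 0)) (σ (b, 0))))
    (by simp) (by simp) hd (by simp)
  refine ⟨10, le_rfl, N, Exec.seq (m := 3) (exec_ldreg hM (by simp) (by simp) ha)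
    (Exec.seq (m := 3) (exec_ldreg h1 (by simp) (by simp) hb)
    (Exec.seq (m := 1) (n := 3) (Exec.instr ?_) e)), by simpa using hN⟩
  have e1 : update (update M 1 (σ (a, 0))) 2 (σ (b, 0)) 1 = σ (a, 0) := by simp
  have e2 : update (update M 1 (σ (a, 0))) 2 (σ (b, 0)) 2 = σ (b, 0) := by simp
  have e3 : ∀ K : Memory, (o = Op.div → K 2 ≠ 0) →
      Step (o.instr 1 1 2) K (update K 1 (o.val (K 1) (K 2))) := fun K hK => by
    cases o with
    | add => exact Step.add ..
    | sub => exact Step.sub ..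
    | mul => exact Step.mul ..
    | div => exact Step.div _ _ _ _ (hK rfl)
  have := e3 (update (update M 1 (σ (a, 0))) 2 (σ (b, 0))) (by rw [e2]; exact hdiv)
  rwa [e1, e2] at this

/-- Put the address of the entry `i` of the array `k` into register `1`, where `i` is the content
of the entry `(a, 0)`. -/
def addrReg (k a : ℕ) : Prog :=
  Prog.seq (ldreg 1 a) (if k = 0 then Prog.skip else
    straight [Instr.const 2 (natConst (2 ^ (k + 1))), Instr.mul 1 1 2,
      Instr.const 2 (natConst (2 ^ k)), Instr.add 1 1 2, Instr.add 1 1 0])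

theorem exec_addrReg {B : ℕ} {σ : Store} {M : Memory} (hM : Lay B σ M) {k a i : ℕ} (ha : a ≠ 0)
    (hi : σ (a, 0) = i) :
    ∃ m ≤ 8, ∃ N, Exec (addrReg k a) M m N ∧ Lay B σ N ∧ N 1 = addr B (k, i) := by
  have h1 := hM.setReg (r := 1) (by simp) (by simp) (σ (a, 0))
  unfold addrReg addr
  by_cases hk : k = 0
  · simp only [hk, if_true]
    exact ⟨3, by simp, _, Exec.seq (m := 3) (exec_ldreg hM (by simp) (by simp) ha) (Exec.skip _),
      h1, by simp [hi]⟩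
  · simp only [hk, if_false]
    refine ⟨8, le_rfl, _, Exec.seq (m := 3) (exec_ldreg hM (by simp) (by simp) ha)
      (exec_cons (Step.const ..) (exec_cons (Step.mul ..) (exec_cons (Step.const ..)
        (exec_cons (Step.add ..) (exec_cons (Step.add ..) (exec_nil _)))))), ?_, ?_⟩
    · exact ((((h1.setReg (by simp) (by simp) _).setReg (by simp) (by simp) _).setReg
        (by simp) (by simp) _).setReg (by simp) (by simp) _).setReg (by simp) (by simp) _
    · simp [hi, natConst, hM.reg]; ring

/-- `d := k[a]` -/
def readA (d k a : ℕ) : Prog :=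
  Prog.seq (addrReg k a) (Prog.seq (Prog.instr (Instr.load 1 1)) (streg 1 2 d))

theorem runsTo_readA {B : ℕ} {σ : Store} {d k a i : ℕ} (hd : d ≠ 0) (ha : a ≠ 0)
    (hi : σ (a, 0) = i) (hv : Valid B (k, i)) :
    RunsTo B (readA d k a) σ 12 (update σ (d, 0) (σ (k, i))) := fun M hM => by
  obtain ⟨m, hm, N, e, hN, e1⟩ := exec_addrReg hM (k := k) ha hi
  obtain ⟨N', e', hN'⟩ := exec_streg (r := 1) (r' := 2) (k := d)
    (hN.setReg (r := 1) (by simp) (by simp) (σ (k, i))) (by simp) (by simp) hd (by simp)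
  refine ⟨m + (1 + 3), by omega, N', Exec.seq e (Exec.seq (m := 1) (Exec.instr ?_) e'),
    by simpa using hN'⟩
  rw [← hN.mem _ hv]
  exact Step.load _ _ _ _ e1

/-- `k[a] := b` -/
def writeA (k a b : ℕ) : Prog :=
  Prog.seq (addrReg k a) (Prog.seq (ldreg 2 b) (Prog.instr (Instr.store 1 2)))

theorem runsTo_writeA {B : ℕ} {σ : Store} {k a b i : ℕ} (ha : a ≠ 0) (hb : b ≠ 0)
    (hi : σ (a, 0) = i) (hv : Valid B (k, i)) :
    RunsTo B (writeA k a b) σ 12 (update σ (k, i) (σ (b, 0))) := fun M hM => by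
  obtain ⟨m, hm, N, e, hN, e1⟩ := exec_addrReg hM (k := k) ha hi
  have h2 := hN.setReg (r := 2) (by simp) (by simp) (σ (b, 0))
  refine ⟨m + (3 + 1), by omega, _, Exec.seq e (Exec.seq (exec_ldreg hN (by simp) (by simp) hb)
    (Exec.instr (Step.store _ _ _ (addr B (k, i)) ?_))), ?_⟩
  · simpa using e1
  · simpa using h2.set hv (σ (b, 0))

/-- `if a < b then P else Q` -/
def ifLt (a b : ℕ) (P Q : Prog) : Prog :=
  Prog.seq (ldreg 1 a) (Prog.seq (ldreg 2 b) (Prog.cond (Test.lt 1 2) P Q))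

theorem runsTo_ifLt {B : ℕ} {σ σ' : Store} {a b n : ℕ} {P Q : Prog} (ha : a ≠ 0) (hb : b ≠ 0)
    (hP : σ (a, 0) < σ (b, 0) → RunsTo B P σ n σ')
    (hQ : ¬ σ (a, 0) < σ (b, 0) → RunsTo B Q σ n σ') :
    RunsTo B (ifLt a b P Q) σ (n + 7) σ' := fun M hM => by
  have h1 := hM.setReg (r := 1) (by simp) (by simp) (σ (a, 0))
  have h2 := h1.setReg (r := 2) (by simp) (by simp) (σ (b, 0))
  by_cases h : σ (a, 0) < σ (b, 0)
  · obtain ⟨m, hm, N, e, hN⟩ := hP h _ h2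
    exact ⟨3 + (3 + (m + 1)), by omega, N, Exec.seq (exec_ldreg hM (by simp) (by simp) ha)
      (Exec.seq (exec_ldreg h1 (by simp) (by simp) hb)
      (Exec.condTrue (by simpa [Test.Holds] using h) e)), hN⟩
  · obtain ⟨m, hm, N, e, hN⟩ := hQ h _ h2
    exact ⟨3 + (3 + (m + 1)), by omega, N, Exec.seq (exec_ldreg hM (by simp) (by simp) ha)
      (Exec.seq (exec_ldreg h1 (by simp) (by simp) hb)
      (Exec.condFalse (by simpa [Test.Holds] using h) e)), hN⟩

/-- `while a < b do P` -/
def whileLt (a b : ℕ) (P : Prog) : Prog :=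
  Prog.seq (ldreg 1 a) (Prog.seq (ldreg 2 b)
    (Prog.loop (Test.lt 1 2) (Prog.seq P (Prog.seq (ldreg 1 a) (ldreg 2 b)))))

/-- A loop with the invariant `I`, indexed by the number of rounds. -/
theorem runsTo_whileLt {B : ℕ} {a b c T : ℕ} {P : Prog} (ha : a ≠ 0) (hb : b ≠ 0)
    (I : ℕ → Store → Prop) (hlt : ∀ t < T, ∀ σ, I t σ → σ (a, 0) < σ (b, 0))
    (hend : ∀ σ, I T σ → ¬ σ (a, 0) < σ (b, 0))
    (hP : ∀ t < T, ∀ σ, I t σ → ∃ σ', RunsTo B P σ c σ' ∧ I (t + 1) σ') {σ : Store}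
    (h0 : I 0 σ) :
    ∃ σ', RunsTo B (whileLt a b P) σ (T * (c + 7) + 7) σ' ∧ I T σ' := by
  have key : ∀ k t σ, t + k = T → I t σ → ∃ σ', I T σ' ∧ ∀ M, Lay B σ M →
      M 1 = σ (a, 0) → M 2 = σ (b, 0) → ∃ m ≤ k * (c + 7) + 1, ∃ N,
        Exec (Prog.loop (Test.lt 1 2) (Prog.seq P (Prog.seq (ldreg 1 a) (ldreg 2 b)))) M m N ∧
          Lay B σ' N := by
    intro k
    induction k with
    | zero =>
      intro t σ ht hI
      obtain rfl : t = T := by omega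
      refine ⟨σ, hI, fun M hM e1 e2 => ⟨1, by simp, M, Exec.loopFalse ?_, hM⟩⟩
      simpa [Test.Holds, e1, e2] using hend σ hI
    | succ k ih =>
      intro t σ ht hI
      obtain ⟨σ', hσ', hI'⟩ := hP t (by omega) σ hI
      obtain ⟨τ, hτ, H⟩ := ih (t + 1) σ' (by omega) hI'
      refine ⟨τ, hτ, fun M hM e1 e2 => ?_⟩
      obtain ⟨m, hm, N, e, hN⟩ := hσ' M hM
      have h1 := hN.setReg (r := 1) (by simp) (by simp) (σ' (a, 0))
      have h2 := h1.setReg (r := 2) (by simp) (by simp) (σ' (b, 0))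
      obtain ⟨m', hm', K, e', hK⟩ := H _ h2 (by simp) (by simp)
      refine ⟨(m + (3 + 3)) + m' + 1, ?_, K, Exec.loopTrue ?_ (Exec.seq e (Exec.seq
        (exec_ldreg hN (by simp) (by simp) ha) (exec_ldreg h1 (by simp) (by simp) hb))) e', hK⟩
      · rw [add_mul]; omega
      · simpa [Test.Holds, e1, e2] using hlt t (by omega) σ hI
  obtain ⟨σ', hσ', H⟩ := key T 0 σ (by simp) h0
  refine ⟨σ', fun M hM => ?_, hσ'⟩
  have h1 := hM.setReg (r := 1) (by simp) (by simp) (σ (a, 0))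
  have h2 := h1.setReg (r := 2) (by simp) (by simp) (σ (b, 0))
  obtain ⟨m, hm, N, e, hN⟩ := H _ h2 (by simp) (by simp)
  exact ⟨3 + (3 + m), by omega, N, Exec.seq (exec_ldreg hM (by simp) (by simp) ha)
    (Exec.seq (exec_ldreg h1 (by simp) (by simp) hb) e), hN⟩

end

end PenroseTomography

/-! ### Polynomial time computable functions -/

namespace PenroseTomography

noncomputable section

open Function

/-- A type of scalars: its elements are represented by real numbers. The size is used to bound
running times, and it bounds the number of rounds of a loop over a natural number. -/
class Scal (α : Type) where
  val : α → ℝ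
  size : α → ℕ
  zero : α
  val_zero : val zero = 0

/-- A type of contexts: the values of finitely many scalar and array variables. -/
class Ctx (γ : Type) where
  /-- An assignment of arrays of the store to the variables. -/
  Slots : Type
  /-- All variables are assigned to arrays `k` with `0 < k < d`. -/
  Below : Slots → ℕ → Prop
  /-- The store contains the values of the variables. -/
  Rep : Slots → γ → Store → Prop
  /-- The size of the values; running times are bounded by polynomials in it. -/
  size : γ → ℕ
  below_mono : ∀ {s d d'}, Below s d → d ≤ d' → Below s d'
  rep_congr : ∀ {s d g} {σ σ' : Store}, Below s d → (∀ k < d, ∀ i, σ' (k, i) = σ (k, i)) →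
    Rep s g σ → Rep s g σ'

instance Scal.toCtx {α : Type} [Scal α] : Ctx α where
  Slots := ℕ
  Below s d := s ≠ 0 ∧ s < d
  Rep s a σ := σ (s, 0) = Scal.val a
  size := Scal.size
  below_mono h h' := ⟨h.1, h.2.trans_le h'⟩
  rep_congr h h' e := (h' _ h.2 _).trans e

/-- An array does not contribute to the size: only the scalars that bound loops do. -/
instance arrayCtx {α : Type} [Scal α] : Ctx (ℕ → α) where
  Slots := ℕ
  Below s d := s ≠ 0 ∧ s < d
  Rep s a σ := ∀ i, σ (s, i) = Scal.val (a i)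
  size _ := 0
  below_mono h h' := ⟨h.1, h.2.trans_le h'⟩
  rep_congr h h' e i := (h' _ h.2 _).trans (e i)

instance prodCtx {γ δ : Type} [Ctx γ] [Ctx δ] : Ctx (γ × δ) where
  Slots := Ctx.Slots γ × Ctx.Slots δ
  Below s d := Ctx.Below s.1 d ∧ Ctx.Below s.2 d
  Rep s g σ := Ctx.Rep s.1 g.1 σ ∧ Ctx.Rep s.2 g.2 σ
  size g := Ctx.size g.1 + Ctx.size g.2
  below_mono h h' := ⟨Ctx.below_mono h.1 h', Ctx.below_mono h.2 h'⟩
  rep_congr h h' e := ⟨Ctx.rep_congr h.1 h' e.1, Ctx.rep_congr h.2 h' e.2⟩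

/-- Real numbers have the size zero, as no loop depends on them. -/
instance : Scal ℝ := ⟨id, fun _ => 0, 0, rfl⟩

/-- Natural numbers have themselves as size, so that loops of length `n` are polynomial. -/
instance : Scal ℕ := ⟨fun n => n, id, 0, Nat.cast_zero⟩

open Classical in
instance : Scal Prop := ⟨fun p => if p then 1 else 0, fun _ => 0, False, if_neg id⟩

/-- The arrays from `d` on are zero. -/
def Clean (d : ℕ) (σ : Store) : Prop := ∀ k i, d ≤ k → σ (k, i) = 0

theorem Clean.mono {d d' : ℕ} {σ : Store} (h : Clean d σ) (hd : d ≤ d') : Clean d' σ :=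
  fun k i hk => h k i (hd.trans hk)

theorem Clean.update {d : ℕ} {σ : Store} (h : Clean d σ) {k : ℕ} (hk : k < d) (i : ℕ) (x : ℝ) :
    Clean d (update σ (k, i) x) := fun k' i' hk' => by
  rw [update_of_ne (by rintro ⟨⟩; omega)]; exact h k' i' hk'

/-- The natural-valued function `b` is bounded by a polynomial in the size of its argument. -/
def PolyBdd {γ : Type} [Ctx γ] (b : γ → ℕ) : Prop :=
  ∃ q : Polynomial ℕ, ∀ g, b g ≤ q.eval (Ctx.size g)

/-- The function `f` can be computed in polynomial time, by a program that extends the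
store by scalars in the arrays from `d` to `d' - 1`; the variables of the result may
also be variables of the argument. -/
@[fun_prop]
def Comp {γ δ : Type} [Ctx γ] [Ctx δ] (f : γ → δ) : Prop :=
  PolyBdd (fun g => Ctx.size (f g)) ∧ ∀ (s : Ctx.Slots γ) (d : ℕ), d ≠ 0 → Ctx.Below s d →
    ∃ (s' : Ctx.Slots δ) (d' : ℕ) (P : Prog) (q : Polynomial ℕ), d ≤ d' ∧ Ctx.Below s' d' ∧
      ∀ B g σ, Ctx.Rep s g σ → Clean d σ → ∃ σ', RunsTo B P σ (q.eval (Ctx.size g)) σ' ∧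
        (∀ k < d, ∀ i, σ' (k, i) = σ (k, i)) ∧ (∀ k i, d ≤ k → i ≠ 0 → σ' (k, i) = 0) ∧
        Clean d' σ' ∧ Ctx.Rep s' (f g) σ'

variable {γ δ ε α β : Type} [Ctx γ] [Ctx δ] [Ctx ε] [Scal α] [Scal β]

theorem eval_mono (q : Polynomial ℕ) {a b : ℕ} (h : a ≤ b) : q.eval a ≤ q.eval b := by
  rw [Polynomial.eval_eq_sum_range, Polynomial.eval_eq_sum_range]
  gcongr

theorem PolyBdd.mono {b b' : γ → ℕ} (h : PolyBdd b) (hb : ∀ g, b' g ≤ b g) : PolyBdd b' := by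
  obtain ⟨q, hq⟩ := h
  exact ⟨q, fun g => (hb g).trans (hq g)⟩

theorem PolyBdd.const (n : ℕ) : PolyBdd (fun _ : γ => n) := ⟨Polynomial.C n, fun g => by simp⟩

theorem PolyBdd.size : PolyBdd (fun g : γ => Ctx.size g) := ⟨Polynomial.X, fun g => by simp⟩

theorem PolyBdd.add {b b' : γ → ℕ} (h : PolyBdd b) (h' : PolyBdd b') :
    PolyBdd (fun g => b g + b' g) := by
  obtain ⟨q, hq⟩ := h
  obtain ⟨q', hq'⟩ := h'
  exact ⟨q + q', fun g => by rw [Polynomial.eval_add]; exact add_le_add (hq g) (hq' g)⟩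

theorem PolyBdd.mul {b b' : γ → ℕ} (h : PolyBdd b) (h' : PolyBdd b') :
    PolyBdd (fun g => b g * b' g) := by
  obtain ⟨q, hq⟩ := h
  obtain ⟨q', hq'⟩ := h'
  exact ⟨q * q', fun g => by rw [Polynomial.eval_mul]; exact Nat.mul_le_mul (hq g) (hq' g)⟩

theorem PolyBdd.comp (q : Polynomial ℕ) {b : γ → ℕ} (h : PolyBdd b) :
    PolyBdd (fun g => q.eval (b g)) := by
  obtain ⟨q', hq'⟩ := h
  exact ⟨q.comp q', fun g => by rw [Polynomial.eval_comp]; exact eval_mono q (hq' g)⟩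

@[fun_prop] theorem Comp.id : Comp (fun x : γ => x) :=
  ⟨PolyBdd.size, fun s d _ hs => ⟨s, d, Prog.skip, 0, le_rfl, hs, fun B _ σ h h' =>
    ⟨σ, (RunsTo.skip B σ).mono (by simp), fun _ _ _ => rfl, fun k i hk _ => h' k i hk, h', h⟩⟩⟩

@[fun_prop] theorem Comp.comp {f : δ → ε} {g : γ → δ} (hf : Comp f) (hg : Comp g) :
    Comp (fun x => f (g x)) := by
  obtain ⟨⟨qf, hqf⟩, hf⟩ := hf
  obtain ⟨⟨qg, hqg⟩, hg⟩ := hg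
  refine ⟨(PolyBdd.comp qf ⟨qg, hqg⟩).mono fun x => hqf _, fun s d hd hs => ?_⟩
  obtain ⟨s₁, d₁, P₁, q₁, hd₁, hs₁, H₁⟩ := hg s d hd hs
  obtain ⟨s₂, d₂, P₂, q₂, hd₂, hs₂, H₂⟩ := hf s₁ d₁ (by omega) hs₁
  refine ⟨s₂, d₂, Prog.seq P₁ P₂, q₁ + q₂.comp qg, hd₁.trans hd₂, hs₂, fun B x σ hr hc => ?_⟩
  obtain ⟨σ₁, r₁, a₁, z₁, c₁, R₁⟩ := H₁ B x σ hr hc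
  obtain ⟨σ₂, r₂, a₂, z₂, c₂, R₂⟩ := H₂ B (g x) σ₁ R₁ c₁
  refine ⟨σ₂, (r₁.seq r₂).mono ?_, fun k hk i => ?_, fun k i hk hi => ?_, c₂, R₂⟩
  · rw [Polynomial.eval_add, Polynomial.eval_comp]
    exact Nat.add_le_add_left (eval_mono _ (hqg x)) _
  · rw [a₂ k (by omega), a₁ k hk]
  · by_cases h : k < d₁
    · rw [a₂ k h, z₁ k i hk hi]
    · exact z₂ k i (by omega) hi

@[fun_prop] theorem Comp.prodMk {f : γ → δ} {g : γ → ε} (hf : Comp f) (hg : Comp g) :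
    Comp (fun x => (f x, g x)) := by
  obtain ⟨hqf, hf⟩ := hf
  obtain ⟨hqg, hg⟩ := hg
  refine ⟨hqf.add hqg, fun s d hd hs => ?_⟩
  obtain ⟨s₁, d₁, P₁, q₁, hd₁, hs₁, H₁⟩ := hf s d hd hs
  obtain ⟨s₂, d₂, P₂, q₂, hd₂, hs₂, H₂⟩ := hg s d₁ (by omega) (Ctx.below_mono hs hd₁)
  refine ⟨(s₁, s₂), d₂, Prog.seq P₁ P₂, q₁ + q₂, hd₁.trans hd₂,
    ⟨Ctx.below_mono hs₁ hd₂, hs₂⟩, fun B x σ hr hc => ?_⟩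
  obtain ⟨σ₁, r₁, a₁, z₁, c₁, R₁⟩ := H₁ B x σ hr hc
  obtain ⟨σ₂, r₂, a₂, z₂, c₂, R₂⟩ := H₂ B x σ₁ (Ctx.rep_congr hs a₁ hr) c₁
  refine ⟨σ₂, (r₁.seq r₂).mono (by rw [Polynomial.eval_add]), fun k hk i => ?_,
    fun k i hk hi => ?_, c₂, Ctx.rep_congr hs₁ a₂ R₁, R₂⟩
  · rw [a₂ k (by omega), a₁ k hk]
  · by_cases h : k < d₁
    · rw [a₂ k h, z₁ k i hk hi]
    · exact z₂ k i (by omega) hi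

@[fun_prop] theorem Comp.fst {f : γ → δ × ε} (hf : Comp f) : Comp (fun x => (f x).1) :=
  Comp.comp (f := Prod.fst) ⟨PolyBdd.size.mono fun _ => Nat.le_add_right _ _, fun s d _ hs =>
    ⟨s.1, d, Prog.skip, 0, le_rfl, hs.1, fun B _ σ h h' =>
      ⟨σ, (RunsTo.skip B σ).mono (by simp), fun _ _ _ => rfl, fun k i hk _ => h' k i hk, h',
        h.1⟩⟩⟩ hf

@[fun_prop] theorem Comp.snd {f : γ → δ × ε} (hf : Comp f) : Comp (fun x => (f x).2) :=
  Comp.comp (f := Prod.snd) ⟨PolyBdd.size.mono fun _ => Nat.le_add_left _ _, fun s d _ hs =>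
    ⟨s.2, d, Prog.skip, 0, le_rfl, hs.2, fun B _ σ h h' =>
      ⟨σ, (RunsTo.skip B σ).mono (by simp), fun _ _ _ => rfl, fun k i hk _ => h' k i hk, h',
        h.2⟩⟩⟩ hf

/-- `d := a` -/
def mov (d a : ℕ) : Prog := Prog.seq (ldreg 1 a) (streg 1 2 d)

theorem runsTo_mov (B : ℕ) (σ : Store) {d a : ℕ} (hd : d ≠ 0) (ha : a ≠ 0) :
    RunsTo B (mov d a) σ 6 (update σ (d, 0) (σ (a, 0))) := fun M hM => by
  obtain ⟨N, e, hN⟩ := exec_streg (r := 1) (r' := 2) (k := d)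
    (hM.setReg (r := 1) (by simp) (by simp) (σ (a, 0))) (by simp) (by simp) hd (by simp)
  exact ⟨6, le_rfl, N, Exec.seq (m := 3) (exec_ldreg hM (by simp) (by simp) ha) e,
    by simpa using hN⟩

/-- Set the first entries of the arrays `d, …, d + m - 1` to zero. -/
def zeros (d : ℕ) : ℕ → Prog
  | 0 => Prog.skip
  | m + 1 => Prog.seq (zeros d m) (setC (d + m) (natConst 0))

theorem runsTo_zeros (B : ℕ) (σ : Store) {d : ℕ} (hd : d ≠ 0) (m : ℕ) :
    RunsTo B (zeros d m) σ (4 * m)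
      (fun c => if d ≤ c.1 ∧ c.1 < d + m ∧ c.2 = 0 then 0 else σ c) := by
  induction m with
  | zero =>
    refine (RunsTo.skip B σ).congr ?_
    funext c; rw [if_neg (by omega)]
  | succ m ih =>
    refine (ih.seq (runsTo_setC B _ (d := d + m) (by omega) (natConst 0))).congr ?_
    funext ⟨k, i⟩
    simp only [update_apply, Prod.mk.injEq, natConst, Nat.cast_zero]
    split_ifs <;> first | rfl | omega

/-- A scalar-valued function can be computed in polynomial time if there is a program that puts
its value into the first free array, and that does not change the store otherwise. -/
theorem Comp.of_eval {f : γ → α} (hb : PolyBdd (fun g => Scal.size (f g)))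
    (h : ∀ (s : Ctx.Slots γ) (d : ℕ), d ≠ 0 → Ctx.Below s d → ∃ (P : Prog) (b : γ → ℕ),
      PolyBdd b ∧ ∀ B g σ, Ctx.Rep s g σ → Clean d σ →
        RunsTo B P σ (b g) (update σ (d, 0) (Scal.val (f g)))) : Comp f := by
  refine ⟨hb, fun s d hd hs => ?_⟩
  obtain ⟨P, b, ⟨q, hq⟩, H⟩ := h s d hd hs
  refine ⟨d, d + 1, P, q, by omega, ⟨hd, by omega⟩, fun B g σ hr hc => ⟨_,
    (H B g σ hr hc).mono (hq g), fun k hk i => ?_, fun k i hk hi => ?_, ?_, ?_⟩⟩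
  · rw [update_of_ne (by rintro ⟨⟩; omega)]
  · rw [update_of_ne (by rintro ⟨⟩; omega), hc k i hk]
  · exact (hc.mono (by omega)).update (by omega) _ _
  · exact update_self ..

theorem Comp.eval {f : γ → α} (hf : Comp f) (s : Ctx.Slots γ) {d : ℕ} (hd : d ≠ 0)
    (hs : Ctx.Below s d) : ∃ (P : Prog) (q : Polynomial ℕ),
      ∀ B g σ, Ctx.Rep s g σ → Clean d σ →
        RunsTo B P σ (q.eval (Ctx.size g)) (update σ (d, 0) (Scal.val (f g))) := by
  obtain ⟨(s' : ℕ), d', P, q, hd', hs', H⟩ := hf.2 s d hd hs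
  refine ⟨Prog.seq P (Prog.seq (mov (d' + 1) s') (Prog.seq (zeros d (d' + 1 - d))
    (Prog.seq (mov d (d' + 1)) (setC (d' + 1) (natConst 0))))),
    q + Polynomial.C (6 + (4 * (d' + 1 - d) + (6 + 4))), fun B g σ hr hc => ?_⟩
  obtain ⟨σ', r, a, z, c, R⟩ := H B g σ hr hc
  have hs1 : s' ≠ 0 := hs'.1
  have e : σ' (s', 0) = Scal.val (f g) := R
  generalize ht : d' + 1 = t
  have hm : d + (t - d) = t := by omega
  have r2 := runsTo_mov B σ' (d := t) (a := s') (by omega) hs1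
  have r3 := runsTo_zeros B (update σ' (t, 0) (σ' (s', 0))) hd (t - d)
  rw [hm, e] at r3
  rw [e] at r2
  refine ((r.seq (r2.seq (r3.seq ((runsTo_mov B _ hd (by omega)).seq
    (runsTo_setC B _ (d := t) (by omega) (natConst 0)))))).mono (by
      rw [Polynomial.eval_add, Polynomial.eval_C])).congr ?_
  funext ⟨k, i⟩
  have hne : d ≠ t := by omega
  simp only [update_apply, Prod.mk.injEq, natConst, Nat.cast_zero, lt_irrefl, and_true, and_false,
    if_false, if_true]
  split_ifs with h1 h2 h3 h3
  · omega
  · rw [hc k i (by omega)]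
  · rfl
  · rw [hc k i (by omega)]
  · by_cases h5 : k < d
    · rw [a k h5]
    · rw [hc k i (by omega)]
      by_cases h6 : i = 0
      · exact c k i (by omega)
      · exact z k i (by omega) h6

end

end PenroseTomography

/-! ### Primitive computations and loops -/

namespace PenroseTomography

noncomputable section

open Function

variable {γ δ ε α β : Type} [Ctx γ] [Ctx δ] [Ctx ε] [Scal α] [Scal β]

theorem rep_update {s : Ctx.Slots γ} {d : ℕ} (hs : Ctx.Below s d) {g : γ} {σ : Store}
    (h : Ctx.Rep s g σ) {k : ℕ} (hk : d ≤ k) (i : ℕ) (x : ℝ) :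
    Ctx.Rep s g (update σ (k, i) x) :=
  Ctx.rep_congr hs (fun k' hk' i' => update_of_ne (by rintro ⟨⟩; omega) _ _) h

/-- Scalars that the machine can load as a constant. -/
class AlgConst (c : α) : Prop where
  isAlgebraic : IsAlgebraic ℚ (Scal.val c)

instance (n : ℕ) : AlgConst n := ⟨isAlgebraic_natCast n⟩

instance (n : ℕ) : AlgConst (n : ℝ) := ⟨isAlgebraic_natCast n⟩

instance : AlgConst (0 : ℝ) := ⟨isAlgebraic_zero⟩

instance : AlgConst (1 : ℝ) := ⟨isAlgebraic_one⟩

instance (n : ℕ) [n.AtLeastTwo] : AlgConst (ofNat(n) : ℝ) :=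
  ⟨isAlgebraic_natCast (R := ℚ) (OfNat.ofNat n)⟩

instance (p : Prop) : AlgConst p :=
  ⟨by simp only [Scal.val]; split_ifs; exacts [isAlgebraic_one, isAlgebraic_zero]⟩

@[fun_prop] theorem Comp.const (c : α) [hc : AlgConst c] : Comp (fun _ : γ => c) :=
  Comp.of_eval (PolyBdd.const _) fun _ d hd _ =>
    ⟨setC d ⟨Scal.val c, hc.isAlgebraic⟩, _, PolyBdd.const 4, fun B _ σ _ _ =>
      runsTo_setC B σ hd _⟩

/-- A scalar function is computable if its value is, as a real number. -/
theorem Comp.of_val {f : γ → α} (hb : PolyBdd (fun g => Scal.size (f g)))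
    (h : Comp (fun g => Scal.val (f g))) : Comp f :=
  Comp.of_eval hb fun s d hd hs => by
    obtain ⟨P, q, H⟩ := h.eval s hd hs
    exact ⟨P, _, PolyBdd.comp q PolyBdd.size, H⟩

theorem Comp.toVal {f : γ → α} (hf : Comp f) : Comp (fun g => Scal.val (f g)) :=
  Comp.of_eval (PolyBdd.const 0) fun s d hd hs => by
    obtain ⟨P, q, H⟩ := hf.eval s hd hs
    exact ⟨P, _, PolyBdd.comp q PolyBdd.size, H⟩

theorem Comp.binary {f g : γ → ℝ} {h : γ → α} (hf : Comp f) (hg : Comp g)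
    (hb : PolyBdd (fun x => Scal.size (h x))) (P : ℕ → Prog) (n : ℕ)
    (hP : ∀ B d σ x, d ≠ 0 → Clean (d + 2) σ → σ (d, 0) = f x → σ (d + 1, 0) = g x →
      RunsTo B (P d) σ n (update σ (d, 0) (Scal.val (h x)))) : Comp h :=
  Comp.of_eval hb fun s d hd hs => by
    obtain ⟨P₁, q₁, H₁⟩ := hf.eval s hd hs
    obtain ⟨P₂, q₂, H₂⟩ := hg.eval s (d := d + 1) (by omega) (Ctx.below_mono hs (by omega))
    refine ⟨Prog.seq P₁ (Prog.seq P₂ (Prog.seq (P d) (setC (d + 1) (natConst 0)))), _,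
      (PolyBdd.comp q₁ PolyBdd.size).add ((PolyBdd.comp q₂ PolyBdd.size).add
        (PolyBdd.const (n + 4))), fun B x σ hr hc => ?_⟩
    have r₁ := H₁ B x σ hr hc
    have c₁ := (hc.mono (Nat.le_succ d)).update (Nat.lt_succ_self d) 0 (Scal.val (f x))
    have r₂ := H₂ B x _ (rep_update hs hr le_rfl 0 _) c₁
    have r₃ := hP B d _ x hd ((c₁.mono (Nat.le_succ _)).update (Nat.lt_succ_self (d + 1)) 0
      (Scal.val (g x))) (by rw [update_of_ne (by simp), update_self]; rfl)
      (by rw [update_self]; rfl)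
    refine (r₁.seq (r₂.seq (r₃.seq (runsTo_setC B _ (d := d + 1) (by omega) _)))).congr ?_
    funext ⟨k, i⟩
    simp only [update_apply, Prod.mk.injEq, natConst, Nat.cast_zero]
    split_ifs with h1 h2
    · omega
    · exact (hc k i (by omega)).symm
    · rfl
    · rfl

@[fun_prop] theorem Comp.lt {f g : γ → ℝ} (hf : Comp f) (hg : Comp g) : Comp (fun x => f x < g x) :=
  Comp.binary hf hg (PolyBdd.const 0) (fun d => ifLt d (d + 1) (setC d (natConst 1))
    (setC d (natConst 0))) 11 fun B d σ x hd _ e1 e2 => by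
    refine runsTo_ifLt hd (by omega) (fun h => ?_) (fun h => ?_)
    · rw [e1, e2] at h
      simpa [natConst, Scal.val, h] using runsTo_setC B σ hd (natConst 1)
    · rw [e1, e2] at h
      simpa [natConst, Scal.val, h] using runsTo_setC B σ hd (natConst 0)

@[fun_prop] theorem Comp.add {f g : γ → ℝ} (hf : Comp f) (hg : Comp g) :
    Comp (fun x => f x + g x) :=
  Comp.binary hf hg (PolyBdd.const 0) (fun d => arith Op.add d d (d + 1)) 10
    fun B d σ x hd _ e1 e2 => by
    simpa [e1, e2, Op.val, Scal.val] using
      runsTo_arith B σ Op.add hd hd (Nat.succ_ne_zero d) (by simp)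

@[fun_prop] theorem Comp.sub {f g : γ → ℝ} (hf : Comp f) (hg : Comp g) :
    Comp (fun x => f x - g x) :=
  Comp.binary hf hg (PolyBdd.const 0) (fun d => arith Op.sub d d (d + 1)) 10
    fun B d σ x hd _ e1 e2 => by
    simpa [e1, e2, Op.val, Scal.val] using
      runsTo_arith B σ Op.sub hd hd (Nat.succ_ne_zero d) (by simp)

@[fun_prop] theorem Comp.mul {f g : γ → ℝ} (hf : Comp f) (hg : Comp g) :
    Comp (fun x => f x * g x) :=
  Comp.binary hf hg (PolyBdd.const 0) (fun d => arith Op.mul d d (d + 1)) 10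
    fun B d σ x hd _ e1 e2 => by
    simpa [e1, e2, Op.val, Scal.val] using
      runsTo_arith B σ Op.mul hd hd (Nat.succ_ne_zero d) (by simp)

/-- The machine does not divide by zero, so the divisor is compared with zero first. -/
@[fun_prop] theorem Comp.div {f g : γ → ℝ} (hf : Comp f) (hg : Comp g) :
    Comp (fun x => f x / g x) :=
  Comp.binary hf hg (PolyBdd.const 0) (fun d => ifLt (d + 2) (d + 1) (arith Op.div d d (d + 1))
    (ifLt (d + 1) (d + 2) (arith Op.div d d (d + 1)) (setC d (natConst 0)))) 24
    fun B d σ x hd hc e1 e2 => by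
    have e3 := hc (d + 2) 0 le_rfl
    have key : g x ≠ 0 → RunsTo B (arith Op.div d d (d + 1)) σ 10
        (update σ (d, 0) (Scal.val (f x / g x))) := fun h => by
      simpa [e1, e2, Op.val, Scal.val] using
        runsTo_arith B σ Op.div hd hd (Nat.succ_ne_zero d) (by rw [e2]; simpa)
    refine runsTo_ifLt (n := 17) (by omega) (by omega) (fun h => ?_) (fun h => ?_)
    · rw [e2, e3] at h
      exact (key h.ne').mono (by simp)
    · refine runsTo_ifLt (n := 10) (by omega) (by omega) (fun h => ?_) (fun h' => ?_)
      · rw [e2, e3] at h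
        exact key h.ne
      · rw [e2, e3] at h h'
        have : g x = 0 := le_antisymm (not_lt.1 h) (not_lt.1 h')
        rw [this, div_zero]
        simpa [natConst, Scal.val] using
          (runsTo_setC B σ hd (natConst 0)).mono (n' := 10) (by simp)

/-- The entry `i` of an array. -/
def rd (a : ℕ → α) (i : ℕ) : ℝ := Scal.val (a i)

@[fun_prop] theorem Comp.rd {A : γ → ℕ → α} {i : γ → ℕ} (hA : Comp A) (hi : Comp i) :
    Comp (fun x => rd (A x) (i x)) := by
  refine Comp.comp (f := fun p : (ℕ → α) × ℕ => PenroseTomography.rd p.1 p.2) ?_ (hA.prodMk hi)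
  refine Comp.of_eval (PolyBdd.const 0) fun s d hd hs => ?_
  refine ⟨readA d s.1 s.2, _, PolyBdd.const 12, fun B x σ hr hc => ?_⟩
  refine (runsTo_readA hd hs.2.1 hr.2 (fun h => absurd h hs.1.1)).congr ?_
  rw [hr.1]
  rfl

/-- `for j < l do P`, where `o` is a scratch scalar -/
def forLoop (j l o : ℕ) (P : Prog) : Prog :=
  Prog.seq (whileLt j l (Prog.seq P (Prog.seq (setC o (natConst 1))
    (Prog.seq (arith Op.add j j o) (setC o (natConst 0)))))) (setC j (natConst 0))

theorem runsTo_forLoop {B j l o L c : ℕ} {P : Prog} (hj : j ≠ 0) (hl : l ≠ 0) (ho : o ≠ 0)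
    (hjl : l ≠ j) (hjo : j ≠ o) (S : ℕ → Store)
    (hSl : ∀ t ≤ L, S t (l, 0) = L) (hSj : ∀ t ≤ L, S t (j, 0) = 0)
    (hSo : ∀ t ≤ L, S t (o, 0) = 0)
    (hP : ∀ t < L, RunsTo B P (update (S t) (j, 0) t) c (update (S (t + 1)) (j, 0) t)) :
    RunsTo B (forLoop j l o P) (S 0) (L * (c + 25) + 11) (S L) := by
  have hne : ((l, 0) : ℕ × ℕ) ≠ (j, 0) := by simpa using hjl
  obtain ⟨σ', r, e⟩ := runsTo_whileLt (B := B) (a := j) (b := l) (c := c + 18) (T := L)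
    (P := Prog.seq P (Prog.seq (setC o (natConst 1))
      (Prog.seq (arith Op.add j j o) (setC o (natConst 0))))) hj hl
    (fun t σ => t ≤ L ∧ σ = update (S t) (j, 0) t)
    (fun t ht σ e => by
      rw [e.2, update_self, update_of_ne hne, hSl t e.1]; exact_mod_cast ht)
    (fun σ e => by rw [e.2, update_self, update_of_ne hne, hSl L le_rfl]; simp)
    (fun t ht σ e => by
      rw [e.2]
      refine ⟨_, (hP t ht).seq ((runsTo_setC B _ ho _).seq
        ((runsTo_arith B _ Op.add hj hj ho (by simp)).seq (runsTo_setC B _ ho _))), ht, ?_⟩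
      funext ⟨k, i⟩
      have := hSo (t + 1) ht
      simp only [update_apply, Prod.mk.injEq, natConst, Op.val]
      split_ifs <;> simp_all)
    (σ := S 0) ⟨Nat.zero_le _, by simp [hSj 0 (Nat.zero_le L)]⟩
  refine ((r.seq (runsTo_setC B _ hj _)).mono (by ring_nf; omega)).congr ?_
  rw [e.2, update_idem]
  simp [natConst, ← hSj L le_rfl]

/-- The store `σ`, with `v` in the first `t` entries of the array `a`. -/
def setArr (σ : Store) (a t : ℕ) (v : ℕ → ℝ) : Store :=
  fun c => if c.1 = a ∧ c.2 < t then v c.2 else σ c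

theorem setArr_of_ne (σ : Store) {a k : ℕ} (t i : ℕ) (v : ℕ → ℝ) (h : k ≠ a) :
    setArr σ a t v (k, i) = σ (k, i) := if_neg fun h' => h h'.1

/-- `for j < l do a[j] := P`, where `P` puts its result into the array `j + 1` -/
def tabulate (a l j : ℕ) (P : Prog) : Prog :=
  forLoop j l (j + 1) (Prog.seq P (Prog.seq (writeA a j (j + 1)) (setC (j + 1) (natConst 0))))

theorem runsTo_tabulate {B a l j L c : ℕ} {P : Prog} (ha : a ≠ 0) (hl : l ≠ 0) (haj : a < j)
    (hlj : l < j) (hla : l ≠ a) (v : ℕ → ℝ) {σ : Store} (hL : σ (l, 0) = L)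
    (hc : Clean j σ)
    (hP : ∀ t < L, RunsTo B P (update (setArr σ a t v) (j, 0) t) c
      (update (update (setArr σ a t v) (j, 0) t) (j + 1, 0) (v t))) :
    RunsTo B (tabulate a l j P) σ (L * (c + 41) + 11) (setArr σ a L v) := by
  have h0 : setArr σ a 0 v = σ := by funext c; simp [setArr]
  have := runsTo_forLoop (B := B) (j := j) (l := l) (o := j + 1) (L := L) (c := c + 16)
    (P := Prog.seq P (Prog.seq (writeA a j (j + 1)) (setC (j + 1) (natConst 0))))
    (by omega) hl (by omega) (by omega) (by omega) (fun t => setArr σ a t v)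
    (fun t _ => by rw [setArr_of_ne _ _ _ _ hla, hL])
    (fun t _ => by rw [setArr_of_ne _ _ _ _ haj.ne', hc _ _ le_rfl])
    (fun t _ => by rw [setArr_of_ne _ _ _ _ (by omega), hc _ _ (by omega)])
    (fun t ht => by
      refine ((hP t ht).seq ((runsTo_writeA (k := a) (a := j) (b := j + 1) (i := t) (by omega)
        (by omega) ?_ (fun h => absurd h ha)).seq (runsTo_setC B _ (by omega) _))).congr ?_
      · rw [update_of_ne (by simp), update_self]
      · funext ⟨k, i⟩
        have h1 := hc (j + 1) 0 (by omega)
        simp only [update_apply, Prod.mk.injEq, natConst, setArr]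
        split_ifs <;> first | omega | simp_all)
  rw [h0] at this
  exact this.mono (by ring_nf; omega)

end

end PenroseTomography

/-! ### Iteration of arrays -/

namespace PenroseTomography

noncomputable section

open Function

variable {γ δ ε α β : Type} [Ctx γ] [Ctx δ] [Ctx ε] [Scal α] [Scal β]

/-- The array with the `L` entries `a 0, …, a (L - 1)`, padded with zeros. -/
def arr (L : ℕ) (a : ℕ → α) : ℕ → α := fun j => if j < L then a j else Scal.zero

/-- The array of length `L` after `t` rounds, where the entry `j` after round `t + 1` is
`G t A j` if `A` is the array after round `t`. -/
def iterArr (L : ℕ) (a₀ : ℕ → α) (G : ℕ → (ℕ → α) → ℕ → α) : ℕ → ℕ → α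
  | 0 => arr L a₀
  | t + 1 => arr L (G t (iterArr L a₀ G t))

/-- The value of `h` at the array after `T` rounds. -/
def withIter (L T : ℕ) (a₀ : ℕ → α) (G : ℕ → (ℕ → α) → ℕ → α) (h : (ℕ → α) → ℝ) : ℝ :=
  h (iterArr L a₀ G T)

/-- The store `σ` with the contents of the array `a` replaced by `v`. -/
def putArr (σ : Store) (a : ℕ) (v : ℕ → ℝ) : Store := fun c => if c.1 = a then v c.2 else σ c

/-- `for j < l do { a[j] := b[j]; b[j] := 0 }` -/
def moveArr (a b l j : ℕ) : Prog :=
  forLoop j l (j + 1) (Prog.seq (readA (j + 1) b j) (Prog.seq (writeA a j (j + 1))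
    (Prog.seq (setC (j + 1) (natConst 0)) (writeA b j (j + 1)))))

/-- After the move, the array `b` is clean again. -/
theorem runsTo_moveArr {B a b l j L : ℕ} (ha : a ≠ 0) (hb : b ≠ 0) (hl : l ≠ 0) (hab : a < b)
    (hbj : b < j) (hlj : l < j) (hla : l ≠ a) (hlb : l ≠ b) (v : ℕ → ℝ) {σ : Store}
    (hL : σ (l, 0) = L) (hc : Clean b σ) :
    RunsTo B (moveArr a b l j) (setArr σ b L v) (L * (40 + 25) + 11) (setArr σ a L v) := by
  have := runsTo_forLoop (B := B) (j := j) (l := l) (o := j + 1) (L := L)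
    (c := 40) (P := Prog.seq (readA (j + 1) b j) (Prog.seq (writeA a j (j + 1))
      (Prog.seq (setC (j + 1) (natConst 0)) (writeA b j (j + 1)))))
    (by omega) hl (by omega) (by omega) (by omega)
    (fun u c => if c.1 = a ∧ c.2 < u then v c.2 else
      if c.1 = b then if u ≤ c.2 ∧ c.2 < L then v c.2 else 0 else σ c)
    (fun u _ => by simp [hla, hlb, hL])
    (fun u _ => by simp [(hab.trans hbj).ne', hbj.ne', hc j 0 hbj.le])
    (fun u _ => by
      have h1 : j + 1 ≠ a := by omega
      have h2 : j + 1 ≠ b := by omega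
      simp [h1, h2, hc (j + 1) 0 (by omega)])
    (fun u hu => by
      refine ((runsTo_readA (i := u) (by omega) (by omega) (by simp)
        (fun h => absurd h hb)).seq ((runsTo_writeA (i := u) (by omega) (by omega) ?_
        (fun h => absurd h ha)).seq ((runsTo_setC B _ (by omega) _).seq (runsTo_writeA
        (i := u) (by omega) (by omega) ?_ (fun h => absurd h hb))))).congr ?_
      · simp
      · have h1 : j ≠ a := by omega
        simp [h1]
      · funext ⟨k, i⟩
        have h1 := hc (j + 1) 0 (by omega)
        simp only [update_apply, Prod.mk.injEq, natConst]
        split_ifs <;> first | omega | simp_all)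
  unfold moveArr
  convert this using 1 <;>
  · funext ⟨k, i⟩
    have h1 := hc b i le_rfl
    simp only [setArr]
    split_ifs <;> first | rfl | omega | simp_all

theorem setArr_eq_putArr {σ : Store} {a L : ℕ} (v : ℕ → α) (h : ∀ i, L ≤ i → σ (a, i) = 0) :
    setArr σ a L (fun j => Scal.val (v j)) = putArr σ a (fun j => Scal.val (arr L v j)) := by
  funext ⟨k, i⟩
  simp only [setArr, putArr, arr]
  split_ifs with h1 h2 h3 h4 h5
  · rfl
  · omega
  · omega
  · omega
  · rw [h4, h i (by omega), Scal.val_zero]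
  · rfl

theorem iterArr_eq_zero {L i : ℕ} (hi : L ≤ i) (a₀ : ℕ → α) (G : ℕ → (ℕ → α) → ℕ → α) (t : ℕ) :
    iterArr L a₀ G t i = Scal.zero := by
  cases t <;> exact if_neg (by omega)

theorem rep_scal {s : ℕ} {a : α} {σ : Store} (h : σ (s, 0) = Scal.val a) : Ctx.Rep s a σ := h

theorem rep_array {s : ℕ} {a : ℕ → α} {σ : Store} (h : ∀ i, σ (s, i) = Scal.val (a i)) :
    Ctx.Rep s a σ := h

/-- A loop over the rounds that tabulates the next array into a second one and moves it back. All
loops are reduced to this rule. -/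
@[fun_prop] theorem Comp.withIter {L T : γ → ℕ} {a₀ : γ → ℕ → α} {G : γ → ℕ → (ℕ → α) → ℕ → α}
    {h : γ → (ℕ → α) → ℝ} (hL : Comp L) (hT : Comp T)
    (ha : Comp (fun p : γ × ℕ => Scal.val (a₀ p.1 p.2)))
    (hG : Comp (fun p : ((γ × ℕ) × (ℕ → α)) × ℕ => Scal.val (G p.1.1.1 p.1.1.2 p.1.2 p.2)))
    (hh : Comp (fun p : γ × (ℕ → α) => h p.1 p.2)) :
    Comp (fun x => withIter (L x) (T x) (a₀ x) (G x) (h x)) := by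
  refine Comp.of_eval (PolyBdd.const 0) fun s d hd hs => ?_
  have hb : ∀ {m}, d ≤ m → Ctx.Below s m := fun hm => Ctx.below_mono hs hm
  obtain ⟨PL, qL, HL⟩ := hL.eval s hd hs
  obtain ⟨PT, qT, HT⟩ := hT.eval s (d := d + 1) (by omega) (hb (by omega))
  obtain ⟨Pa, qa, Ha⟩ := ha.eval (s, d + 5) (d := d + 6) (by omega)
    ⟨hb (by omega), by omega, by omega⟩
  obtain ⟨PG, qG, HG⟩ := hG.eval (((s, d + 2), d + 3), d + 5) (d := d + 6) (by omega)
    ⟨⟨⟨hb (by omega), Nat.succ_ne_zero _, Nat.lt_of_sub_pos (by simp)⟩, Nat.succ_ne_zero _,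
      Nat.lt_of_sub_pos (by simp)⟩, by omega, by omega⟩
  obtain ⟨Ph, qh, Hh⟩ := hh.eval (s, d + 3) (d := d + 4) (by omega)
    ⟨hb (by omega), by omega, by omega⟩
  have bL : PolyBdd L := hL.1
  have bT : PolyBdd T := hT.1
  refine ⟨Prog.seq (Prog.seq PL PT) (Prog.seq (tabulate (d + 3) d (d + 5) Pa)
    (Prog.seq (forLoop (d + 2) (d + 1) (d + 5) (Prog.seq (tabulate (d + 4) d (d + 5) PG)
      (moveArr (d + 3) (d + 4) d (d + 5))))
    (Prog.seq Ph (Prog.seq (tabulate (d + 3) d (d + 5) Prog.skip)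
      (Prog.seq (mov d (d + 4)) (Prog.seq (setC (d + 1) (natConst 0))
        (setC (d + 4) (natConst 0)))))))),
    fun x => qL.eval (Ctx.size x) + (qT.eval (Ctx.size x) +
      ((L x * (qa.eval (Ctx.size x + L x) + 41) + 11) +
      ((T x * (((L x * (qG.eval (Ctx.size x + T x + L x) + 41) + 11) +
        (L x * (40 + 25) + 11)) + 25) + 11) +
      (qh.eval (Ctx.size x) + ((L x * (0 + 41) + 11) + (6 + (4 + 4))))))), ?_, ?_⟩
  · have bs : PolyBdd (fun g : γ => Ctx.size g) := PolyBdd.size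
    have c := fun n => PolyBdd.const (γ := γ) n
    exact (bs.comp qL).add ((bs.comp qT).add (((bL.mul (((bs.add bL).comp qa).add (c 41))).add
      (c 11)).add (((bT.mul ((((bL.mul ((((bs.add bT).add bL).comp qG).add (c 41))).add
      (c 11)).add ((bL.mul (c (40 + 25))).add (c 11))).add (c 25))).add (c 11)).add
      ((bs.comp qh).add (((bL.mul (c (0 + 41))).add (c 11)).add (c _))))))
  · intro B x σ hr hc
    -- the store with the two loop bounds
    set σ₁ := update (update σ (d, 0) (L x : ℝ)) (d + 1, 0) (T x : ℝ) with hσ₁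
    have c₁ : Clean (d + 2) σ₁ :=
      ((hc.mono (by omega)).update (by omega) 0 _).update (by omega) 0 _
    have r₁ := (HL B x σ hr hc).seq (HT B x _ (rep_update hs hr le_rfl 0 _)
      ((hc.mono (by omega)).update (by omega) 0 _))
    have e₁ : σ₁ (d, 0) = L x := by simp [σ₁]
    have e₂ : σ₁ (d + 1, 0) = T x := by simp [σ₁]
    have rep : ∀ σ' : Store, (∀ k < d, ∀ i, σ' (k, i) = σ (k, i)) → Ctx.Rep s x σ' :=
      fun σ' h => Ctx.rep_congr hs h hr
    have low : ∀ k < d, ∀ i, σ₁ (k, i) = σ (k, i) := fun k hk i => by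
      rw [hσ₁, update_of_ne (by rintro ⟨⟩; omega), update_of_ne (by rintro ⟨⟩; omega)]
    -- initialization
    have r₂ := runsTo_tabulate (B := B) (a := d + 3) (l := d) (j := d + 5) (L := L x)
      (c := qa.eval (Ctx.size x + L x)) (P := Pa) (by omega) hd (by omega) (by omega) (by omega)
      (fun j => Scal.val (a₀ x j)) e₁ (c₁.mono (by omega)) (fun t ht => by
        refine (Ha B (x, t) _ ⟨rep _ fun k hk i => ?_, ?_⟩ ?_).mono
          (eval_mono _ (Nat.add_le_add_left ht.le _))
        · rw [update_of_ne (by rintro ⟨⟩; omega), setArr_of_ne _ _ _ _ (by omega), low k hk]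
        · exact update_self ..
        · refine Clean.update ?_ (by omega) _ _
          intro k i hk
          rw [setArr_of_ne _ _ _ _ (by omega), c₁ k i (by omega)])
    have f₂ := setArr_eq_putArr (σ := σ₁) (a := d + 3) (L := L x) (a₀ x)
      fun i _ => c₁ _ _ (by omega)
    -- the main loop
    have r₃ := runsTo_forLoop (B := B) (j := d + 2) (l := d + 1) (o := d + 5) (L := T x)
      (c := (L x * (qG.eval (Ctx.size x + T x + L x) + 41) + 11) + (L x * (40 + 25) + 11))
      (P := Prog.seq (tabulate (d + 4) d (d + 5) PG)
        (moveArr (d + 3) (d + 4) d (d + 5)))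
      (by omega) (by omega) (by omega) (by omega) (by omega)
      (fun t => putArr σ₁ (d + 3) (fun j => Scal.val (iterArr (L x) (a₀ x) (G x) t j)))
      (fun t _ => by simp [putArr, e₂])
      (fun t _ => by simp [putArr, c₁ _ _ le_rfl])
      (fun t _ => by simp [putArr, c₁ (d + 5) 0 (by omega)])
      (fun t ht => by
        set A := iterArr (L x) (a₀ x) (G x) t with hA
        set τ := update (putArr σ₁ (d + 3) (fun j => Scal.val (A j))) (d + 2, 0) (t : ℝ) with hτ
        have lowτ : ∀ k < d, ∀ i, τ (k, i) = σ (k, i) := fun k hk i => by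
          rw [hτ, update_of_ne (by rintro ⟨⟩; omega), putArr, if_neg (by simp; omega), low k hk]
        have cτ : Clean (d + 4) τ := by
          refine Clean.update ?_ (by omega) _ _
          intro k i hk
          rw [putArr, if_neg (by simp; omega), c₁ _ _ (by omega)]
        have r₄ := runsTo_tabulate (B := B) (a := d + 4) (l := d) (j := d + 5) (L := L x)
          (c := qG.eval (Ctx.size x + T x + L x)) (P := PG) (σ := τ) (by omega) hd (by omega)
          (by omega) (by omega) (fun j => Scal.val (G x t A j)) (by simp [hτ, putArr, e₁])
          (cτ.mono (by omega)) (fun u hu => by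
            refine (HG B (((x, t), A), u) _ ⟨⟨⟨rep _ fun k hk i => ?_, ?_⟩, fun i => ?_⟩, ?_⟩
              ?_).mono (eval_mono _ ?_)
            · rw [update_of_ne (by rintro ⟨⟩; omega), setArr_of_ne _ _ _ _ (by omega), lowτ k hk]
            · refine rep_scal ?_
              rw [update_of_ne (by simp),
                setArr_of_ne (k := d + 2) (a := d + 4) _ _ _ _ (by omega), hτ,
                update_self]
              rfl
            · refine rep_array (fun i => ?_) i
              rw [update_of_ne (by simp),
                setArr_of_ne (k := d + 3) (a := d + 4) _ _ _ _ (by omega), hτ,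
                update_of_ne (by simp), putArr, if_pos rfl]
            · exact update_self ..
            · refine Clean.update ?_ (by omega) _ _
              intro k i hk
              rw [setArr_of_ne _ _ _ _ (by omega), cτ k i (by omega)]
            · exact Nat.add_le_add (Nat.add_le_add_left ht.le _) hu.le)
        have r₅ := runsTo_moveArr (B := B) (a := d + 3) (b := d + 4) (l := d) (j := d + 5)
          (L := L x) (σ := τ) (by omega) (by omega) hd (by omega) (by omega) (by omega) (by omega)
          (by omega) (fun j => Scal.val (G x t A j)) (by simp [hτ, putArr, e₁]) cτ
        refine (r₄.seq r₅).congr ?_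
        rw [setArr_eq_putArr (σ := τ) (a := d + 3) (L := L x) (G x t A) fun i hi => by
          rw [hτ, update_of_ne (by simp), putArr, if_pos rfl, hA, iterArr_eq_zero hi,
            Scal.val_zero]]
        funext ⟨k, i⟩
        simp only [putArr, iterArr, hτ, update_apply, Prod.mk.injEq]
        rw [← hA]
        split_ifs <;> first | rfl | omega)
    set A := iterArr (L x) (a₀ x) (G x) (T x) with hA
    have lowA : ∀ k < d, ∀ i, putArr σ₁ (d + 3) (fun j => Scal.val (A j)) (k, i) = σ (k, i) :=
      fun k hk i => by rw [putArr, if_neg (by simp; omega), low k hk]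
    have r₆ := Hh B (x, A) (putArr σ₁ (d + 3) (fun j => Scal.val (A j)))
      ⟨rep _ lowA, fun i => if_pos rfl⟩ (fun k i hk => by
        rw [putArr, if_neg (by simp; omega), c₁ _ _ (by omega)])
    have r₇ := runsTo_tabulate (B := B) (a := d + 3) (l := d) (j := d + 5) (L := L x)
      (c := 0) (P := Prog.skip) (by omega) hd (by omega) (by omega) (by omega)
      (fun j => 0) (σ := update (putArr σ₁ (d + 3) (fun j => Scal.val (A j))) (d + 4, 0)
        (h x A)) (by simp [putArr, e₁])
      (fun k i hk => by
        rw [update_of_ne (by rintro ⟨⟩; omega), putArr, if_neg (by simp; omega),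
          c₁ _ _ (by omega)])
      (fun t ht => by
        refine (RunsTo.skip B _).congr ?_
        symm
        rw [update_eq_self_iff]
        simp [setArr, putArr, c₁ (d + 6) 0 (by omega)])
    refine RunsTo.congr (RunsTo.mono (r₁.seq ((r₂.congr f₂).seq (r₃.seq (r₆.seq (r₇.seq
      ((runsTo_mov B _ hd (a := d + 4) (by omega)).seq ((runsTo_setC B _ (d := d + 1) (by omega) _).seq
      (runsTo_setC B _ (d := d + 4) (by omega) _)))))))) ?_) ?_
    · have : Ctx.size (x, A) = Ctx.size x := rfl
      rw [this]; dsimp only; omega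
    have hA0 : ∀ i, ¬ i < L x → Scal.val (A i) = 0 := fun i hi => by
      rw [hA, iterArr_eq_zero (by omega), Scal.val_zero]
    funext ⟨k, i⟩
    have h1 := hc (d + 1) 0 (by omega)
    have h2 := hc (d + 3) i (by omega)
    have h3 := hc (d + 4) 0 (by omega)
    have h4 := hA0 i
    have hw : PenroseTomography.withIter (L x) (T x) (a₀ x) (G x) (h x) = h x A := rfl
    rw [hw]
    clear HL HT Ha HG Hh r₁ r₂ r₃ r₆ r₇ rep low lowA f₂ hA0 c₁ hr hA hw
    clear_value A
    simp only [update_apply, Prod.mk.injEq, natConst, setArr, putArr, hσ₁]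
    split_ifs <;> first | omega | simp_all [Scal.val]

end

end PenroseTomography

/-! ### Sums, recursion, quantifiers and natural numbers -/

namespace PenroseTomography

noncomputable section

open Function

variable {γ δ ε α β : Type} [Ctx γ] [Ctx δ] [Ctx ε] [Scal α] [Scal β]

@[fun_prop] theorem Comp.natCast {f : γ → ℕ} (hf : Comp f) : Comp (fun x => (f x : ℝ)) := hf.toVal

/-- The indicator of a proposition. -/
def ind (p : Prop) : ℝ := Scal.val p

theorem ind_true {p : Prop} (h : p) : ind p = 1 := if_pos h

theorem ind_false {p : Prop} (h : ¬ p) : ind p = 0 := if_neg h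

@[fun_prop] theorem Comp.ind {p : γ → Prop} (hp : Comp p) :
    Comp (fun x => PenroseTomography.ind (p x)) := hp.toVal

theorem Comp.iff {p q : γ → Prop} (hp : Comp p) (h : ∀ x, q x ↔ p x) : Comp q := by
  rwa [show q = p from funext fun x => propext (h x)]

@[fun_prop] theorem Comp.not {p : γ → Prop} (hp : Comp p) : Comp (fun x => ¬ p x) := by
  have h : Comp (fun x => PenroseTomography.ind (p x) < 1) := by fun_prop
  exact h.iff fun x => by by_cases hx : p x <;> simp [ind_true, ind_false, hx]

@[fun_prop] theorem Comp.and {p q : γ → Prop} (hp : Comp p) (hq : Comp q) :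
    Comp (fun x => p x ∧ q x) := by
  have h : Comp (fun x => 0 < PenroseTomography.ind (p x) * PenroseTomography.ind (q x)) := by
    fun_prop
  exact h.iff fun x => by
    by_cases hx : p x <;> by_cases hx' : q x <;> simp [ind_true, ind_false, hx, hx']

@[fun_prop] theorem Comp.le {f g : γ → ℝ} (hf : Comp f) (hg : Comp g) :
    Comp (fun x => f x ≤ g x) := by
  have h : Comp (fun x => ¬ (g x < f x)) := by fun_prop
  exact h.iff fun x => not_lt.symm

@[fun_prop] theorem Comp.eq {f g : γ → ℝ} (hf : Comp f) (hg : Comp g) :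
    Comp (fun x => f x = g x) := by
  have h : Comp (fun x => f x ≤ g x ∧ g x ≤ f x) := by fun_prop
  exact h.iff fun x => le_antisymm_iff

@[fun_prop] theorem Comp.natLt {f g : γ → ℕ} (hf : Comp f) (hg : Comp g) :
    Comp (fun x => f x < g x) := by
  have h : Comp (fun x => (f x : ℝ) < (g x : ℝ)) := by fun_prop
  exact h.iff fun x => Nat.cast_lt.symm

@[fun_prop] theorem Comp.natLe {f g : γ → ℕ} (hf : Comp f) (hg : Comp g) :
    Comp (fun x => f x ≤ g x) := by
  have h : Comp (fun x => (f x : ℝ) ≤ (g x : ℝ)) := by fun_prop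
  exact h.iff fun x => Nat.cast_le.symm

@[fun_prop] theorem Comp.natEq {f g : γ → ℕ} (hf : Comp f) (hg : Comp g) :
    Comp (fun x => f x = g x) := by
  have h : Comp (fun x => (f x : ℝ) = (g x : ℝ)) := by fun_prop
  exact h.iff fun x => Nat.cast_inj.symm

@[fun_prop] theorem Comp.ite {p : γ → Prop} [∀ x, Decidable (p x)] {f g : γ → ℝ} (hp : Comp p)
    (hf : Comp f) (hg : Comp g) : Comp (fun x => if p x then f x else g x) := by
  have h : Comp (fun x => PenroseTomography.ind (p x) * f x +
    PenroseTomography.ind (¬ p x) * g x) := by fun_prop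
  convert h using 2 with x
  split_ifs with hx <;> simp [ind_true, ind_false, hx]

/-- A natural-valued function is computable if its value is, as a real number, and if it has a
computable bound. -/
theorem Comp.nat_of_real {f b : γ → ℕ} (hf : Comp (fun x => (f x : ℝ))) (hb : Comp b)
    (h : ∀ x, f x ≤ b x) : Comp f := Comp.of_val (hb.1.mono h) hf

@[fun_prop] theorem Comp.natAdd {f g : γ → ℕ} (hf : Comp f) (hg : Comp g) :
    Comp (fun x => f x + g x) := by
  refine Comp.of_val (hf.1.add hg.1) ?_
  have h : Comp (fun x => (f x : ℝ) + (g x : ℝ)) := by fun_prop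
  simpa [Scal.val] using h

@[fun_prop] theorem Comp.natMul {f g : γ → ℕ} (hf : Comp f) (hg : Comp g) :
    Comp (fun x => f x * g x) := by
  refine Comp.of_val (hf.1.mul hg.1) ?_
  have h : Comp (fun x => (f x : ℝ) * (g x : ℝ)) := by fun_prop
  simpa [Scal.val] using h

@[fun_prop] theorem Comp.natSub {f g : γ → ℕ} (hf : Comp f) (hg : Comp g) :
    Comp (fun x => f x - g x) := by
  have h : Comp (fun x => if g x ≤ f x then (f x : ℝ) - (g x : ℝ) else 0) := by fun_prop
  refine Comp.nat_of_real ?_ hf fun x => Nat.sub_le _ _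
  convert h using 2 with x
  split_ifs with hx
  · exact Nat.cast_sub hx
  · rw [Nat.sub_eq_zero_of_le (by omega), Nat.cast_zero]

@[fun_prop] theorem Comp.natIte {p : γ → Prop} [∀ x, Decidable (p x)] {f g : γ → ℕ} (hp : Comp p)
    (hf : Comp f) (hg : Comp g) : Comp (fun x => if p x then f x else g x) := by
  refine Comp.nat_of_real (b := fun x => f x + g x) ?_ (by fun_prop)
    fun x => by split_ifs <;> omega
  have h : Comp (fun x => if p x then (f x : ℝ) else (g x : ℝ)) := by fun_prop
  convert h using 2 with x
  split_ifs <;> rfl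

/-- The value after `n` rounds of a recursion. -/
def rrec (n : ℕ) (a : ℝ) (step : ℕ → ℝ → ℝ) : ℝ :=
  withIter (α := ℝ) 1 n (fun _ => a) (fun t A _ => step t (rd A 0)) (fun A => rd A 0)

theorem rrec_zero (a : ℝ) (step : ℕ → ℝ → ℝ) : rrec 0 a step = a := rfl

theorem rrec_succ (n : ℕ) (a : ℝ) (step : ℕ → ℝ → ℝ) :
    rrec (n + 1) a step = step n (rrec n a step) := rfl

@[fun_prop] theorem Comp.rrec {n : γ → ℕ} {a : γ → ℝ} {step : γ → ℕ → ℝ → ℝ} (hn : Comp n)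
    (ha : Comp a) (hs : Comp (fun p : (γ × ℕ) × ℝ => step p.1.1 p.1.2 p.2)) :
    Comp (fun x => PenroseTomography.rrec (n x) (a x) (step x)) := by
  refine Comp.withIter (by fun_prop) hn ?_ ?_ (by fun_prop)
  · exact ha.comp Comp.id.fst
  · exact Comp.comp (f := fun p : (γ × ℕ) × ℝ => step p.1.1 p.1.2 p.2)
      (g := fun p : ((γ × ℕ) × (ℕ → ℝ)) × ℕ => (p.1.1, PenroseTomography.rd p.1.2 0)) hs
      (by fun_prop)

/-- The sum `h 0 + ⋯ + h (n - 1)`. -/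
def rsum (n : ℕ) (h : ℕ → ℝ) : ℝ := ∑ i ∈ Finset.range n, h i

@[fun_prop] theorem Comp.rsum {n : γ → ℕ} {h : γ → ℕ → ℝ} (hn : Comp n)
    (hh : Comp (fun p : γ × ℕ => h p.1 p.2)) :
    Comp (fun x => PenroseTomography.rsum (n x) (h x)) := by
  have h' : Comp (fun x => PenroseTomography.rrec (n x) 0 (fun i s => s + h x i)) := by fun_prop
  convert h' using 2 with x
  unfold PenroseTomography.rsum
  induction n x with
  | zero => rfl
  | succ k ih => rw [Finset.sum_range_succ, rrec_succ, ih]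

/-- The sum `h 0 + ⋯ + h (n - 1)` of natural numbers. -/
def nsum (n : ℕ) (h : ℕ → ℕ) : ℕ := ∑ i ∈ Finset.range n, h i

@[fun_prop] theorem Comp.nsum {n : γ → ℕ} {h : γ → ℕ → ℕ} (hn : Comp n)
    (hh : Comp (fun p : γ × ℕ => h p.1 p.2)) :
    Comp (fun x => PenroseTomography.nsum (n x) (h x)) := by
  refine Comp.of_val ?_ ?_
  · obtain ⟨q, hq⟩ := hh.1
    have b : PolyBdd n := hn.1
    refine (b.mul ((PolyBdd.size.add b).comp q)).mono fun x => ?_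
    change ∑ i ∈ Finset.range (n x), h x i ≤ _
    refine (Finset.sum_le_card_nsmul _ _ (q.eval (Ctx.size x + n x)) fun i hi => ?_).trans
      (by simp)
    exact (hq (x, i)).trans (eval_mono q (Nat.add_le_add_left (Finset.mem_range.1 hi).le _))
  · have h' : Comp (fun x => PenroseTomography.rsum (n x) (fun i => (h x i : ℝ))) := by fun_prop
    simpa [Scal.val, PenroseTomography.rsum, PenroseTomography.nsum] using h'

/-- Bounded existential quantification. -/
def bex (n : ℕ) (p : ℕ → Prop) : Prop := ∃ i < n, p i

/-- Bounded universal quantification. -/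
def ball (n : ℕ) (p : ℕ → Prop) : Prop := ∀ i < n, p i

@[fun_prop] theorem Comp.bex {n : γ → ℕ} {p : γ → ℕ → Prop} (hn : Comp n)
    (hp : Comp (fun q : γ × ℕ => p q.1 q.2)) :
    Comp (fun x => PenroseTomography.bex (n x) (p x)) := by
  have h : Comp (fun x => 0 < PenroseTomography.rsum (n x)
    (fun i => PenroseTomography.ind (p x i))) := by fun_prop
  refine h.iff fun x => ?_
  have h0 : ∀ i, 0 ≤ PenroseTomography.ind (p x i) := fun i => by
    by_cases hx : p x i <;> simp [ind_true, ind_false, hx]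
  rw [PenroseTomography.rsum, Finset.sum_pos_iff_of_nonneg (fun i _ => h0 i)]
  refine exists_congr fun i => ?_
  by_cases hx : p x i <;> simp [ind_true, ind_false, hx]

@[fun_prop] theorem Comp.ball {n : γ → ℕ} {p : γ → ℕ → Prop} (hn : Comp n)
    (hp : Comp (fun q : γ × ℕ => p q.1 q.2)) :
    Comp (fun x => PenroseTomography.ball (n x) (p x)) := by
  have h : Comp (fun x => ¬ PenroseTomography.bex (n x) (fun i => ¬ p x i)) := by fun_prop
  exact h.iff fun x => by simp [PenroseTomography.ball, PenroseTomography.bex]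

@[fun_prop] theorem Comp.natDiv {f g : γ → ℕ} (hf : Comp f) (hg : Comp g) :
    Comp (fun x => f x / g x) := by
  have h : Comp (fun x => PenroseTomography.nsum (f x)
    (fun q => if 0 < g x ∧ (q + 1) * g x ≤ f x then 1 else 0)) := by fun_prop
  convert h using 2 with x
  rw [PenroseTomography.nsum, ← Finset.sum_filter, Finset.sum_const, smul_eq_mul, mul_one]
  conv_lhs => rw [← Finset.card_range (f x / g x)]
  congr 1
  ext q
  rw [Finset.mem_filter, Finset.mem_range, Finset.mem_range]
  rcases Nat.eq_zero_or_pos (g x) with h0 | h0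
  · simp [h0]
  · rw [← Nat.succ_le_iff, Nat.le_div_iff_mul_le h0]
    refine ⟨fun H => ⟨?_, h0, H⟩, fun H => H.2.2⟩
    exact (Nat.le_mul_of_pos_right _ h0).trans H

@[fun_prop] theorem Comp.natMod {f g : γ → ℕ} (hf : Comp f) (hg : Comp g) :
    Comp (fun x => f x % g x) := by
  have h : Comp (fun x => f x - g x * (f x / g x)) := by fun_prop
  convert h using 2 with x
  exact Nat.mod_eq_sub_mul_div

/-- The real number `x`, provided that it is a natural number that is at most `n`. -/
def natOf (n : ℕ) (x : ℝ) : ℕ := nsum n fun i => by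
  classical exact if (i : ℝ) < x then 1 else 0

theorem natOf_natCast {n m : ℕ} (h : m ≤ n) : natOf n (m : ℝ) = m := by
  classical
  simp only [natOf, nsum, Nat.cast_lt]
  rw [← Finset.sum_filter, Finset.sum_const, smul_eq_mul, mul_one]
  conv_rhs => rw [← Finset.card_range m]
  congr 1
  ext q
  rw [Finset.mem_filter, Finset.mem_range, Finset.mem_range]
  omega

@[fun_prop] theorem Comp.natOf {n : γ → ℕ} {f : γ → ℝ} (hn : Comp n) (hf : Comp f) :
    Comp (fun x => PenroseTomography.natOf (n x) (f x)) := by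
  unfold PenroseTomography.natOf
  fun_prop

@[fun_prop] theorem Comp.two_pow {n : γ → ℕ} (hn : Comp n) : Comp (fun x => (2 : ℝ) ^ n x) := by
  have h : Comp (fun x => PenroseTomography.rrec (n x) 1 (fun _ s => 2 * s)) := by fun_prop
  convert h using 2 with x
  induction n x with
  | zero => simp [rrec_zero]
  | succ k ih => rw [pow_succ, rrec_succ, ih, mul_comm]

/-- Sequences of algebraic numbers. -/
class AlgSeq (c : ℕ → ℝ) : Prop where
  isAlgebraic : ∀ i, IsAlgebraic ℚ (c i)

/-- A table of `n` constants. -/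
def table (n : ℕ) (c : ℕ → ℝ) (k : ℕ) : ℝ := if k < n then c k else 0

@[fun_prop] theorem Comp.table (n : ℕ) (c : ℕ → ℝ) [hc : AlgSeq c] {k : γ → ℕ} (hk : Comp k) :
    Comp (fun x => PenroseTomography.table n c (k x)) := by
  induction n generalizing c k with
  | zero =>
    have h : Comp (fun _ : γ => (0 : ℝ)) := by fun_prop
    simpa [PenroseTomography.table] using h
  | succ n ih =>
    have : AlgConst (c 0) := ⟨hc.isAlgebraic 0⟩
    have : AlgSeq (fun i => c (i + 1)) := ⟨fun i => hc.isAlgebraic _⟩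
    have h1 := ih (fun i => c (i + 1)) (k := fun x => k x - 1) (by fun_prop)
    have h : Comp (fun x => if k x = 0 then c 0 else
      PenroseTomography.table n (fun i => c (i + 1)) (k x - 1)) := by fun_prop
    convert h using 2 with x
    unfold PenroseTomography.table
    rcases hx : k x with _ | m <;> simp

/-- A sum with a fixed number of terms. -/
@[fun_prop] theorem Comp.finSum {n : ℕ} {f : γ → Fin n → ℝ} (hf : ∀ i, Comp (fun x => f x i)) :
    Comp (fun x => ∑ i, f x i) := by
  induction n with
  | zero => simpa using (Comp.const (γ := γ) (0 : ℝ))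
  | succ n ih =>
    simp only [Fin.sum_univ_succ]
    exact (hf 0).add (ih fun i => hf i.succ)

end

end PenroseTomography

/-! ### Orientations with bounded indegrees -/

namespace PenroseTomography

noncomputable section

open Function

section Orientation

open Classical

/-- The end of the edge `e` (with ends `a e` and `b e`) that is chosen by the state `A`. A state
consists of the heights `A 0, …, A (V - 1)` of the vertices, and then one entry for each edge, which
is `0` if the end `a e` is chosen. -/
def cur (V : ℕ) (a b : ℕ → ℕ) (A : ℕ → ℕ) (e : ℕ) : ℕ := if rd A (V + e) = 0 then a e else b e

/-- The end of the edge `e` that is not chosen. -/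
def oth (V : ℕ) (a b : ℕ → ℕ) (A : ℕ → ℕ) (e : ℕ) : ℕ := if rd A (V + e) = 0 then b e else a e

/-- The number of edges for which `x` chooses the vertex `v`. -/
def load (M : ℕ) (ok : ℕ → Prop) (x : ℕ → ℕ) (v : ℕ) : ℕ :=
  nsum M fun e => if ok e ∧ x e = v then 1 else 0

/-- The vertex `v` is overloaded, and its height is below the limit. -/
def active (V M : ℕ) (ok : ℕ → Prop) (a b : ℕ → ℕ) (cap : ℕ → ℝ) (A : ℕ → ℕ) (v : ℕ) : Prop :=
  cap v < load M ok (cur V a b A) v ∧ rd A v < V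

/-- The first active vertex. -/
def chosen (V M : ℕ) (ok : ℕ → Prop) (a b : ℕ → ℕ) (cap : ℕ → ℝ) (A : ℕ → ℕ) (v : ℕ) : Prop :=
  active V M ok a b cap A v ∧ ball v fun u => ¬ active V M ok a b cap A u

/-- The edge `e` may be moved from `v` to its other end, which is lower. -/
def movable (V : ℕ) (ok : ℕ → Prop) (a b : ℕ → ℕ) (A : ℕ → ℕ) (v e : ℕ) : Prop :=
  ok e ∧ cur V a b A e = v ∧ rd A (oth V a b A e) < rd A v

/-- A round of the algorithm: the first active vertex gives away its first movable edge, or is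
raised by one if there is no such edge. -/
def orientStep (V M : ℕ) (ok : ℕ → Prop) (a b : ℕ → ℕ) (cap : ℕ → ℝ) (A : ℕ → ℕ) (i : ℕ) : ℕ :=
  if i < V then
    if chosen V M ok a b cap A i ∧ ¬ bex M fun e => movable V ok a b A i e then A i + 1 else A i
  else if bex V fun v => chosen V M ok a b cap A v ∧ movable V ok a b A v (i - V) ∧
    ball (i - V) fun e => ¬ movable V ok a b A v e then if rd A i = 0 then 1 else 0 else A i

/-- The value of `h` at the final state. -/
def orient (V M : ℕ) (ok : ℕ → Prop) (a b : ℕ → ℕ) (cap : ℕ → ℝ) (h : (ℕ → ℕ) → ℝ) : ℝ :=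
  withIter (V + M) (V * V + M * V + 1) (fun _ => 0)
    (fun _ A i => orientStep V M ok a b cap A i) h

/-- The final state. -/
def orientState (V M : ℕ) (ok : ℕ → Prop) (a b : ℕ → ℕ) (cap : ℕ → ℝ) : ℕ → ℕ :=
  iterArr (V + M) (fun _ => 0) (fun _ A i => orientStep V M ok a b cap A i) (V * V + M * V + 1)

theorem rd_nat (A : ℕ → ℕ) (i : ℕ) : rd A i = A i := rfl

variable {V M : ℕ} {ok : ℕ → Prop} {a b : ℕ → ℕ} {cap : ℕ → ℝ}

theorem load_eq_card (x : ℕ → ℕ) (v : ℕ) :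
    load M ok x v = (((Finset.range M).filter ok).filter fun e => x e = v).card := by
  rw [load, nsum, ← Finset.sum_filter, Finset.sum_const, smul_eq_mul, mul_one,
    Finset.filter_filter]

/-- The three kinds of rounds. -/
theorem orientStep_cases (A : ℕ → ℕ) :
    ((∀ v < V, ¬ active V M ok a b cap A v) ∧ ∀ i < V + M, orientStep V M ok a b cap A i = A i) ∨
    (∃ v < V, ∃ e < M, active V M ok a b cap A v ∧ movable V ok a b A v e ∧
      ∀ i < V + M, orientStep V M ok a b cap A i =
        update A (V + e) (if A (V + e) = 0 then 1 else 0) i) ∨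
    (∃ v < V, active V M ok a b cap A v ∧ (∀ e < M, ¬ movable V ok a b A v e) ∧
      ∀ i < V + M, orientStep V M ok a b cap A i = update A v (A v + 1) i) := by
  by_cases h : ∃ v, v < V ∧ active V M ok a b cap A v
  · obtain ⟨hv, hact⟩ := Nat.find_spec h
    have hmin : ∀ u < Nat.find h, ¬ active V M ok a b cap A u := fun u hu hu' =>
      Nat.find_min h hu ⟨hu.trans hv, hu'⟩
    set v := Nat.find h
    have hch : chosen V M ok a b cap A v := ⟨hact, hmin⟩
    have huniq : ∀ u, chosen V M ok a b cap A u → u = v := fun u hu => by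
      rcases lt_trichotomy u v with h1 | h1 | h1
      · exact absurd hu.1 (hmin u h1)
      · exact h1
      · exact absurd hact (hu.2 v h1)
    by_cases h' : ∃ e, e < M ∧ movable V ok a b A v e
    · obtain ⟨he, hmov⟩ := Nat.find_spec h'
      have hmine : ∀ u < Nat.find h', ¬ movable V ok a b A v u := fun u hu hu' =>
        Nat.find_min h' hu ⟨hu.trans he, hu'⟩
      set e := Nat.find h'
      refine Or.inr (Or.inl ⟨v, hv, e, he, hact, hmov, fun i hi => ?_⟩)
      rw [orientStep]
      by_cases hiV : i < V
      · rw [if_pos hiV, if_neg, update_of_ne (by omega)]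
        rintro ⟨h1, h2⟩
        exact h2 ⟨e, he, huniq i h1 ▸ hmov⟩
      · rw [if_neg hiV]
        by_cases hie : i = V + e
        · subst hie
          rw [if_pos, update_self, rd_nat]
          · simp
          · exact ⟨v, hv, hch, by simpa using hmov, by
            rw [Nat.add_sub_cancel_left]; exact hmine⟩
        · rw [if_neg, update_of_ne hie]
          rintro ⟨u, -, h1, h2, h3⟩
          obtain rfl := huniq u h1
          have h4 : ¬ i - V < e := fun h4 => hmine _ h4 h2
          have h5 : ¬ e < i - V := fun h5 => h3 _ h5 hmov
          omega
    · push Not at h'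
      refine Or.inr (Or.inr ⟨v, hv, hact, h', fun i hi => ?_⟩)
      rw [orientStep]
      by_cases hiV : i < V
      · rw [if_pos hiV]
        by_cases hiv : i = v
        · rw [hiv, update_self, if_pos ⟨hch, fun ⟨e, he, h1⟩ => h' e he h1⟩]
        · rw [if_neg fun h1 => hiv (huniq i h1.1), update_of_ne hiv]
      · rw [if_neg hiV, if_neg, update_of_ne (by omega)]
        rintro ⟨u, -, h1, h2, -⟩
        exact h' _ (by omega) (huniq u h1 ▸ h2)
  · push Not at h
    refine Or.inl ⟨h, fun i hi => ?_⟩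
    rw [orientStep]
    by_cases hiV : i < V
    · rw [if_pos hiV, if_neg fun h1 => h i hiV h1.1.1]
    · rw [if_neg hiV, if_neg]
      rintro ⟨u, hu, h1, -⟩
      exact h u hu h1.1

/-- The invariant: along the chosen orientation an edge descends by at most one, and a vertex that
has been raised is full. -/
structure OrientInv (V M : ℕ) (ok : ℕ → Prop) (a b : ℕ → ℕ) (cap : ℕ → ℝ) (A : ℕ → ℕ) :
    Prop where
  out : ∀ i, V + M ≤ i → A i = 0
  le : ∀ v < V, A v ≤ V
  edge : ∀ e < M, ok e → A (cur V a b A e) ≤ A (oth V a b A e) + 1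
  full : ∀ v < V, 0 < A v → cap v ≤ load M ok (cur V a b A) v

/-- The potential: the total height of the vertices, and of the ends that are not chosen. -/
def potential (V M : ℕ) (ok : ℕ → Prop) (a b : ℕ → ℕ) (A : ℕ → ℕ) : ℕ :=
  ∑ v ∈ Finset.range V, A v + ∑ e ∈ (Finset.range M).filter ok, A (oth V a b A e)

/-- A round preserves the invariant, and it increases the potential unless no vertex is active. -/
theorem OrientInv.step (ha : ∀ e < M, ok e → a e < V) (hb : ∀ e < M, ok e → b e < V)
    (hcap : ∀ v < V, ∃ z : ℤ, cap v = z) {A A' : ℕ → ℕ} (hA : OrientInv V M ok a b cap A)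
    (hA' : A' = arr (V + M) (orientStep V M ok a b cap A)) :
    OrientInv V M ok a b cap A' ∧ ((∀ v < V, ¬ active V M ok a b cap A v) ∧ A' = A ∨
      potential V M ok a b A < potential V M ok a b A') := by
  have hout : ∀ i, V + M ≤ i → A' i = 0 := fun i hi => by
    rw [hA', arr, if_neg (by omega)]; rfl
  have hcur : ∀ e < M, ok e → cur V a b A e < V := fun e he hoe => by
    unfold cur; split_ifs; exacts [ha e he hoe, hb e he hoe]
  have hoth : ∀ e < M, ok e → oth V a b A e < V := fun e he hoe => by
    unfold oth; split_ifs; exacts [hb e he hoe, ha e he hoe]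
  rcases orientStep_cases (V := V) (M := M) (ok := ok) (a := a) (b := b) (cap := cap) A with
    ⟨hno, h⟩ | ⟨v, hv, e, he, hact, hmov, h⟩ | ⟨v, hv, hact, hno, h⟩
  · have : A' = A := by
      funext i
      by_cases hi : i < V + M
      · rw [hA', arr, if_pos hi, h i hi]
      · rw [hout i (by omega), hA.out i (by omega)]
    rw [this]
    exact ⟨hA, Or.inl ⟨hno, rfl⟩⟩
  · have hA2 : A' = update A (V + e) (if A (V + e) = 0 then 1 else 0) := by
      funext i
      by_cases hi : i < V + M
      · rw [hA', arr, if_pos hi, h i hi]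
      · rw [hout i (by omega), update_of_ne (by omega), hA.out i (by omega)]
    have hh : ∀ u < V, A' u = A u := fun u hu => by rw [hA2, update_of_ne (by omega)]
    obtain ⟨hoe, hce, hlt⟩ := hmov
    rw [rd_nat, rd_nat, Nat.cast_lt] at hlt
    have hc' : ∀ f, f ≠ e → cur V a b A' f = cur V a b A f := fun f hf => by
      unfold cur; rw [rd_nat, rd_nat, hA2, update_of_ne (by omega)]
    have ho' : ∀ f, f ≠ e → oth V a b A' f = oth V a b A f := fun f hf => by
      unfold oth; rw [rd_nat, rd_nat, hA2, update_of_ne (by omega)]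
    have hce' : cur V a b A' e = oth V a b A e := by
      unfold cur oth; rw [rd_nat, rd_nat, hA2, update_self]
      by_cases h0 : A (V + e) = 0 <;> simp [h0]
    have hoe' : oth V a b A' e = v := by
      rw [← hce]
      unfold cur oth; rw [rd_nat, rd_nat, hA2, update_self]
      by_cases h0 : A (V + e) = 0 <;> simp [h0]
    have hwne : oth V a b A e ≠ v := fun h => by rw [h] at hlt; omega
    -- only the loads of the two ends of the moved edge change
    have hload : ∀ u, load M ok (cur V a b A) u ≤ load M ok (cur V a b A') u +
        if u = v then 1 else 0 := fun u => by
      rw [load, load, nsum, nsum]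
      rw [← Finset.add_sum_erase _ _ (Finset.mem_range.2 he),
        ← Finset.add_sum_erase _ (fun f => if ok f ∧ cur V a b A' f = u then 1 else 0)
          (Finset.mem_range.2 he)]
      have : ∑ f ∈ (Finset.range M).erase e, (if ok f ∧ cur V a b A f = u then 1 else 0) =
          ∑ f ∈ (Finset.range M).erase e, if ok f ∧ cur V a b A' f = u then 1 else 0 :=
        Finset.sum_congr rfl fun f hf => by rw [hc' f (Finset.ne_of_mem_erase hf)]
      rw [this, hce, hce']
      by_cases huv : u = v
      · simp only [huv, hoe, true_and, if_true, if_neg hwne]; omega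
      · simp only [if_neg huv, hoe, true_and, if_neg (Ne.symm huv)]; split_ifs <;> omega
    refine ⟨⟨hout, fun u hu => by rw [hh u hu]; exact hA.le u hu, fun f hf hof => ?_,
      fun u hu h0 => ?_⟩, Or.inr ?_⟩
    · by_cases hfe : f = e
      · subst hfe
        rw [hce', hoe', hh _ (hoth f hf hof), hh v hv]; omega
      · rw [hc' f hfe, ho' f hfe, hh _ (hcur f hf hof), hh _ (hoth f hf hof)]
        exact hA.edge f hf hof
    · rw [hh u hu] at h0
      have h1 := hload u
      by_cases huv : u = v
      · subst huv
        rw [if_pos rfl] at h1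
        obtain ⟨z, hz⟩ := hcap u hu
        have h2 := hact.1
        rw [hz] at h2 ⊢
        have h3 : z < load M ok (cur V a b A) u := by exact_mod_cast h2
        have h4 : z ≤ load M ok (cur V a b A') u := by omega
        exact_mod_cast h4
      · rw [if_neg huv, add_zero] at h1
        exact (hA.full u hu h0).trans (by exact_mod_cast h1)
    · unfold potential
      refine add_lt_add_of_le_of_lt (Finset.sum_le_sum fun u hu => ?_)
        (Finset.sum_lt_sum (fun f hf => ?_) ⟨e, ?_, ?_⟩)
      · rw [hh u (Finset.mem_range.1 hu)]
      · rw [Finset.mem_filter, Finset.mem_range] at hf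
        by_cases hfe : f = e
        · subst hfe; rw [hoe', hh v hv]; exact hlt.le
        · rw [ho' f hfe, hh _ (hoth f hf.1 hf.2)]
      · exact Finset.mem_filter.2 ⟨Finset.mem_range.2 he, hoe⟩
      · rw [hoe', hh v hv]; exact hlt
  · have hA2 : A' = update A v (A v + 1) := by
      funext i
      by_cases hi : i < V + M
      · rw [hA', arr, if_pos hi, h i hi]
      · rw [hout i (by omega), update_of_ne (by omega), hA.out i (by omega)]
    have hc' : cur V a b A' = cur V a b A := by
      funext f; unfold cur; rw [rd_nat, rd_nat, hA2, update_of_ne (by omega)]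
    have ho' : oth V a b A' = oth V a b A := by
      funext f; unfold oth; rw [rd_nat, rd_nat, hA2, update_of_ne (by omega)]
    have hge : ∀ u, A u ≤ A' u := fun u => by
      rw [hA2, update_apply]; split_ifs with h1
      · rw [h1]; omega
      · exact le_rfl
    have hne : ∀ u, u ≠ v → A' u = A u := fun u hu => by rw [hA2, update_of_ne hu]
    have hvv : A' v = A v + 1 := by rw [hA2, update_self]
    have hvV : A v < V := by have := hact.2; rw [rd_nat] at this; exact_mod_cast this
    refine ⟨⟨hout, fun u hu => ?_, fun f hf hof => ?_, fun u hu h0 => ?_⟩, Or.inr ?_⟩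
    · by_cases huv : u = v
      · rw [huv, hvv]; omega
      · rw [hne u huv]; exact hA.le u hu
    · rw [hc', ho']
      by_cases hfv : cur V a b A f = v
      · have h1 := hno f hf
        have h2 : A v ≤ A (oth V a b A f) := by
          by_contra h3
          exact h1 ⟨hof, hfv, by rw [rd_nat, rd_nat]; exact_mod_cast not_le.1 h3⟩
        rw [hfv, hvv]
        have := hge (oth V a b A f)
        omega
      · rw [hne _ hfv]
        have := hge (oth V a b A f)
        have := hA.edge f hf hof
        omega
    · rw [hc']
      by_cases huv : u = v
      · rw [huv]; exact hact.1.le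
      · rw [hne u huv] at h0; exact hA.full u hu h0
    · unfold potential
      rw [ho']
      refine add_lt_add_of_lt_of_le (Finset.sum_lt_sum (fun u _ => hge u)
        ⟨v, Finset.mem_range.2 hv, by rw [hvv]; omega⟩) (Finset.sum_le_sum fun f _ => hge _)

theorem OrientInv.potential_le (ha : ∀ e < M, ok e → a e < V) (hb : ∀ e < M, ok e → b e < V)
    {A : ℕ → ℕ} (hA : OrientInv V M ok a b cap A) : potential V M ok a b A ≤ V * V + M * V := by
  refine add_le_add ((Finset.sum_le_card_nsmul _ _ V fun v hv =>
    hA.le v (Finset.mem_range.1 hv)).trans (by simp)) ((Finset.sum_le_card_nsmul _ _ V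
    fun e he => ?_).trans ?_)
  · rw [Finset.mem_filter, Finset.mem_range] at he
    refine hA.le _ ?_
    unfold oth; split_ifs; exacts [hb e he.1 he.2, ha e he.1 he.2]
  · rw [smul_eq_mul]
    exact Nat.mul_le_mul_right _ ((Finset.card_filter_le _ _).trans (by simp))

/-- In the final state no vertex is active. -/
theorem orientState_spec (ha : ∀ e < M, ok e → a e < V) (hb : ∀ e < M, ok e → b e < V)
    (hcap : ∀ v < V, ∃ z : ℤ, cap v = z) :
    OrientInv V M ok a b cap (orientState V M ok a b cap) ∧
      ∀ v < V, ¬ active V M ok a b cap (orientState V M ok a b cap) v := by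
  set S := iterArr (V + M) (fun _ => 0) (fun _ A i => orientStep V M ok a b cap A i) with hS
  have h0 : S 0 = fun _ => 0 := by funext i; simp [hS, iterArr, arr, Scal.zero]
  have key : ∀ t, OrientInv V M ok a b cap (S t) ∧
      ((∀ v < V, ¬ active V M ok a b cap (S t) v) ∨ t ≤ potential V M ok a b (S t)) := by
    intro t
    induction t with
    | zero => exact ⟨by rw [h0]; exact ⟨by simp, by simp, by simp, by simp⟩, Or.inr (by simp)⟩
    | succ t ih =>
      obtain ⟨h1, h2⟩ := ih
      obtain ⟨h3, h4⟩ := h1.step ha hb hcap (A' := S (t + 1)) rfl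
      refine ⟨h3, ?_⟩
      rcases h4 with ⟨h4, h5⟩ | h4
      · rw [h5]; exact Or.inl h4
      · rcases h2 with h2 | h2
        · rcases (h1.step ha hb hcap (A' := S (t + 1)) rfl).2 with ⟨h6, h7⟩ | h6
          · rw [h7]; exact Or.inl h2
          · exfalso
            rcases orientStep_cases (V := V) (M := M) (ok := ok) (a := a) (b := b) (cap := cap)
              (S t) with ⟨-, h⟩ | ⟨v, hv, e, he, hact, -⟩ | ⟨v, hv, hact, -⟩
            · have : S (t + 1) = S t := by
                funext i
                by_cases hi : i < V + M
                · rw [hS, iterArr, arr, if_pos hi]; exact h i hi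
                · rw [h3.out i (by omega), h1.out i (by omega)]
              rw [this] at h4; exact lt_irrefl _ h4
            · exact h2 v hv hact
            · exact h2 v hv hact
        · exact Or.inr (by omega)
  obtain ⟨h1, h2⟩ := key (V * V + M * V + 1)
  refine ⟨h1, h2.resolve_right fun h => ?_⟩
  have := h1.potential_le ha hb
  omega

theorem sum_load (x : ℕ → ℕ) (T : Finset ℕ) :
    ∑ v ∈ T, load M ok x v = (((Finset.range M).filter ok).filter fun e => x e ∈ T).card := by
  have h := Finset.card_eq_sum_card_fiberwise (f := x) (t := T)
    (s := ((Finset.range M).filter ok).filter fun e => x e ∈ T)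
    (fun e he => Finset.mem_coe.2 (Finset.mem_filter.1 (Finset.mem_coe.1 he)).2)
  rw [h]
  refine Finset.sum_congr rfl fun v hv => ?_
  rw [load_eq_card]
  congr 1
  ext e
  simp only [Finset.mem_filter]
  constructor
  · rintro ⟨h1, h2⟩; exact ⟨⟨h1, h2 ▸ hv⟩, h2⟩
  · rintro ⟨⟨h1, -⟩, h2⟩; exact ⟨h1, h2⟩

/-- If there is any orientation that respects the capacities, then the final state is one: otherwise
an overloaded vertex has the height `V`, there is a height `k < V` that does not occur, and the
edges at the vertices above `k` do not leave this set, which is too small for them. -/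
theorem orientState_load_le (ha : ∀ e < M, ok e → a e < V) (hb : ∀ e < M, ok e → b e < V)
    (hcap : ∀ v < V, ∃ z : ℤ, cap v = z) (y : ℕ → ℕ) (hy : ∀ e < M, ok e → y e = a e ∨ y e = b e)
    (hyl : ∀ v < V, load M ok y v ≤ cap v) {v : ℕ} (hv : v < V) :
    load M ok (cur V a b (orientState V M ok a b cap)) v ≤ cap v := by
  obtain ⟨hI, hno⟩ := orientState_spec ha hb hcap
  set A := orientState V M ok a b cap
  by_contra hover
  rw [not_le] at hover
  have hAv : A v = V := by
    refine le_antisymm (hI.le v hv) ?_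
    by_contra hlt
    exact hno v hv ⟨hover, by rw [rd_nat]; exact_mod_cast not_le.1 hlt⟩
  obtain ⟨k, hkV, hk⟩ : ∃ k < V, ∀ u < V, A u ≠ k := by
    by_contra hcon
    push Not at hcon
    have h1 : Finset.range (V + 1) ⊆ (Finset.range V).image A := fun k hk => by
      rw [Finset.mem_range] at hk
      rw [Finset.mem_image]
      rcases Nat.lt_succ_iff_lt_or_eq.1 hk with hk | hk
      · obtain ⟨u, hu, h⟩ := hcon k hk
        exact ⟨u, Finset.mem_range.2 hu, h⟩
      · exact ⟨v, Finset.mem_range.2 hv, by rw [hAv, hk]⟩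
    have h2 := Finset.card_le_card h1
    have h3 := Finset.card_image_le (s := Finset.range V) (f := A)
    simp only [Finset.card_range] at h2 h3
    omega
  set T := (Finset.range V).filter fun u => k < A u with hT
  have h1 : ∑ u ∈ T, load M ok (cur V a b A) u ≤ ∑ u ∈ T, load M ok y u := by
    rw [sum_load, sum_load]
    refine Finset.card_le_card fun e he => ?_
    rw [Finset.mem_filter, Finset.mem_filter, Finset.mem_range] at he ⊢
    obtain ⟨⟨heM, hoe⟩, hcT⟩ := he
    refine ⟨⟨heM, hoe⟩, ?_⟩
    have hcV := hcT
    rw [hT, Finset.mem_filter] at hcT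
    have hoV : oth V a b A e < V := by
      unfold oth; split_ifs; exacts [hb e heM hoe, ha e heM hoe]
    have hoT : oth V a b A e ∈ T := by
      rw [hT, Finset.mem_filter, Finset.mem_range]
      have := hI.edge e heM hoe
      have := hk _ hoV
      exact ⟨hoV, by omega⟩
    unfold cur at hcV
    unfold oth at hoT
    rcases hy e heM hoe with h | h <;> rw [h] <;> split_ifs at hcV hoT <;> assumption
  have h2 : (∑ u ∈ T, load M ok y u : ℝ) ≤ ∑ u ∈ T, cap u :=
    Finset.sum_le_sum fun u hu => hyl u (Finset.mem_range.1 (Finset.mem_filter.1 hu).1)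
  have h3 : ∑ u ∈ T, cap u < (∑ u ∈ T, load M ok (cur V a b A) u : ℝ) := by
    refine Finset.sum_lt_sum (fun u hu => ?_) ⟨v, ?_, hover⟩
    · rw [hT, Finset.mem_filter, Finset.mem_range] at hu
      exact hI.full u hu.1 (by omega)
    · rw [hT, Finset.mem_filter, Finset.mem_range]; exact ⟨hv, by omega⟩
  have h4 : (∑ u ∈ T, load M ok (cur V a b A) u : ℝ) ≤ (∑ u ∈ T, load M ok y u : ℝ) := by
    exact_mod_cast h1
  linarith

end Orientation

section Comp

variable {γ : Type} [Ctx γ]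

open Classical in
@[fun_prop] theorem Comp.orient {V M : γ → ℕ} {ok : γ → ℕ → Prop} {a b : γ → ℕ → ℕ}
    {cap : γ → ℕ → ℝ} {h : γ → (ℕ → ℕ) → ℝ} (hV : Comp V) (hM : Comp M)
    (hok : Comp (fun p : γ × ℕ => ok p.1 p.2)) (ha : Comp (fun p : γ × ℕ => a p.1 p.2))
    (hb : Comp (fun p : γ × ℕ => b p.1 p.2)) (hcap : Comp (fun p : γ × ℕ => cap p.1 p.2))
    (hh : Comp (fun p : γ × (ℕ → ℕ) => h p.1 p.2)) :
    Comp (fun x => PenroseTomography.orient (V x) (M x) (ok x) (a x) (b x) (cap x) (h x)) := by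
  refine Comp.withIter (by fun_prop) (by fun_prop) ?_ ?_ hh
  · exact Comp.const (α := ℝ) ((0 : ℕ) : ℝ)
  · have h1 : Comp (fun p : ((γ × ℕ) × (ℕ → ℕ)) × ℕ =>
      if p.2 < V p.1.1.1 then
        if chosen (V p.1.1.1) (M p.1.1.1) (ok p.1.1.1) (a p.1.1.1) (b p.1.1.1) (cap p.1.1.1)
            p.1.2 p.2 ∧ ¬ PenroseTomography.bex (M p.1.1.1) fun e =>
              movable (V p.1.1.1) (ok p.1.1.1) (a p.1.1.1) (b p.1.1.1) p.1.2 p.2 e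
        then PenroseTomography.rd p.1.2 p.2 + 1 else PenroseTomography.rd p.1.2 p.2
      else if PenroseTomography.bex (V p.1.1.1) fun v =>
          chosen (V p.1.1.1) (M p.1.1.1) (ok p.1.1.1) (a p.1.1.1) (b p.1.1.1) (cap p.1.1.1)
            p.1.2 v ∧
          movable (V p.1.1.1) (ok p.1.1.1) (a p.1.1.1) (b p.1.1.1) p.1.2 v (p.2 - V p.1.1.1) ∧
          PenroseTomography.ball (p.2 - V p.1.1.1) fun e =>
            ¬ movable (V p.1.1.1) (ok p.1.1.1) (a p.1.1.1) (b p.1.1.1) p.1.2 v e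
        then if PenroseTomography.rd p.1.2 p.2 = 0 then (1 : ℝ) else (0 : ℝ)
        else PenroseTomography.rd p.1.2 p.2) := by
      unfold chosen active movable load cur oth
      fun_prop
    convert h1 using 2 with p
    simp only [orientStep, Scal.val]
    split_ifs <;> simp [PenroseTomography.rd, Scal.val]

end Comp

end

end PenroseTomography

/-! ### Arithmetic in `ℤ[ζ₅]` -/

namespace PenroseTomography

noncomputable section

open ComplexConjugate

theorem zeta_isPrimitiveRoot : IsPrimitiveRoot zeta 5 := by
  have := Complex.isPrimitiveRoot_exp 5 (by norm_num)
  simpa [zeta] using this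

theorem zeta_pow_five : zeta ^ 5 = 1 := zeta_isPrimitiveRoot.pow_eq_one

theorem zeta_ne_zero : zeta ≠ 0 := fun h => by simpa [h] using zeta_pow_five

theorem zeta_geom : zeta ^ 4 = -1 - zeta - zeta ^ 2 - zeta ^ 3 := by
  have := zeta_isPrimitiveRoot.geom_sum_eq_zero (by norm_num)
  simp only [Finset.sum_range_succ, Finset.sum_range_zero, pow_zero, pow_one, zero_add] at this
  linear_combination this

theorem conj_zeta : conj zeta = zeta ^ 4 := by
  have h : Complex.normSq zeta = 1 := by
    rw [Complex.normSq_eq_norm_sq, zeta_isPrimitiveRoot.norm'_eq_one (by norm_num), one_pow]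
  have h1 : zeta * conj zeta = 1 := by rw [Complex.mul_conj, h, Complex.ofReal_one]
  have h2 : zeta * zeta ^ 4 = 1 := by rw [← zeta_pow_five]; ring
  exact mul_left_cancel₀ zeta_ne_zero (h1.trans h2.symm)

theorem zeta_isIntegral : IsIntegral ℤ zeta := zeta_isPrimitiveRoot.isIntegral (by norm_num)

theorem point_eq (a : Coords) :
    point a = a 0 + a 1 * zeta + a 2 * zeta ^ 2 + a 3 * zeta ^ 3 := by
  simp [point, Fin.sum_univ_four]

theorem point_add (a b : Coords) : point (a + b) = point a + point b := by
  simp only [point_eq, Pi.add_apply]; push_cast; ring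

theorem point_sub (a b : Coords) : point (a - b) = point a - point b := by
  simp only [point_eq, Pi.sub_apply]; push_cast; ring

/-- The powers `1, ζ₅, ζ₅², ζ₅³` are linearly independent over `ℚ`. -/
theorem point_injective : Function.Injective point := by
  have h4 : (minpoly ℚ zeta).natDegree = 4 := by
    rw [← Polynomial.cyclotomic_eq_minpoly_rat zeta_isPrimitiveRoot (by norm_num),
      Polynomial.natDegree_cyclotomic]
    decide
  have hli := linearIndependent_pow (K := ℚ) zeta
  have hz : ∀ a : Coords, point a = 0 → a = 0 := by
    intro a ha
    have := Fintype.linearIndependent_iff.1 hli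
      (fun i => (a ⟨i, by have := i.2; omega⟩ : ℚ)) (by
        rw [← ha, point]
        refine Fintype.sum_equiv (finCongr h4) _ _ fun i => ?_
        simp only [Rat.smul_def, Rat.cast_intCast]
        rfl)
    funext j
    have h := this ⟨j, by rw [h4]; exact j.2⟩
    simpa using h
  intro a b hab
  have := hz (a - b) (by rw [point_sub, hab, sub_self])
  exact sub_eq_zero.1 this

theorem mem_cycloInts_add {x y : ℂ} (hx : x ∈ cycloInts) (hy : y ∈ cycloInts) :
    x + y ∈ cycloInts := by
  obtain ⟨a, rfl⟩ := hx
  obtain ⟨b, rfl⟩ := hy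
  exact ⟨a + b, point_add a b⟩

theorem mem_cycloInts_sub {x y : ℂ} (hx : x ∈ cycloInts) (hy : y ∈ cycloInts) :
    x - y ∈ cycloInts := by
  obtain ⟨a, rfl⟩ := hx
  obtain ⟨b, rfl⟩ := hy
  exact ⟨a - b, point_sub a b⟩

theorem mem_cycloInts_zeta_mul {x : ℂ} (hx : x ∈ cycloInts) : zeta * x ∈ cycloInts := by
  obtain ⟨a, rfl⟩ := hx
  refine ⟨![-a 3, a 0 - a 3, a 1 - a 3, a 2 - a 3], ?_⟩
  simp [point_eq]
  linear_combination -(a 3 : ℂ) * zeta_geom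

theorem mem_cycloInts_int_mul (n : ℤ) {x : ℂ} (hx : x ∈ cycloInts) : n * x ∈ cycloInts := by
  obtain ⟨a, rfl⟩ := hx
  refine ⟨fun j => n * a j, ?_⟩
  simp only [point_eq]; push_cast; ring

theorem mem_cycloInts_mul {x y : ℂ} (hx : x ∈ cycloInts) (hy : y ∈ cycloInts) :
    x * y ∈ cycloInts := by
  obtain ⟨a, rfl⟩ := hx
  have h1 := mem_cycloInts_zeta_mul hy
  have h2 := mem_cycloInts_zeta_mul h1
  have h3 := mem_cycloInts_zeta_mul h2
  have := mem_cycloInts_add (mem_cycloInts_add (mem_cycloInts_add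
    (mem_cycloInts_int_mul (a 0) hy) (mem_cycloInts_int_mul (a 1) h1))
    (mem_cycloInts_int_mul (a 2) h2)) (mem_cycloInts_int_mul (a 3) h3)
  convert this using 1
  rw [point_eq]; ring

theorem one_mem_cycloInts : (1 : ℂ) ∈ cycloInts := ⟨![1, 0, 0, 0], by simp [point_eq]⟩

theorem zeta_pow_mem_cycloInts (k : ℕ) : zeta ^ k ∈ cycloInts := by
  induction k with
  | zero => simpa using one_mem_cycloInts
  | succ k ih => rw [pow_succ']; exact mem_cycloInts_zeta_mul ih

theorem mem_cycloInts_conj {x : ℂ} (hx : x ∈ cycloInts) : conj x ∈ cycloInts := by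
  obtain ⟨a, rfl⟩ := hx
  have : conj (point a) = a 0 * 1 + a 1 * zeta ^ 4 + a 2 * zeta ^ 8 + a 3 * zeta ^ 12 := by
    simp only [point_eq, map_add, map_mul, map_pow, conj_zeta, map_intCast]; ring
  rw [this]
  exact mem_cycloInts_add (mem_cycloInts_add (mem_cycloInts_add
    (mem_cycloInts_int_mul _ one_mem_cycloInts)
    (mem_cycloInts_int_mul _ (zeta_pow_mem_cycloInts 4)))
    (mem_cycloInts_int_mul _ (zeta_pow_mem_cycloInts 8)))
    (mem_cycloInts_int_mul _ (zeta_pow_mem_cycloInts 12))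

/-- `ℤ[ζ₅]` as a ring. -/
def cycloRing : Subring ℂ where
  carrier := cycloInts
  mul_mem' := mem_cycloInts_mul
  one_mem' := one_mem_cycloInts
  add_mem' := mem_cycloInts_add
  zero_mem' := ⟨0, by simp [point_eq]⟩
  neg_mem' {x} hx := by simpa using mem_cycloInts_int_mul (-1) hx

theorem isIntegral_of_mem {x : ℂ} (hx : x ∈ cycloInts) : IsIntegral ℤ x := by
  obtain ⟨a, rfl⟩ := hx
  exact IsIntegral.sum _ fun j _ => (isIntegral_algebraMap (x := a j)).mul (zeta_isIntegral.pow _)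

/-- A nonzero element of `ℤ[ζ₅]` divides a positive integer. -/
theorem exists_mul_eq_nat {x : ℂ} (hx : x ∈ cycloInts) (h0 : x ≠ 0) :
    ∃ c ∈ cycloInts, ∃ D : ℕ, 0 < D ∧ c * x = D := by
  have halg : IsAlgebraic ℤ (⟨x, hx⟩ : cycloRing) := by
    have := (isIntegral_of_mem hx).isAlgebraic
    refine (isAlgebraic_algebraMap_iff (A := ℂ) (R := ℤ) (S := cycloRing)
      Subtype.val_injective).1 ?_
    exact this
  obtain ⟨r, hr, y, hy⟩ := halg.exists_nonzero_dvd
    (mem_nonZeroDivisors_of_ne_zero fun h => h0 (congrArg Subtype.val h))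
  have e : (r : ℂ) = x * y := by simpa using congrArg Subtype.val hy
  refine ⟨(r.sign : ℂ) * y, mem_cycloInts_int_mul _ y.2, r.natAbs, Int.natAbs_pos.2 hr, ?_⟩
  rw [mul_assoc, mul_comm (y : ℂ), ← e]
  have : r.sign * r = (r.natAbs : ℤ) := by rw [Int.sign_mul_self_eq_abs, Int.abs_eq_natAbs]
  have := congrArg (Int.cast (R := ℂ)) this
  rwa [Int.cast_mul, Int.cast_natCast] at this

/-- An additive map that preserves `ℤ[ζ₅]` is given by an integer matrix. -/
theorem exists_matrix (L : ℂ →+ ℂ) (hL : ∀ x ∈ cycloInts, L x ∈ cycloInts) :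
    ∃ A : Fin 4 → Fin 4 → ℤ, ∀ a, L (point a) = point fun j => ∑ k, A k j * a k := by
  choose A hA using fun k : Fin 4 => hL _ (zeta_pow_mem_cycloInts k)
  refine ⟨A, fun a => ?_⟩
  have h : ∀ (n : ℤ) (x : ℂ), L (n * x) = n * L x := fun n x => by
    rw [← zsmul_eq_mul, map_zsmul, zsmul_eq_mul]
  rw [point, map_sum]
  simp only [h, ← hA]
  simp only [point_eq, Fin.sum_univ_four]
  push_cast
  ring

theorem cross_ne_zero {u₁ u₂ : ℂ} (h₂ : ‖u₂‖ = 1) (hne : LinearIndependent ℝ ![u₁, u₂]) :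
    (u₁ * conj u₂).im ≠ 0 := fun h => by
  have e : u₁ * conj u₂ = ((u₁ * conj u₂).re : ℂ) := by
    apply Complex.ext <;> simp [h]
  have h1 : conj u₂ * u₂ = 1 := by
    rw [mul_comm, Complex.mul_conj, Complex.normSq_eq_norm_sq, h₂]; simp
  have e2 : u₁ = ((u₁ * conj u₂).re : ℂ) * u₂ := by rw [← e, mul_assoc, h1, mul_one]
  have := (LinearIndependent.pair_iff.1 hne 1 (-(u₁ * conj u₂).re) (by
    simp only [Complex.real_smul]; push_cast; linear_combination e2)).1
  exact one_ne_zero this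

/-- Two lines with the given directions meet. -/
theorem exists_mem_lines {u₁ u₂ : ℂ} (h₂ : ‖u₂‖ = 1) (hne : LinearIndependent ℝ ![u₁, u₂])
    (x y : ℂ) : ∃ z, z ∈ line u₁ x ∧ z ∈ line u₂ y := by
  have hk := cross_ne_zero h₂ hne
  set s := ((y - x) * conj u₂).im / (u₁ * conj u₂).im with hs
  set w := (y - x - s * u₁) * conj u₂ with hw
  have hw0 : w.im = 0 := by
    have : w = (y - x) * conj u₂ - s * (u₁ * conj u₂) := by rw [hw]; ring
    rw [this, Complex.sub_im, Complex.im_ofReal_mul, hs, div_mul_cancel₀ _ hk, sub_self]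
  have h1 : conj u₂ * u₂ = 1 := by
    rw [mul_comm, Complex.mul_conj, Complex.normSq_eq_norm_sq, h₂]; simp
  have e : y - x - s * u₁ = w.re * u₂ := by
    have : (w.re : ℂ) = w := by apply Complex.ext <;> simp [hw0]
    rw [this, hw, mul_assoc, h1, mul_one]
  refine ⟨x + s * u₁, ⟨s, rfl⟩, -w.re, ?_⟩
  push_cast
  linear_combination -e

/-- The intersection of two lines through points of `ℤ[ζ₅]` is, up to a fixed denominator `D`, an
integer linear function of the coordinates of these points. By Cramer's rule the denominator is
`v₁ * conj v₂ - conj v₁ * v₂` for elements `vᵢ` of `ℤ[ζ₅]` in the two directions, and it divides a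
positive integer. -/
theorem exists_grid {u₁ u₂ : ℂ} (h₁ : IsCycloDirection u₁) (h₂ : IsCycloDirection u₂)
    (hne : LinearIndependent ℝ ![u₁, u₂]) :
    ∃ D : ℕ, 0 < D ∧ ∃ A B : Fin 4 → Fin 4 → ℤ, ∀ a b z, z ∈ line u₁ (point a) →
      z ∈ line u₂ (point b) →
        D * z = point fun j => ∑ k, A k j * a k + ∑ k, B k j * b k := by
  obtain ⟨-, v₁, hv₁, hv₁0, s₁, e₁⟩ := h₁
  obtain ⟨hn₂, v₂, hv₂, hv₂0, s₂, e₂⟩ := h₂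
  have hδ : v₁ * conj v₂ - conj v₁ * v₂ ≠ 0 := by
    have hk := cross_ne_zero hn₂ hne
    have hs₁ : s₁ ≠ 0 := fun h => hv₁0 (by rw [e₁, h]; simp)
    have hs₂ : s₂ ≠ 0 := fun h => hv₂0 (by rw [e₂, h]; simp)
    intro h
    have h3 : v₁ * conj v₂ - conj v₁ * v₂ = (s₁ * s₂ : ℂ) *
        (u₁ * conj u₂ - conj (u₁ * conj u₂)) := by
      rw [e₁, e₂]; simp only [map_mul, Complex.conj_ofReal, Complex.conj_conj]; ring
    rw [h3, Complex.sub_conj] at h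
    have hs₁' : (s₁ : ℂ) ≠ 0 := by exact_mod_cast hs₁
    have hs₂' : (s₂ : ℂ) ≠ 0 := by exact_mod_cast hs₂
    have hk' : ((u₁ * conj u₂).im : ℂ) ≠ 0 := by exact_mod_cast hk
    simp [hs₁', hs₂'] at h
    simp_all
  obtain ⟨c, hc, D, hD, hcD⟩ := exists_mul_eq_nat
    (mem_cycloInts_sub (mem_cycloInts_mul hv₁ (mem_cycloInts_conj hv₂))
      (mem_cycloInts_mul (mem_cycloInts_conj hv₁) hv₂)) hδ
  -- the contributions of the two lines to `D * z`; they preserve `ℤ[ζ₅]`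
  let L₂ : ℂ →+ ℂ :=
    { toFun := fun y => c * v₁ * (y * conj v₂ - conj y * v₂)
      map_zero' := by simp
      map_add' := fun x y => by rw [map_add]; ring }
  let L₁ : ℂ →+ ℂ :=
    { toFun := fun x => D * x - c * v₁ * (x * conj v₂ - conj x * v₂)
      map_zero' := by simp
      map_add' := fun x y => by rw [map_add]; ring }
  have hL₂ : ∀ x ∈ cycloInts, L₂ x ∈ cycloInts := fun x hx =>
    mem_cycloInts_mul (mem_cycloInts_mul hc hv₁) (mem_cycloInts_sub
      (mem_cycloInts_mul hx (mem_cycloInts_conj hv₂))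
      (mem_cycloInts_mul (mem_cycloInts_conj hx) hv₂))
  have hL₁ : ∀ x ∈ cycloInts, L₁ x ∈ cycloInts := fun x hx =>
    mem_cycloInts_sub (by exact_mod_cast mem_cycloInts_int_mul D hx) (hL₂ x hx)
  obtain ⟨A, hA⟩ := exists_matrix L₁ hL₁
  obtain ⟨B, hB⟩ := exists_matrix L₂ hL₂
  refine ⟨D, hD, A, B, fun a b z ha hb => ?_⟩
  have e : point (fun j => ∑ k, A k j * a k + ∑ k, B k j * b k) =
      L₁ (point a) + L₂ (point b) := by
    rw [hA, hB, ← point_add]; rfl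
  rw [e]
  obtain ⟨s, hs⟩ := ha
  obtain ⟨t, ht⟩ := hb
  change _ = (D * point a - c * v₁ * (point a * conj v₂ - conj (point a) * v₂)) +
    c * v₁ * (point b * conj v₂ - conj (point b) * v₂)
  have ea : point a = z - s * u₁ := by rw [hs]; ring
  have eb : point b = z - t * u₂ := by rw [ht]; ring
  rw [ea, eb, ← hcD]
  simp only [map_sub, map_mul, Complex.conj_ofReal]
  have e₁' : conj v₁ = s₁ * conj u₁ := by rw [e₁]; simp
  have e₂' : conj v₂ = s₂ * conj u₂ := by rw [e₂]; simp
  rw [e₁', e₂', e₁, e₂]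
  ring

/-! ### Algebraic numbers -/

theorem isAlgebraic_re_im {w : ℂ} (hw : IsAlgebraic ℚ w) :
    IsAlgebraic ℚ w.re ∧ IsAlgebraic ℚ w.im := by
  have hI : IsAlgebraic ℚ Complex.I :=
    IsIntegral.isAlgebraic (IsIntegral.of_pow (n := 2) (by norm_num) (by
      rw [Complex.I_sq]; exact isIntegral_one.neg))
  have hc : IsAlgebraic ℚ (conj w) := by
    simpa using hw.algHom (Complex.conjAe.toAlgHom.restrictScalars ℚ)
  have h2 : IsAlgebraic ℚ (2 : ℂ) := isAlgebraic_natCast 2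
  have key : ∀ r : ℝ, IsAlgebraic ℚ (r : ℂ) → IsAlgebraic ℚ r := fun r hr =>
    (isAlgebraic_algebraMap_iff (A := ℂ) (R := ℚ) (S := ℝ) Complex.ofReal_injective).1 hr
  constructor <;> refine key _ ?_
  · rw [Complex.re_eq_add_conj]; exact (hw.add hc).mul h2.inv
  · rw [Complex.im_eq_sub_conj]; exact (hw.sub hc).mul (h2.mul hI).inv

theorem zeta_isAlgebraic : IsAlgebraic ℚ zeta :=
  (zeta_isIntegral.tower_top (A := ℚ)).isAlgebraic

theorem isAlgebraic_of_mem {x : ℂ} (hx : x ∈ cycloInts) : IsAlgebraic ℚ x :=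
  ((isIntegral_of_mem hx).tower_top (A := ℚ)).isAlgebraic

end

end PenroseTomography

/-! ### Pentagons and windows -/

namespace PenroseTomography

noncomputable section

open ComplexConjugate

/-- `cos (4π/5)`, the negative of the inradius of the pentagon. -/
def cosTwo : ℝ := (zeta ^ 2).re

/-- The real part `cos (2π/5)` of `ζ₅` is the positive root of `4x² + 2x - 1`. -/
theorem zeta_rel : zeta.re ^ 2 + zeta.im ^ 2 = 1 ∧ 4 * zeta.re ^ 2 + 2 * zeta.re = 1 ∧
    0 < zeta.re ∧ 0 < zeta.im := by
  have e : zeta = Complex.exp (((2 * Real.pi / 5 : ℝ) : ℂ) * Complex.I) := by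
    rw [zeta]; congr 1; push_cast; ring
  have hre : zeta.re = Real.cos (2 * Real.pi / 5) := by rw [e, Complex.exp_ofReal_mul_I_re]
  have him : zeta.im = Real.sin (2 * Real.pi / 5) := by rw [e, Complex.exp_ofReal_mul_I_im]
  have hpi := Real.pi_pos
  have h1 : zeta.re ^ 2 + zeta.im ^ 2 = 1 := by rw [hre, him, Real.cos_sq_add_sin_sq]
  refine ⟨h1, ?_, ?_, ?_⟩
  · have h2 : zeta ^ 4 = conj zeta := conj_zeta.symm
    have h3 : zeta ^ 3 = conj (zeta ^ 2) := by
      rw [map_pow, conj_zeta]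
      linear_combination -zeta ^ 3 * zeta_pow_five
    have h4 := congrArg Complex.re zeta_geom
    rw [h2, h3] at h4
    simp [pow_two] at h4
    nlinarith
  · rw [hre]; exact Real.cos_pos_of_mem_Ioo ⟨by linarith, by linarith⟩
  · rw [him]; exact Real.sin_pos_of_pos_of_lt_pi (by linarith) (by linarith)

theorem cosTwo_eq : cosTwo = 2 * zeta.re ^ 2 - 1 := by
  obtain ⟨h1, -⟩ := zeta_rel
  simp only [cosTwo, pow_two, Complex.mul_re]
  nlinarith

theorem zeta_pow_mod (k : ℕ) : zeta ^ k = zeta ^ (k % 5) := by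
  conv_lhs => rw [← Nat.div_add_mod k 5, pow_add, pow_mul, zeta_pow_five, one_pow, one_mul]

theorem zeta_pow_re (k : ℕ) :
    (zeta ^ k).re = 1 ∨ (zeta ^ k).re = zeta.re ∨ (zeta ^ k).re = cosTwo := by
  rw [zeta_pow_mod]
  have : k % 5 < 5 := Nat.mod_lt _ (by norm_num)
  interval_cases k % 5
  · simp
  · simp
  · exact Or.inr (Or.inr rfl)
  · have h3 : zeta ^ 3 = conj (zeta ^ 2) := by
      rw [map_pow, conj_zeta]
      linear_combination -zeta ^ 3 * zeta_pow_five
    rw [h3, Complex.conj_re]; exact Or.inr (Or.inr rfl)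
  · rw [← conj_zeta, Complex.conj_re]; simp

theorem cosTwo_le_re (k : ℕ) : cosTwo ≤ (zeta ^ k).re := by
  obtain ⟨h1, h2, h3, h4⟩ := zeta_rel
  rcases zeta_pow_re k with h | h | h <;> rw [h] <;> rw [cosTwo_eq] <;> nlinarith

theorem zeta_pow_re_ne_zero (k : ℕ) : (zeta ^ k).re ≠ 0 := by
  obtain ⟨h1, h2, h3, h4⟩ := zeta_rel
  rcases zeta_pow_re k with h | h | h <;> rw [h]
  · norm_num
  · exact h3.ne'
  · rw [cosTwo_eq]; nlinarith

theorem pow_five_eq_one_iff (z : ℂ) : z ^ 5 = 1 ↔ ∃ k < 5, z = zeta ^ k := by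
  constructor
  · intro h
    obtain ⟨k, hk, e⟩ := zeta_isPrimitiveRoot.eq_pow_of_pow_eq_one h
    exact ⟨k, hk, e.symm⟩
  · rintro ⟨k, -, rfl⟩
    rw [← pow_mul, mul_comm, pow_mul, zeta_pow_five, one_pow]

theorem setOf_pow_five_finite : {z : ℂ | z ^ 5 = 1}.Finite :=
  ((Finset.range 5).image fun k => zeta ^ k).finite_toSet.subset fun z hz => by
    obtain ⟨k, hk, rfl⟩ := (pow_five_eq_one_iff z).1 hz
    simpa using ⟨k, hk, rfl⟩

theorem le_re_of_mem_pentagon {w : ℂ} (hw : w ∈ pentagon) (j : ℕ) :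
    cosTwo ≤ (w * zeta ^ j).re := by
  have h : pentagon ⊆ {w | cosTwo ≤ (w * zeta ^ j).re} := by
    refine convexHull_min ?_ ?_
    · intro z hz
      obtain ⟨k, -, rfl⟩ := (pow_five_eq_one_iff z).1 hz
      rw [Set.mem_ofPred_eq, ← pow_add]
      exact cosTwo_le_re _
    · intro x hx y hy a b ha hb hab
      simp only [Set.mem_ofPred_eq] at *
      have : ((a • x + b • y) * zeta ^ j).re = a * (x * zeta ^ j).re + b * (y * zeta ^ j).re := by
        simp only [Complex.real_smul, add_mul, Complex.add_re, mul_assoc, Complex.re_ofReal_mul]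
      rw [this]
      calc cosTwo = a * cosTwo + b * cosTwo := by rw [← add_mul, hab, one_mul]
        _ ≤ _ := add_le_add (mul_le_mul_of_nonneg_left hx ha) (mul_le_mul_of_nonneg_left hy hb)
  exact h hw

/-- A point that satisfies the five inequalities lies in the pentagon. Otherwise a linear functional
separates it from the pentagon; if this functional is minimal at the vertex `v`, then it is a
nonnegative combination of the functionals of the two edges at `v`. -/
theorem mem_pentagon_of_le {w : ℂ} (hw : ∀ j < 5, cosTwo ≤ (w * zeta ^ j).re) :
    w ∈ pentagon := by
  have hw' : ∀ j, cosTwo ≤ (w * zeta ^ j).re := fun j => by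
    rw [zeta_pow_mod]; exact hw _ (Nat.mod_lt _ (by norm_num))
  by_contra hnot
  have hcl : IsClosed pentagon := setOf_pow_five_finite.isClosed_convexHull ℝ
  obtain ⟨f, c, hf1, hf2⟩ := geometric_hahn_banach_point_closed (convex_convexHull ℝ _) hcl hnot
  set q : ℂ := ⟨f 1, -f Complex.I⟩ with hq
  have hfq : ∀ z, f z = (z * q).re := fun z => by
    conv_lhs => rw [← Complex.re_add_im z]
    have h1 : ((z.re : ℂ) + z.im * Complex.I) = z.re • (1 : ℂ) + z.im • Complex.I := by simp
    rw [h1, map_add, map_smul, map_smul]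
    simp [hq]
  obtain ⟨j, -, hj⟩ := Finset.exists_min_image (Finset.range 5) (fun k => f (zeta ^ k)) ⟨0, by simp⟩
  have hlt : f w < f (zeta ^ j) := hf1.trans (hf2 _ (subset_convexHull ℝ _
    ((pow_five_eq_one_iff _).2 ⟨j % 5, Nat.mod_lt _ (by norm_num), zeta_pow_mod j⟩)))
  set p := zeta ^ j * q with hp
  have hj' : ∀ k, p.re ≤ (zeta ^ k * p).re := fun k => by
    have := hj ((k + j) % 5) (Finset.mem_range.2 (Nat.mod_lt _ (by norm_num)))
    rw [← zeta_pow_mod, hfq, hfq, pow_add] at this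
    rwa [hp, ← mul_assoc]
  obtain ⟨h1, h2, h3, h4⟩ := zeta_rel
  have hc1 := hj' 1
  have hc4 := hj' 4
  rw [← conj_zeta] at hc4
  simp only [pow_one, Complex.mul_re, Complex.conj_re, Complex.conj_im] at hc1 hc4
  -- `w` rotated by the angle of the vertex
  obtain ⟨i, hi⟩ : ∃ i, zeta ^ (i + j) = 1 := ⟨4 * j, by
    rw [show 4 * j + j = 5 * j by ring, pow_mul, zeta_pow_five, one_pow]⟩
  set x := w * zeta ^ i with hx
  have hxp : (x * p).re = f w := by
    rw [hfq, hx, hp]; congr 1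
    linear_combination w * q * hi
  have hx2 := hw' (i + 2)
  have hx3 := hw' (i + 3)
  have e3 : zeta ^ 3 = conj (zeta ^ 2) := by
    rw [map_pow, conj_zeta]
    linear_combination -zeta ^ 3 * zeta_pow_five
  rw [pow_add, ← mul_assoc, ← hx] at hx2 hx3
  rw [e3] at hx3
  rw [← hxp, hfq (zeta ^ j), ← hp] at hlt
  rw [cosTwo_eq] at hx2 hx3
  simp only [pow_two, Complex.mul_re, Complex.mul_im, Complex.conj_re,
    Complex.conj_im] at hx2 hx3 hlt
  set C := zeta.re
  set S := zeta.im
  set X := x.re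
  set Y := x.im
  set a := p.re
  set b := p.im
  have hC : C < 1 := by nlinarith
  have hH : 0 < 1 - 2 * C ^ 2 := by nlinarith
  have hid : (1 - C) * (1 - 2 * C ^ 2) = 2 * C * S ^ 2 := by
    linear_combination (-2 * C) * h1 - (1 - C) * h2
  -- the coefficients of the functional, up to a common positive factor
  have hα : 0 ≤ -a * (2 * C * S) - b * (1 - 2 * C ^ 2) := by
    refine (mul_nonneg_iff_of_pos_left h4).1 ?_
    have := mul_nonneg (sub_nonneg.2 hc1) hH.le
    linarith [congrArg (fun t => a * t) hid]
  have hβ : 0 ≤ -a * (2 * C * S) + b * (1 - 2 * C ^ 2) := by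
    refine (mul_nonneg_iff_of_pos_left h4).1 ?_
    have := mul_nonneg (sub_nonneg.2 hc4) hH.le
    linarith [congrArg (fun t => a * t) hid]
  have hx2' : 0 ≤ (1 - 2 * C ^ 2) * (1 - X) - 2 * C * S * Y := by
    linear_combination hx2 - X * h1
  have hx3' : 0 ≤ (1 - 2 * C ^ 2) * (1 - X) + 2 * C * S * Y := by
    linear_combination hx3 - X * h1
  have hpos : 0 < 2 * (2 * C * S) * (1 - 2 * C ^ 2) := by positivity
  have := add_nonneg (mul_nonneg hβ hx2') (mul_nonneg hα hx3')
  have h5 : 0 ≤ 2 * (2 * C * S) * (1 - 2 * C ^ 2) * (X * a - Y * b - a) := by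
    linear_combination this
  have := (mul_nonneg_iff_of_pos_left hpos).1 h5
  linarith

theorem continuous_re_mul (c : ℂ) : Continuous fun w : ℂ => (w * c).re := by fun_prop

/-- The interior of the pentagon is given by five linear inequalities. -/
theorem mem_interior_pentagon {w : ℂ} :
    w ∈ interior pentagon ↔ ∀ j < 5, cosTwo < (w * zeta ^ j).re := by
  constructor
  · intro hw j _
    refine lt_of_le_of_ne (le_re_of_mem_pentagon (interior_subset hw) j) fun h => ?_
    obtain ⟨i, hi⟩ : ∃ i, zeta ^ (i + j) = 1 := ⟨4 * j, by
      rw [show 4 * j + j = 5 * j by ring, pow_mul, zeta_pow_five, one_pow]⟩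
    have hc : Filter.Tendsto (fun r : ℝ => w - r * zeta ^ i) (nhds 0) (nhds w) := by
      have : Continuous fun r : ℝ => w - r * zeta ^ i := by fun_prop
      simpa using this.tendsto 0
    have h1 := hc.eventually (mem_interior_iff_mem_nhds.1 hw)
    obtain ⟨ε, hε, h2⟩ := Metric.eventually_nhds_iff.1 h1
    have h3 := le_re_of_mem_pentagon (h2 (y := ε / 2) (by
      rw [Real.dist_eq, sub_zero, abs_of_pos (by linarith)]; linarith)) j
    have e : (w - (ε / 2 : ℝ) * zeta ^ i) * zeta ^ j = w * zeta ^ j - (ε / 2 : ℝ) := by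
      rw [sub_mul, mul_assoc, ← pow_add, hi, mul_one]
    rw [e, Complex.sub_re, Complex.ofReal_re, ← h] at h3
    linarith
  · intro hw
    have hopen : IsOpen {w : ℂ | ∀ j ∈ Finset.range 5, cosTwo < (w * zeta ^ j).re} := by
      have : {w : ℂ | ∀ j ∈ Finset.range 5, cosTwo < (w * zeta ^ j).re} =
          ⋂ j ∈ Finset.range 5, {w | cosTwo < (w * zeta ^ j).re} := by ext; simp
      rw [this]
      exact isOpen_biInter_finset fun j _ => isOpen_lt continuous_const (continuous_re_mul _)
    refine mem_interior.2 ⟨_, fun w hw => ?_, hopen, fun j hj => hw j (Finset.mem_range.1 hj)⟩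
    exact mem_pentagon_of_le fun j hj => (hw j (Finset.mem_range.2 hj)).le

theorem norm_le_of_mem_pentagon {w : ℂ} (hw : w ∈ pentagon) : ‖w‖ ≤ 1 := by
  have h : pentagon ⊆ Metric.closedBall 0 1 := by
    refine convexHull_min (fun z hz => ?_) (convex_closedBall _ _)
    rw [mem_closedBall_zero_iff]
    have h1 : ‖z‖ ^ 5 = 1 := by rw [← norm_pow, hz, norm_one]
    exact ((pow_eq_one_iff_of_nonneg (norm_nonneg z) (by norm_num)).1 h1).le
  simpa using h hw

/-- The factors of the four pentagons. -/
def factor : Fin 4 → ℝ := ![1, -1, Real.goldenRatio, -Real.goldenRatio]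

theorem factor_ne_zero (i : Fin 4) : factor i ≠ 0 := by
  have := Real.goldenRatio_ne_zero
  fin_cases i <;> simp [factor, this]

theorem pentagons_eq (i : Fin 4) : pentagons i = (fun z => (factor i : ℂ) * z) '' pentagon := by
  fin_cases i <;> simp [pentagons, factor]

/-- The factor of the pentagon over the residue class of `k`, for `k < 5`, and zero if there is
none. -/
def winFactor (π : Equiv.Perm (Fin 4)) (k : ℕ) : ℝ :=
  if h : 1 ≤ k ∧ k ≤ 4 then factor (π ⟨k - 1, by omega⟩) else 0

theorem winFactor_ne_zero {π : Equiv.Perm (Fin 4)} {k : ℕ} (h : k ≠ 0) (h' : k < 5) :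
    winFactor π k ≠ 0 := by
  rw [winFactor, dif_pos (by omega)]; exact factor_ne_zero _

theorem window_eq (π : Equiv.Perm (Fin 4)) {k : ℕ} (hk : k < 5) :
    window π (k : ZMod 5) =
      if k = 0 then ∅ else (fun z => (winFactor π k : ℂ) * z) '' pentagon := by
  have hcast : ∀ i : Fin 4, ((k : ZMod 5) = ((i : ℕ) + 1 : ZMod 5)) ↔ k = i + 1 := fun i => by
    rw [← Nat.cast_succ, ZMod.natCast_eq_natCast_iff', Nat.mod_eq_of_lt hk,
      Nat.mod_eq_of_lt (by omega)]
  ext w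
  simp only [window, Set.mem_ofPred_eq, hcast]
  split_ifs with h
  · simp only [Set.mem_empty_iff_false, iff_false]
    rintro ⟨i, h1, -⟩; omega
  · have h1 : 1 ≤ k ∧ k ≤ 4 := by omega
    rw [winFactor, dif_pos h1, ← pentagons_eq]
    constructor
    · rintro ⟨i, h2, h3⟩
      have : i = ⟨k - 1, by omega⟩ := Fin.ext (by simp; omega)
      rwa [this] at h3
    · intro h2
      exact ⟨⟨k - 1, by omega⟩, by simp; omega, h2⟩

theorem convex_window (π : Equiv.Perm (Fin 4)) (c : ZMod 5) : Convex ℝ (window π c) := by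
  have : c = ((c.val : ℕ) : ZMod 5) := (ZMod.natCast_zmod_val c).symm
  rw [this, window_eq π (ZMod.val_lt c)]
  split_ifs
  · exact convex_empty
  · have := (convex_convexHull ℝ {z : ℂ | z ^ 5 = 1}).is_linear_image
      (f := fun z => (winFactor π c.val : ℂ) * z) ⟨fun x y => mul_add _ _ _, fun r x => by
        simp only [Complex.real_smul]; ring⟩
    exact this

theorem mem_interior_window {π : Equiv.Perm (Fin 4)} {k : ℕ} (hk : k < 5) {w : ℂ} :
    w ∈ interior (window π (k : ZMod 5)) ↔
      k ≠ 0 ∧ ∀ j < 5, cosTwo < (w * zeta ^ j).re / winFactor π k := by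
  rw [window_eq π hk]
  split_ifs with h
  · simp [h]
  · have hρ := winFactor_ne_zero (π := π) h hk
    have hρ' : (winFactor π k : ℂ) ≠ 0 := by exact_mod_cast hρ
    have := (Homeomorph.mulLeft₀ _ hρ').image_interior pentagon
    simp only [Homeomorph.coe_mulLeft₀] at this
    rw [← this, Set.mem_image]
    simp only [h, ne_eq, not_false_eq_true, true_and]
    have e : ∀ v : ℂ, (v * zeta ^ 0).re = v.re := by simp
    have key : ∀ j, (w * zeta ^ j).re / winFactor π k =
        ((winFactor π k : ℂ)⁻¹ * w * zeta ^ j).re := fun j => by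
      rw [mul_assoc, ← Complex.ofReal_inv, Complex.re_ofReal_mul, div_eq_inv_mul]
    simp only [key]
    rw [← mem_interior_pentagon]
    constructor
    · rintro ⟨x, hx, rfl⟩
      rwa [inv_mul_cancel_left₀ hρ']
    · intro hx
      exact ⟨_, hx, mul_inv_cancel_left₀ hρ' _⟩

theorem norm_le_of_mem_window {π : Equiv.Perm (Fin 4)} {c : ZMod 5} {w : ℂ}
    (hw : w ∈ window π c) : ‖w‖ ≤ 2 := by
  obtain ⟨i, -, h⟩ := hw
  rw [pentagons_eq] at h
  obtain ⟨x, hx, rfl⟩ := h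
  have h1 := norm_le_of_mem_pentagon hx
  have h2 : |factor (π i)| ≤ 2 := by
    have h3 := Real.goldenRatio_lt_two.le
    have h4 := Real.goldenRatio_pos
    generalize π i = j
    fin_cases j <;> simp [factor, abs_of_pos h4, h3]
  rw [norm_mul, Complex.norm_real, Real.norm_eq_abs]
  nlinarith [norm_nonneg x]

end

end PenroseTomography

/-! ### Finite subsets of Penrose model sets -/

namespace PenroseTomography

noncomputable section

open MeasureTheory

theorem conj2_add (a b : Coords) : conj2 (a + b) = conj2 a + conj2 b := by
  simp [conj2, add_mul, Finset.sum_add_distrib]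

theorem conj2_sub (a b : Coords) : conj2 (a - b) = conj2 a - conj2 b := by
  simp [conj2, sub_mul, Finset.sum_sub_distrib]

theorem residue_add (a b : Coords) : residue (a + b) = residue a + residue b := by
  simp [residue, Finset.sum_add_distrib]

theorem residue_sub (a b : Coords) : residue (a - b) = residue a - residue b := by
  simp [residue, Finset.sum_sub_distrib]

/-- Almost all `u` are generic, because the boundary of a convex set is a null set. -/
theorem exists_isGeneric {π : Equiv.Perm (Fin 4)} {U : Set ℂ} (hU : IsOpen U) (hne : U.Nonempty) :
    ∃ u ∈ U, IsGeneric π u := by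
  have hnull : volume (⋃ a : Coords, (fun u => conj2 a - u) ⁻¹' frontier (window π (residue a)))
      = 0 := by
    refine measure_iUnion_null fun a => ?_
    rw [(Measure.measurePreserving_sub_left volume (conj2 a)).measure_preimage
      isClosed_frontier.measurableSet.nullMeasurableSet]
    exact (convex_window π _).addHaar_frontier volume
  by_contra! h
  refine (hU.measure_pos volume hne).ne' (measure_mono_null (fun u hu => ?_) hnull)
  have := h u hu
  simp only [IsGeneric, not_forall, not_not] at this
  exact Set.mem_iUnion.2 this

/-- For finite sets, genericity can be replaced by membership in the interior of the window. -/
theorem inPenrose_iff {π : Equiv.Perm (Fin 4)} {F : Finset ℂ} :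
    InPenrose π F ↔ ∃ t u : ℂ, ∀ f ∈ F, ∃ a, f = t + point a ∧
      conj2 a - u ∈ interior (window π (residue a)) := by
  constructor
  · rintro ⟨S, ⟨u, t, hu, rfl⟩, hF⟩
    refine ⟨t, u, fun f hf => ?_⟩
    obtain ⟨-, ⟨a, rfl, ha⟩, rfl⟩ := hF hf
    refine ⟨a, rfl, ?_⟩
    rw [← self_sdiff_frontier]
    exact ⟨ha, hu a⟩
  · rintro ⟨t, u, h⟩
    choose! a ha hu using h
    have hop : IsOpen {u | ∀ f ∈ F, conj2 (a f) - u ∈ interior (window π (residue (a f)))} := by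
      have : {u | ∀ f ∈ F, conj2 (a f) - u ∈ interior (window π (residue (a f)))} =
          ⋂ f ∈ F, (fun u => conj2 (a f) - u) ⁻¹' interior (window π (residue (a f))) := by
        ext; simp
      rw [this]
      exact isOpen_biInter_finset fun f _ => isOpen_interior.preimage (by fun_prop)
    obtain ⟨u', hu', hgen⟩ := exists_isGeneric (π := π) hop ⟨u, hu⟩
    exact ⟨_, ⟨u', t, hgen, rfl⟩, fun f hf =>
      ⟨_, ⟨a f, rfl, interior_subset (hu' f hf)⟩, (ha f hf).symm⟩⟩

theorem point_smul (n : ℤ) (a : Coords) : point (n • a) = n * point a := by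
  simp only [point_eq, Pi.smul_apply, smul_eq_mul]; push_cast; ring

variable {π : Equiv.Perm (Fin 4)} {D : ℕ} {g : ℕ → ℂ} {X : ℕ → Coords}

/-- A window that is shifted in the residue classes by `r` may be used as well: multiples of `1` in
`ℤ[ζ₅]` have every residue class, and the addition of `r` is undone by the translation. -/
theorem inPenrose_of_window (hD : 0 < D) {Z : Finset ℕ} (hg : ∀ e ∈ Z, D * g e = point (X e))
    (X₀ : Coords) {z : ℕ → Coords} (hz : ∀ e ∈ Z, X e - X₀ = (D : ℤ) • z e) (r : ℕ) (u : ℂ)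
    (h : ∀ e ∈ Z, conj2 (z e) - u ∈ interior (window π (residue (z e) + r))) :
    InPenrose π (Z.image g) := by
  have hD' : (D : ℂ) ≠ 0 := by exact_mod_cast hD.ne'
  set b : Coords := ![(r : ℤ), 0, 0, 0] with hb
  have hb1 : point b = r := by simp [point_eq, hb]
  have hb2 : conj2 b = r := by simp [conj2, hb, Fin.sum_univ_four]
  have hb3 : residue b = r := by simp [residue, hb, Fin.sum_univ_four]
  refine inPenrose_iff.2 ⟨point X₀ / D - r, u + r, fun f hf => ?_⟩
  obtain ⟨e, he, rfl⟩ := Finset.mem_image.1 hf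
  refine ⟨z e + b, ?_, ?_⟩
  · have := congrArg point (hz e he)
    rw [point_sub, point_smul, ← hg e he] at this
    rw [point_add, hb1]
    field_simp
    push_cast at this
    linear_combination this
  · rw [conj2_add, residue_add, hb2, hb3]
    have := h e he
    convert this using 1
    ring

/-- In a set contained in a Penrose model set, the differences to a reference point belong to
`ℤ[ζ₅]`, and they lie in a window that is shifted by the residue class of the reference point. -/
theorem exists_window {Z : Finset ℕ} (hg : ∀ e ∈ Z, D * g e = point (X e))
    (h : InPenrose π (Z.image g)) {e₀ : ℕ} (he₀ : e₀ ∈ Z) :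
    ∃ (z : ℕ → Coords) (r : ℕ) (u : ℂ), r < 5 ∧ (∀ e ∈ Z, X e - X e₀ = (D : ℤ) • z e) ∧
      ∀ e ∈ Z, conj2 (z e) - u ∈ interior (window π (residue (z e) + r)) := by
  obtain ⟨t, u, h⟩ := inPenrose_iff.1 h
  choose! a ha hu using fun e (he : e ∈ Z) => h (g e) (Finset.mem_image_of_mem _ he)
  refine ⟨fun e => a e - a e₀, (residue (a e₀)).val, u - conj2 (a e₀), ZMod.val_lt _,
    fun e he => ?_, fun e he => ?_⟩
  · apply point_injective
    rw [point_sub, point_smul, point_sub, ← hg e he, ← hg e₀ he₀, ha e he, ha e₀ he₀]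
    push_cast; ring
  · rw [conj2_sub, residue_sub, ZMod.natCast_zmod_val, sub_add_cancel]
    convert hu e he using 1
    ring

/-! ### Systems of linear inequalities in the plane -/

/-- A finite system of strict linear inequalities in one variable with a bounded solution set
is solved by the midpoint of two of the boundary points. -/
theorem exists_midpoint {ι : Type*} (K : Finset ι) (α β : ι → ℝ) {x₀ R : ℝ}
    (h₀ : ∀ i ∈ K, 0 < α i + β i * x₀) (hR : ∀ x, (∀ i ∈ K, 0 < α i + β i * x) → |x| ≤ R) :
    ∃ i ∈ K, ∃ j ∈ K, β i ≠ 0 ∧ β j ≠ 0 ∧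
      ∀ k ∈ K, 0 < α k + β k * ((-α i / β i + -α j / β j) / 2) := by
  classical
  have hpos : (K.filter fun i => 0 < β i).Nonempty := by
    by_contra hne
    rw [Finset.not_nonempty_iff_eq_empty, Finset.filter_eq_empty_iff] at hne
    have h1 := hR (min x₀ (-R - 1)) fun i hi => (h₀ i hi).trans_le (by
      have := mul_le_mul_of_nonpos_left (min_le_left x₀ (-R - 1)) (not_lt.1 (hne hi))
      linarith)
    have := (abs_le.1 h1).1
    linarith [min_le_right x₀ (-R - 1)]
  have hneg : (K.filter fun i => β i < 0).Nonempty := by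
    by_contra hne
    rw [Finset.not_nonempty_iff_eq_empty, Finset.filter_eq_empty_iff] at hne
    have h1 := hR (max x₀ (R + 1)) fun i hi => (h₀ i hi).trans_le (by
      have := mul_le_mul_of_nonneg_left (le_max_left x₀ (R + 1)) (not_lt.1 (hne hi))
      linarith)
    have := (abs_le.1 h1).2
    linarith [le_max_right x₀ (R + 1)]
  obtain ⟨i, hi, hi'⟩ := Finset.exists_max_image _ (fun i => -α i / β i) hpos
  obtain ⟨j, hj, hj'⟩ := Finset.exists_min_image _ (fun i => -α i / β i) hneg
  rw [Finset.mem_filter] at hi hj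
  have hix : -α i / β i < x₀ := by
    rw [div_lt_iff₀ hi.2]; linarith [h₀ i hi.1]
  have hjx : x₀ < -α j / β j := by
    rw [lt_div_iff_of_neg hj.2]; linarith [h₀ j hj.1]
  refine ⟨i, hi.1, j, hj.1, hi.2.ne', hj.2.ne, fun k hk => ?_⟩
  set y := (-α i / β i + -α j / β j) / 2 with hy
  rcases lt_trichotomy (β k) 0 with h | h | h
  · have h1 := hj' k (Finset.mem_filter.2 ⟨hk, h⟩)
    have h2 : y < -α k / β k := by linarith
    rw [lt_div_iff_of_neg h] at h2
    linarith
  · have := h₀ k hk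
    rw [h] at this ⊢
    linarith
  · have h1 := hi' k (Finset.mem_filter.2 ⟨hk, h⟩)
    have h2 : -α k / β k < y := by linarith
    rw [div_lt_iff₀ h] at h2
    linarith

/-- The second coordinate of the point where the lines `x - m k * y = κ k` and
`x - m l * y = κ l` meet. -/
def crossing (m κ : ℕ → ℝ) (k l : ℕ) : ℝ := (κ l - κ k) / (m k - m l)

/-- Fourier–Motzkin elimination: a finite system of strict linear inequalities in the plane with
a bounded solution set is solved by a point that is determined by six of the boundary lines. -/
theorem exists_six (K : Finset ℕ) (m κ s : ℕ → ℝ) (hs : ∀ k ∈ K, s k ≠ 0) {x₀ y₀ R : ℝ}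
    (h₀ : ∀ k ∈ K, 0 < s k * (κ k - (x₀ - m k * y₀)))
    (hR : ∀ x y, (∀ k ∈ K, 0 < s k * (κ k - (x - m k * y))) → |x| ≤ R ∧ |y| ≤ R) :
    ∃ k₁ ∈ K, ∃ k₂ ∈ K, ∃ k₃ ∈ K, ∃ k₄ ∈ K, ∃ k₅ ∈ K, ∃ k₆ ∈ K, ∀ x y,
      y = (crossing m κ k₁ k₂ + crossing m κ k₃ k₄) / 2 →
      x = ((κ k₅ + m k₅ * y) + (κ k₆ + m k₆ * y)) / 2 →
      ∀ k ∈ K, 0 < s k * (κ k - (x - m k * y)) := by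
  classical
  -- the system at a fixed value of `y`
  have hx : ∀ x y, (∀ k ∈ K, 0 < s k * (κ k - (x - m k * y))) → ∃ k₅ ∈ K, ∃ k₆ ∈ K,
      ∀ k ∈ K, 0 < s k * (κ k - (((κ k₅ + m k₅ * y) + (κ k₆ + m k₆ * y)) / 2 - m k * y)) := by
    intro x y hxy
    obtain ⟨i, hi, j, hj, -, -, H⟩ := exists_midpoint K (fun k => s k * (κ k + m k * y))
      (fun k => -s k) (x₀ := x) (R := R) (fun k hk => by linarith [hxy k hk])
      (fun x' hx' => (hR x' y fun k hk => by linarith [hx' k hk]).1)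
    refine ⟨i, hi, j, hj, fun k hk => ?_⟩
    have h1 : ∀ k ∈ K, -(s k * (κ k + m k * y)) / -s k = κ k + m k * y := fun k hk => by
      rw [neg_div_neg_eq, mul_div_cancel_left₀ _ (hs k hk)]
    have := H k hk
    rw [h1 i hi, h1 j hj] at this
    linarith
  obtain ⟨i, hi, j, hj, hsi, hsj⟩ : ∃ i ∈ K, ∃ j ∈ K, 0 < s i ∧ s j < 0 := by
    by_contra! h
    rcases (em (∃ i ∈ K, 0 < s i)) with ⟨i, hi, hsi⟩ | h1
    · have h2 : ∀ k ∈ K, 0 < s k := fun k hk => lt_of_le_of_ne (h i hi k hk hsi) (hs k hk).symm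
      have h3 := (hR (min x₀ (-R - 1)) y₀ fun k hk => (h₀ k hk).trans_le
        (mul_le_mul_of_nonneg_left (by linarith [min_le_left x₀ (-R - 1)]) (h2 k hk).le)).1
      have := (abs_le.1 h3).1
      linarith [min_le_right x₀ (-R - 1)]
    · push Not at h1
      have h3 := (hR (max x₀ (R + 1)) y₀ fun k hk => (h₀ k hk).trans_le
        (mul_le_mul_of_nonpos_left (by linarith [le_max_left x₀ (R + 1)]) (h1 k hk))).1
      have := (abs_le.1 h3).2
      linarith [le_max_right x₀ (R + 1)]
  -- the elimination of `x`
  set L := (K ×ˢ K).filter fun c => s c.1 < 0 ∧ 0 < s c.2 with hL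
  have hfwd : ∀ x y, (∀ k ∈ K, 0 < s k * (κ k - (x - m k * y))) →
      ∀ c ∈ L, 0 < (κ c.2 - κ c.1) + (m c.2 - m c.1) * y := by
    intro x y h c hc
    simp only [hL, Finset.mem_filter, Finset.mem_product] at hc
    have h1 := neg_of_mul_pos_right (h _ hc.1.1) hc.2.1.le
    have h2 := pos_of_mul_pos_right (h _ hc.1.2) hc.2.2.le
    linarith
  have hback : ∀ y, (∀ c ∈ L, 0 < (κ c.2 - κ c.1) + (m c.2 - m c.1) * y) →
      ∃ x, ∀ k ∈ K, 0 < s k * (κ k - (x - m k * y)) := by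
    intro y h
    obtain ⟨a, ha, ha'⟩ := Finset.exists_max_image (K.filter fun k => s k < 0)
      (fun k => κ k + m k * y) ⟨j, by simp [hj, hsj]⟩
    obtain ⟨b, hb, hb'⟩ := Finset.exists_min_image (K.filter fun k => 0 < s k)
      (fun k => κ k + m k * y) ⟨i, by simp [hi, hsi]⟩
    rw [Finset.mem_filter] at ha hb
    have hab := h (a, b) (by simp [hL, ha, hb])
    refine ⟨((κ a + m a * y) + (κ b + m b * y)) / 2, fun k hk => ?_⟩
    simp only at hab
    rcases lt_or_gt_of_ne (hs k hk) with h1 | h1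
    · have := ha' k (by simp [hk, h1])
      exact mul_pos_of_neg_of_neg h1 (by linarith)
    · have := hb' k (by simp [hk, h1])
      exact mul_pos h1 (by linarith)
  obtain ⟨c, hc, c', hc', -, -, H⟩ := exists_midpoint L (fun c => κ c.2 - κ c.1)
    (fun c => m c.2 - m c.1) (x₀ := y₀) (R := R) (hfwd x₀ y₀ h₀) (fun y hy => by
      obtain ⟨x, hx⟩ := hback y hy
      exact (hR x y hx).2)
  obtain ⟨x, hxy⟩ := hback _ H
  obtain ⟨k₅, h₅, k₆, h₆, h⟩ := hx _ _ hxy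
  simp only [hL, Finset.mem_filter, Finset.mem_product] at hc hc'
  have e : ∀ c : ℕ × ℕ, -(κ c.2 - κ c.1) / (m c.2 - m c.1) = crossing m κ c.1 c.2 := fun c => by
    rw [crossing, ← neg_div_neg_eq, neg_neg, neg_sub]
  refine ⟨c.1, hc.1.1, c.2, hc.1.2, c'.1, hc'.1.1, c'.2, hc'.1.2, k₅, h₅, k₆, h₆,
    fun x y hy hx' => ?_⟩
  rw [e, e, ← hy] at h
  rw [hx']
  exact h

end

end PenroseTomography

/-! ### Matrices of zeros and ones with given row sums and column sums -/

namespace PenroseTomography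

noncomputable section

open Function

/-- The capacities of the vertices: the rows are `0, …, R - 1`, and the columns are
`R, …, R + C - 1`. The cell `e` lies in the row `e / C` and in the column `e % C`; it is an edge
between them that chooses the column if the entry is one, and the row if the entry is zero. Hence
the row sum `p v` leaves room for so many zeros in the row `v`. -/
def cellCap (R C : ℕ) (S : ℕ → Prop) (p q : ℕ → ℝ) (v : ℕ) : ℝ :=
  if v < R then (load (R * C) S (fun e => e / C) v : ℝ) - p v else q (v - R)

/-- The value of `h` at the final state of the algorithm for the allowed cells `S`, the row sums `p`
and the column sums `q`. -/
def fill (R C : ℕ) (S : ℕ → Prop) (p q : ℕ → ℝ) (h : (ℕ → ℕ) → ℝ) : ℝ :=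
  orient (R + C) (R * C) S (fun e => e / C) (fun e => R + e % C) (cellCap R C S p q) h

/-- There is a filling with entries one only at the cells of `S`, with row sums `p` and column
sums `q`, provided that both have the same total. -/
def Feasible (R C : ℕ) (S : ℕ → Prop) (p q : ℕ → ℝ) : Prop :=
  0 < fill R C S p q fun A => ind (ball (R + C) fun v =>
    (load (R * C) S (cur (R + C) (fun e => e / C) (fun e => R + e % C) A) v : ℝ) ≤
      cellCap R C S p q v)

/-- The entry of the filling at the cell `e` is one. -/
def Selected (R C : ℕ) (S : ℕ → Prop) (p q : ℕ → ℝ) (e : ℕ) : Prop :=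
  S e ∧ 0 < fill R C S p q fun A => ind (¬ rd A (R + C + e) = 0)

theorem ind_pos {p : Prop} : 0 < ind p ↔ p := by
  by_cases h : p <;> simp [ind_true, ind_false, h]

section

variable {γ : Type} [Ctx γ]

@[fun_prop] theorem Comp.load {M : γ → ℕ} {S : γ → ℕ → Prop} {x : γ → ℕ → ℕ} {v : γ → ℕ}
    (hM : Comp M) (hS : Comp (fun p : γ × ℕ => S p.1 p.2))
    (hx : Comp (fun p : γ × ℕ => x p.1 p.2)) (hv : Comp v) :
    Comp (fun g => PenroseTomography.load (M g) (S g) (x g) (v g)) := by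
  unfold PenroseTomography.load; fun_prop

@[fun_prop] theorem Comp.cellCap {R C : γ → ℕ} {S : γ → ℕ → Prop} {p q : γ → ℕ → ℝ} {v : γ → ℕ}
    (hR : Comp R) (hC : Comp C) (hS : Comp (fun p : γ × ℕ => S p.1 p.2))
    (hp : Comp (fun x : γ × ℕ => p x.1 x.2)) (hq : Comp (fun x : γ × ℕ => q x.1 x.2))
    (hv : Comp v) :
    Comp (fun g => PenroseTomography.cellCap (R g) (C g) (S g) (p g) (q g) (v g)) := by
  unfold PenroseTomography.cellCap
  refine Comp.ite (by fun_prop) (by fun_prop) ?_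
  exact Comp.comp (f := fun x : γ × ℕ => q x.1 x.2) (g := fun x => (x, v x - R x)) hq (by fun_prop)

@[fun_prop] theorem Comp.fill {R C : γ → ℕ} {S : γ → ℕ → Prop} {p q : γ → ℕ → ℝ}
    {h : γ → (ℕ → ℕ) → ℝ} (hR : Comp R) (hC : Comp C) (hS : Comp (fun p : γ × ℕ => S p.1 p.2))
    (hp : Comp (fun x : γ × ℕ => p x.1 x.2)) (hq : Comp (fun x : γ × ℕ => q x.1 x.2))
    (hh : Comp (fun x : γ × (ℕ → ℕ) => h x.1 x.2)) :
    Comp (fun g => PenroseTomography.fill (R g) (C g) (S g) (p g) (q g) (h g)) := by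
  unfold PenroseTomography.fill; fun_prop

@[fun_prop] theorem Comp.feasible {R C : γ → ℕ} {S : γ → ℕ → Prop} {p q : γ → ℕ → ℝ}
    (hR : Comp R) (hC : Comp C) (hS : Comp (fun p : γ × ℕ => S p.1 p.2))
    (hp : Comp (fun x : γ × ℕ => p x.1 x.2)) (hq : Comp (fun x : γ × ℕ => q x.1 x.2)) :
    Comp (fun g => Feasible (R g) (C g) (S g) (p g) (q g)) := by
  unfold Feasible cur; fun_prop

@[fun_prop] theorem Comp.selected {R C : γ → ℕ} {S : γ → ℕ → Prop} {p q : γ → ℕ → ℝ} {e : γ → ℕ}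
    (hR : Comp R) (hC : Comp C) (hS : Comp (fun p : γ × ℕ => S p.1 p.2))
    (hp : Comp (fun x : γ × ℕ => p x.1 x.2)) (hq : Comp (fun x : γ × ℕ => q x.1 x.2))
    (he : Comp e) :
    Comp (fun g => Selected (R g) (C g) (S g) (p g) (q g) (e g)) := by
  unfold Selected
  have h : Comp fun g => S g (e g) :=
    Comp.comp (f := fun x : γ × ℕ => S x.1 x.2) (g := fun x => (x, e x)) hS (by fun_prop)
  fun_prop

end

variable {R C : ℕ} {S : ℕ → Prop} {p q : ℕ → ℝ}

theorem row_lt {e : ℕ} (he : e < R * C) : e / C < R := Nat.div_lt_of_lt_mul (by rwa [mul_comm])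

theorem col_lt {e : ℕ} (he : e < R * C) : e % C < C :=
  Nat.mod_lt _ (Nat.pos_of_ne_zero (by rintro rfl; simp at he))

theorem feasible_iff : Feasible R C S p q ↔ ∀ v < R + C,
    (load (R * C) S (cur (R + C) (fun e => e / C) (fun e => R + e % C)
      (orientState (R + C) (R * C) S (fun e => e / C) (fun e => R + e % C) (cellCap R C S p q)))
      v : ℝ) ≤ cellCap R C S p q v := ind_pos

/-- The load of a row, if the column is chosen exactly for the cells in `Z`. -/
theorem load_row {x : ℕ → ℕ} (Z : Finset ℕ) (hZ : ∀ e ∈ Z, e < R * C ∧ S e)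
    (hx : ∀ e < R * C, S e → x e = if e ∈ Z then R + e % C else e / C) {v : ℕ} (hv : v < R) :
    load (R * C) S x v + (Z.filter fun e => e / C = v).card =
      load (R * C) S (fun e => e / C) v := by
  classical
  rw [load_eq_card, load_eq_card, ← Finset.card_union_of_disjoint]
  · congr 1
    ext e
    simp only [Finset.mem_union, Finset.mem_filter, Finset.mem_range]
    constructor
    · rintro (⟨⟨h1, h2⟩, h3⟩ | ⟨h1, h2⟩)
      · rw [hx e h1 h2] at h3
        split_ifs at h3 with h
        · omega
        · exact ⟨⟨h1, h2⟩, h3⟩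
      · exact ⟨hZ e h1, h2⟩
    · rintro ⟨⟨h1, h2⟩, h3⟩
      by_cases h : e ∈ Z
      · exact Or.inr ⟨h, h3⟩
      · exact Or.inl ⟨⟨h1, h2⟩, by rw [hx e h1 h2, if_neg h, h3]⟩
  · rw [Finset.disjoint_left]
    intro e he he'
    simp only [Finset.mem_filter, Finset.mem_range] at he he'
    rw [hx e he.1.1 he.1.2, if_pos he'.1] at he
    omega

theorem load_col {x : ℕ → ℕ} (Z : Finset ℕ) (hZ : ∀ e ∈ Z, e < R * C ∧ S e)
    (hx : ∀ e < R * C, S e → x e = if e ∈ Z then R + e % C else e / C) (j : ℕ) :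
    load (R * C) S x (R + j) = (Z.filter fun e => e % C = j).card := by
  classical
  rw [load_eq_card]
  congr 1
  ext e
  simp only [Finset.mem_filter, Finset.mem_range]
  constructor
  · rintro ⟨⟨h1, h2⟩, h3⟩
    rw [hx e h1 h2] at h3
    split_ifs at h3 with h
    · exact ⟨h, by omega⟩
    · have := row_lt h1; omega
  · rintro ⟨h1, h2⟩
    have := hZ e h1
    exact ⟨this, by rw [hx e this.1 this.2, if_pos h1, h2]⟩

theorem cellCap_row {v : ℕ} (hv : v < R) :
    cellCap R C S p q v = (load (R * C) S (fun e => e / C) v : ℝ) - p v := if_pos hv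

theorem cellCap_col (j : ℕ) : cellCap R C S p q (R + j) = q j := by
  rw [cellCap, if_neg (by omega), Nat.add_sub_cancel_left]

variable {p' q' : ℕ → ℕ}

/-- If a filling exists, then the orientation algorithm succeeds. -/
theorem feasible_of_filling (hp : ∀ i < R, p i = p' i) (hq : ∀ j < C, q j = q' j) (Z : Finset ℕ)
    (hZ : ∀ e ∈ Z, e < R * C ∧ S e) (hr : ∀ i < R, (Z.filter fun e => e / C = i).card = p' i)
    (hc : ∀ j < C, (Z.filter fun e => e % C = j).card = q' j) : Feasible R C S p q := by
  classical
  have hx : ∀ e < R * C, S e → (fun e => if e ∈ Z then R + e % C else e / C) e =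
    if e ∈ Z then R + e % C else e / C := fun _ _ _ => rfl
  rw [feasible_iff]
  intro v hv
  refine orientState_load_le (fun e he _ => (row_lt he).trans_le (Nat.le_add_right _ _))
    (fun e he _ => Nat.add_lt_add_left (col_lt he) R) (fun v hv => ?_)
    (fun e => if e ∈ Z then R + e % C else e / C) (fun e _ _ => ?_) (fun v hv => ?_) hv
  · rcases lt_or_ge v R with h | h
    · exact ⟨load (R * C) S (fun e => e / C) v - p' v, by rw [cellCap_row h, hp v h]; simp⟩
    · obtain ⟨j, rfl⟩ := Nat.exists_eq_add_of_le h
      exact ⟨q' j, by rw [cellCap_col, hq j (by omega)]; simp⟩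
  · by_cases h : e ∈ Z <;> simp [h]
  · rcases lt_or_ge v R with h | h
    · rw [cellCap_row h, hp v h, ← hr v h, ← load_row Z hZ hx h]
      simp
    · obtain ⟨j, rfl⟩ := Nat.exists_eq_add_of_le h
      rw [cellCap_col, load_col Z hZ hx, hq j (by omega), hc j (by omega)]

/-- If the algorithm succeeds, then the row sums are at least `p'` and the column sums at most `q'`,
so that both are attained, as the totals are equal. -/
theorem filling_of_feasible (hp : ∀ i < R, p i = p' i) (hq : ∀ j < C, q j = q' j)
    (h : Feasible R C S p q)
    (hpq : ∑ i ∈ Finset.range R, p' i = ∑ j ∈ Finset.range C, q' j) (Z : Finset ℕ)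
    (hZ : ∀ e, e ∈ Z ↔ e < R * C ∧ Selected R C S p q e) :
    (∀ i < R, (Z.filter fun e => e / C = i).card = p' i) ∧
      ∀ j < C, (Z.filter fun e => e % C = j).card = q' j := by
  classical
  rw [feasible_iff] at h
  have hZ' : ∀ e ∈ Z, e < R * C ∧ S e := fun e he => ⟨((hZ e).1 he).1, ((hZ e).1 he).2.1⟩
  have hx : ∀ e < R * C, S e → cur (R + C) (fun e => e / C) (fun e => R + e % C)
      (orientState (R + C) (R * C) S (fun e => e / C) (fun e => R + e % C) (cellCap R C S p q)) e =
        if e ∈ Z then R + e % C else e / C := fun e he hS => by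
    have : e ∈ Z ↔ rd (orientState (R + C) (R * C) S (fun e => e / C) (fun e => R + e % C)
        (cellCap R C S p q)) (R + C + e) ≠ 0 := by
      rw [hZ, Selected,
        show (0 < fill R C S p q fun A => ind (¬ rd A (R + C + e) = 0)) ↔ _ from ind_pos]
      exact ⟨fun H => H.2.2, fun H => ⟨he, hS, H⟩⟩
    unfold cur
    split_ifs with h1 h2 h2
    · exact absurd h1 (this.1 h2)
    · rfl
    · rfl
    · exact absurd (this.2 h1) h2
  have h1 : ∀ i ∈ Finset.range R, p' i ≤ (Z.filter fun e => e / C = i).card := fun i hi => by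
    have hi := Finset.mem_range.1 hi
    have := h i (by omega)
    rw [cellCap_row hi, hp i hi, ← load_row Z hZ' hx hi, Nat.cast_add] at this
    exact_mod_cast (by linarith : (p' i : ℝ) ≤ ((Z.filter fun e => e / C = i).card : ℝ))
  have h2 : ∀ j ∈ Finset.range C, (Z.filter fun e => e % C = j).card ≤ q' j := fun j hj => by
    have hj := Finset.mem_range.1 hj
    have := h (R + j) (by omega)
    rw [cellCap_col, hq j hj, load_col Z hZ' hx] at this
    exact_mod_cast this
  have e1 : ∑ i ∈ Finset.range R, (Z.filter fun e => e / C = i).card = Z.card :=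
    (Finset.card_eq_sum_card_fiberwise fun e he =>
      Finset.mem_coe.2 (Finset.mem_range.2 (row_lt (hZ' e he).1))).symm
  have e2 : ∑ j ∈ Finset.range C, (Z.filter fun e => e % C = j).card = Z.card :=
    (Finset.card_eq_sum_card_fiberwise fun e he =>
      Finset.mem_coe.2 (Finset.mem_range.2 (col_lt (hZ' e he).1))).symm
  have h3 := Finset.sum_le_sum h1
  have h4 := Finset.sum_le_sum h2
  exact ⟨fun i hi => ((Finset.sum_eq_sum_iff_of_le h1).1 (by omega) i (Finset.mem_range.2 hi)).symm,
    fun j hj => (Finset.sum_eq_sum_iff_of_le h2).1 (by omega) j (Finset.mem_range.2 hj)⟩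

end

end PenroseTomography

/-! ### X-rays of subsets of a grid -/

namespace PenroseTomography

noncomputable section

open Function

theorem mem_line_self (u z : ℂ) : z ∈ line u z := ⟨0, by simp⟩

theorem line_eq_of_mem {u z w : ℂ} (h : w ∈ line u z) : line u z = line u w := by
  obtain ⟨s, rfl⟩ := h
  ext v
  constructor
  · rintro ⟨r, rfl⟩; exact ⟨r - s, by push_cast; ring⟩
  · rintro ⟨r, rfl⟩; exact ⟨r + s, by push_cast; ring⟩

theorem cycloLine_eq_of_mem {u w : ℂ} {a b : Coords} (ha : w ∈ line u (point a))
    (hb : w ∈ line u (point b)) : cycloLine u a = cycloLine u b :=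
  Subtype.ext ((line_eq_of_mem ha).trans (line_eq_of_mem hb).symm)

theorem mem_line_of_eq {u w : ℂ} {a b : Coords} (h : cycloLine u a = cycloLine u b)
    (ha : w ∈ line u (point a)) : w ∈ line u (point b) := by
  have := congrArg Subtype.val h
  simp only [cycloLine] at this
  rwa [← this]

/-- The function `p` on the lines in direction `u` is described by `R` lines with values, of which
only the active ones count: the active lines are distinct and contain the support of `p`. -/
structure LineData (u : ℂ) (R : ℕ) (act : ℕ → Prop) (a : ℕ → Coords) (P : ℕ → ℕ)
    (p : Lines u → ℕ) : Prop where
  inj : ∀ i < R, ∀ i' < R, act i → act i' → cycloLine u (a i) = cycloLine u (a i') → i = i'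
  val : ∀ i < R, act i → p (cycloLine u (a i)) = P i
  zero : ∀ i < R, ¬ act i → P i = 0
  cover : ∀ ℓ, p ℓ ≠ 0 → ∃ i < R, act i ∧ ℓ = cycloLine u (a i)

variable {u : ℂ} {R : ℕ} {act : ℕ → Prop} {a : ℕ → Coords} {P : ℕ → ℕ} {p : Lines u → ℕ}

theorem xray_apply (u : ℂ) (F : Finset ℂ) (ℓ : Lines u) [DecidablePred (· ∈ ℓ.1)] :
    xray u F ℓ = (F.filter (· ∈ ℓ.1)).card := by
  rw [xray, ← Set.ncard_coe_finset, Finset.coe_filter]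
  congr 1

/-- The points `g e` have the X-ray `p` if and only if the number of cells in each row is right; this
covers the inactive rows, which have the value zero. -/
theorem xray_image_eq_iff (hL : LineData u R act a P p) (Z : Finset ℕ) {g : ℕ → ℂ} {row : ℕ → ℕ}
    (hrow : ∀ e ∈ Z, row e < R ∧ act (row e) ∧ g e ∈ line u (point (a (row e))))
    (hinj : Set.InjOn g Z) :
    xray u (Z.image g) = p ↔ ∀ i < R, (Z.filter fun e => row e = i).card = P i := by
  classical
  have hcount : ∀ i < R, act i →
      xray u (Z.image g) (cycloLine u (a i)) = (Z.filter fun e => row e = i).card := by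
    intro i hi hact
    rw [xray_apply, Finset.filter_image, Finset.card_image_of_injOn]
    · congr 1
      ext e
      simp only [Finset.mem_filter, and_congr_right_iff]
      intro he
      obtain ⟨h1, h2, h3⟩ := hrow e he
      constructor
      · intro h
        exact hL.inj _ h1 _ hi h2 hact (cycloLine_eq_of_mem h3 h)
      · rintro rfl
        exact h3
    · exact hinj.mono fun e he => (Finset.mem_filter.1 (Finset.mem_coe.1 he)).1
  constructor
  · rintro rfl i hi
    by_cases hact : act i
    · rw [← hcount i hi hact, hL.val i hi hact]
    · rw [hL.zero i hi hact, Finset.card_eq_zero, Finset.filter_eq_empty_iff]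
      rintro e he rfl
      exact hact (hrow e he).2.1
  · intro h
    funext ℓ
    by_cases hℓ : ∃ i < R, act i ∧ ℓ = cycloLine u (a i)
    · obtain ⟨i, hi, hact, rfl⟩ := hℓ
      rw [hcount i hi hact, h i hi, hL.val i hi hact]
    · have h0 : p ℓ = 0 := by
        by_contra h0
        exact hℓ (hL.cover ℓ h0)
      rw [h0, xray_apply, Finset.card_eq_zero, Finset.filter_eq_empty_iff]
      intro w hw hwℓ
      obtain ⟨e, he, rfl⟩ := Finset.mem_image.1 hw
      obtain ⟨h1, h2, h3⟩ := hrow e he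
      refine hℓ ⟨_, h1, h2, ?_⟩
      obtain ⟨ℓ, z, rfl⟩ := ℓ
      exact Subtype.ext ((line_eq_of_mem hwℓ).trans (line_eq_of_mem h3).symm)

theorem exists_mem_of_xray {F : Finset ℂ} (hL : LineData u R act a P p) (hF : xray u F = p)
    {f : ℂ} (hf : f ∈ F) : ∃ i < R, act i ∧ f ∈ line u (point (a i)) := by
  classical
  obtain ⟨i, hi, hact, h⟩ := hL.cover ⟨line u f, f, rfl⟩ (by
    rw [← hF, xray_apply]
    exact (Finset.card_pos.2 ⟨f, Finset.mem_filter.2 ⟨hf, mem_line_self u f⟩⟩).ne')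
  refine ⟨i, hi, hact, ?_⟩
  have := congrArg Subtype.val h
  simp only [cycloLine] at this
  exact this ▸ mem_line_self u f

/-- The data of a grid: for each cell `e` of the matrix, the line of the row `e / C` and the line
of the column `e % C` meet at the point `g e`. -/
structure Grid (u₁ u₂ : ℂ) (C : ℕ) (a b : ℕ → Coords) (D : ℕ) (g : ℕ → ℂ) (X : ℕ → Coords) :
    Prop where
  row_mem : ∀ e, g e ∈ line u₁ (point (a (e / C)))
  col_mem : ∀ e, g e ∈ line u₂ (point (b (e % C)))
  denom : 0 < D
  coords : ∀ e, D * g e = point (X e)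
  unique : ∀ e z, z ∈ line u₁ (point (a (e / C))) → z ∈ line u₂ (point (b (e % C))) → z = g e

/-- The cell `e` belongs to an active row and to an active column. -/
def ActiveCell (R C : ℕ) (act₁ act₂ : ℕ → Prop) (e : ℕ) : Prop :=
  e < R * C ∧ act₁ (e / C) ∧ act₂ (e % C)

variable {u₁ u₂ : ℂ} {C : ℕ} {act₁ act₂ : ℕ → Prop} {b : ℕ → Coords} {D : ℕ} {g : ℕ → ℂ}
  {X : ℕ → Coords} {P Q : ℕ → ℕ} {p₁ : Lines u₁ → ℕ} {p₂ : Lines u₂ → ℕ}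

theorem Grid.injOn (hG : Grid u₁ u₂ C a b D g X) (h₁ : LineData u₁ R act₁ a P p₁)
    (h₂ : LineData u₂ C act₂ b Q p₂) : Set.InjOn g {e | ActiveCell R C act₁ act₂ e} := by
  rintro e ⟨he, h3, h4⟩ e' ⟨he', h3', h4'⟩ h
  have h5 := h₁.inj _ (row_lt he) _ (row_lt he') h3 h3'
    (cycloLine_eq_of_mem (hG.row_mem e) (h ▸ hG.row_mem e'))
  have h6 := h₂.inj _ (col_lt he) _ (col_lt he') h4 h4'
    (cycloLine_eq_of_mem (hG.col_mem e) (h ▸ hG.col_mem e'))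
  rw [← Nat.div_add_mod e C, h5, h6, Nat.div_add_mod]

theorem Grid.xray_iff (hG : Grid u₁ u₂ C a b D g X) (h₁ : LineData u₁ R act₁ a P p₁)
    (h₂ : LineData u₂ C act₂ b Q p₂) (Z : Finset ℕ) (hZ : ∀ e ∈ Z, ActiveCell R C act₁ act₂ e) :
    xray u₁ (Z.image g) = p₁ ∧ xray u₂ (Z.image g) = p₂ ↔
      (∀ i < R, (Z.filter fun e => e / C = i).card = P i) ∧
        ∀ j < C, (Z.filter fun e => e % C = j).card = Q j := by
  have hinj : Set.InjOn g Z := (hG.injOn h₁ h₂).mono hZ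
  rw [xray_image_eq_iff h₁ Z (fun e he => ⟨row_lt (hZ e he).1, (hZ e he).2.1, hG.row_mem e⟩) hinj,
    xray_image_eq_iff h₂ Z (fun e he => ⟨col_lt (hZ e he).1, (hZ e he).2.2, hG.col_mem e⟩) hinj]

/-- A finite set with the given X-rays consists of points of the grid. -/
theorem Grid.exists_cells (hG : Grid u₁ u₂ C a b D g X) (h₁ : LineData u₁ R act₁ a P p₁)
    (h₂ : LineData u₂ C act₂ b Q p₂) {F : Finset ℂ} (hF₁ : xray u₁ F = p₁)
    (hF₂ : xray u₂ F = p₂) :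
    ∃ Z : Finset ℕ, (∀ e ∈ Z, ActiveCell R C act₁ act₂ e) ∧ F = Z.image g := by
  classical
  refine ⟨(Finset.range (R * C)).filter fun e => ActiveCell R C act₁ act₂ e ∧ g e ∈ F,
    fun e he => (Finset.mem_filter.1 he).2.1, ?_⟩
  ext f
  simp only [Finset.mem_image, Finset.mem_filter, Finset.mem_range]
  constructor
  · intro hf
    obtain ⟨i, hi, hi', hif⟩ := exists_mem_of_xray h₁ hF₁ hf
    obtain ⟨j, hj, hj', hjf⟩ := exists_mem_of_xray h₂ hF₂ hf
    have e1 : (j + C * i) / C = i := by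
      rw [Nat.add_mul_div_left _ _ (by omega), Nat.div_eq_of_lt hj, zero_add]
    have e2 : (j + C * i) % C = j := by rw [Nat.add_mul_mod_self_left, Nat.mod_eq_of_lt hj]
    have hlt : j + C * i < R * C := by
      calc j + C * i < C + C * i := by omega
        _ = C * (i + 1) := by ring
        _ ≤ C * R := Nat.mul_le_mul_left _ hi
        _ = R * C := mul_comm _ _
    have hfe : f = g (j + C * i) := hG.unique _ _ (by rwa [e1]) (by rwa [e2])
    exact ⟨_, ⟨hlt, ⟨hlt, by rwa [e1], by rwa [e2]⟩, hfe ▸ hf⟩, hfe.symm⟩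
  · rintro ⟨e, ⟨-, -, h⟩, rfl⟩
    exact h

/-- The total of the row sums of a finite set equals the total of the column sums. -/
theorem sum_filter_card_eq {Z : Finset ℕ} (hZ : ∀ e ∈ Z, e < R * C)
    (hP : ∀ i < R, (Z.filter fun e => e / C = i).card = P i)
    (hQ : ∀ j < C, (Z.filter fun e => e % C = j).card = Q j) :
    ∑ i ∈ Finset.range R, P i = ∑ j ∈ Finset.range C, Q j := by
  have e1 : ∑ i ∈ Finset.range R, (Z.filter fun e => e / C = i).card = Z.card :=
    (Finset.card_eq_sum_card_fiberwise fun e he =>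
      Finset.mem_coe.2 (Finset.mem_range.2 (row_lt (hZ e he)))).symm
  have e2 : ∑ j ∈ Finset.range C, (Z.filter fun e => e % C = j).card = Z.card :=
    (Finset.card_eq_sum_card_fiberwise fun e he =>
      Finset.mem_coe.2 (Finset.mem_range.2 (col_lt (hZ e he)))).symm
  rw [← Finset.sum_congr rfl fun i hi => hP i (Finset.mem_range.1 hi),
    ← Finset.sum_congr rfl fun j hj => hQ j (Finset.mem_range.1 hj), e1, e2]

end

end PenroseTomography

/-! ### Remainders, and membership in the window -/

namespace PenroseTomography

noncomputable section

open Function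

instance (n : ℤ) : AlgConst (n : ℝ) := ⟨isAlgebraic_intCast n⟩

/-- The remainder of `x` modulo `D`, for an integer `x` of absolute value at most `D * 2 ^ T`. As
the machine cannot round, it subtracts the numbers `D * 2 ^ T, …, D * 2, D` where this is
possible. -/
def rmod (T D : ℕ) (x : ℝ) : ℝ := by
  classical exact rrec (T + 1) (x + D * 2 ^ T) fun i y =>
    if (D : ℝ) * 2 ^ (T - i) ≤ y then y - D * 2 ^ (T - i) else y

theorem rmod_intCast {T D : ℕ} {n : ℤ} (h : |n| < D * 2 ^ T) :
    rmod T D n = ((n % D : ℤ) : ℝ) := by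
  classical
  have key : ∀ i, i ≤ T + 1 → ∃ m : ℤ, 0 ≤ m ∧ m * 2 ^ i < D * 2 ^ (T + 1) ∧ m % D = n % D ∧
      rrec i ((n : ℝ) + D * 2 ^ T) (fun i y =>
        if (D : ℝ) * 2 ^ (T - i) ≤ y then y - D * 2 ^ (T - i) else y) = m := by
    intro i
    induction i with
    | zero =>
      intro _
      refine ⟨n + D * 2 ^ T, ?_, ?_, ?_, ?_⟩
      · linarith [(abs_lt.1 h).1]
      · rw [pow_succ]; linarith [(abs_lt.1 h).2]
      · simp
      · rw [rrec_zero]; push_cast; ring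
    | succ i ih =>
      intro hi
      obtain ⟨m, h0, h1, h2, h3⟩ := ih (by omega)
      have e : (2 : ℤ) ^ (T - i) * 2 ^ i = 2 ^ T := by rw [← pow_add]; congr 1; omega
      have hpos : (0 : ℤ) < 2 ^ i := by positivity
      rw [rrec_succ, h3]
      by_cases hm : (D : ℤ) * 2 ^ (T - i) ≤ m
      · refine ⟨m - D * 2 ^ (T - i), by linarith, ?_, ?_, ?_⟩
        · rw [pow_succ] at h1
          rw [pow_succ, pow_succ]
          have : (m - (D : ℤ) * 2 ^ (T - i)) * (2 ^ i * 2) =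
            2 * (m * 2 ^ i) - 2 * D * (2 ^ (T - i) * 2 ^ i) := by ring
          rw [this, e]; linarith
        · rw [Int.sub_mul_emod_self_left, h2]
        · rw [if_pos (by exact_mod_cast hm)]; push_cast; ring
      · refine ⟨m, h0, ?_, h2, by rw [if_neg (by exact_mod_cast hm)]⟩
        have := mul_lt_mul_of_pos_right (not_le.1 hm) hpos
        rw [mul_assoc, e] at this
        rw [pow_succ, pow_succ]; linarith
  obtain ⟨m, h0, h1, h2, h3⟩ := key (T + 1) le_rfl
  have h4 : m < D := lt_of_mul_lt_mul_right h1 (by positivity)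
  rw [← h2, Int.emod_eq_of_lt h0 h4, ← h3]
  rfl

/-- The real part of `ζ₅ʲ`, for `j < 5`. -/
def cosT (j : ℕ) : ℝ := table 5 (fun j => (zeta ^ j).re) j

/-- The imaginary part of `ζ₅ʲ`, for `j < 5`. -/
def sinT (j : ℕ) : ℝ := table 5 (fun j => (zeta ^ j).im) j

/-- The real part of `σ₂` of the element with coordinates `z`. -/
def starRe (z : Fin 4 → ℝ) : ℝ := ∑ k, z k * (zeta ^ (2 * (k : ℕ))).re

/-- The imaginary part of `σ₂` of the element with coordinates `z`. -/
def starIm (z : Fin 4 → ℝ) : ℝ := ∑ k, z k * (zeta ^ (2 * (k : ℕ))).im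

/-- The residue class of the element with coordinates `z`, shifted by `r`. -/
def resT (T r : ℕ) (z : Fin 4 → ℝ) : ℝ := rmod T 5 (∑ k, z k + r)

/-- The factor of the pentagon over this residue class. -/
def facT (π : Equiv.Perm (Fin 4)) (T r : ℕ) (z : Fin 4 → ℝ) : ℝ :=
  table 5 (winFactor π) (natOf 5 (resT T r z))

/-- The element with coordinates `z` lies in the interior of the window, with the centre `x + iy`
and with residue classes shifted by `r`. -/
def Inside (π : Equiv.Perm (Fin 4)) (T r : ℕ) (z : Fin 4 → ℝ) (x y : ℝ) : Prop :=
  0 < resT T r z ∧ ball 5 fun j =>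
    cosTwo < ((starRe z - x) * cosT j - (starIm z - y) * sinT j) / facT π T r z

theorem zeta_pow_isAlgebraic (j : ℕ) : IsAlgebraic ℚ (zeta ^ j) := zeta_isAlgebraic.pow j

instance (j : ℕ) : AlgConst (zeta ^ j).re := ⟨(isAlgebraic_re_im (zeta_pow_isAlgebraic j)).1⟩

instance (j : ℕ) : AlgConst (zeta ^ j).im := ⟨(isAlgebraic_re_im (zeta_pow_isAlgebraic j)).2⟩

instance : AlgConst cosTwo := ⟨(isAlgebraic_re_im (zeta_pow_isAlgebraic 2)).1⟩

instance : AlgSeq (fun j => (zeta ^ j).re) :=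
  ⟨fun j => (isAlgebraic_re_im (zeta_pow_isAlgebraic j)).1⟩

instance : AlgSeq (fun j => (zeta ^ j).im) :=
  ⟨fun j => (isAlgebraic_re_im (zeta_pow_isAlgebraic j)).2⟩

theorem goldenRatio_isAlgebraic : IsAlgebraic ℚ Real.goldenRatio := by
  refine IsIntegral.isAlgebraic ⟨Polynomial.X ^ 2 - Polynomial.X - 1, ?_, ?_⟩
  · monicity!
  · simp [Real.goldenRatio_sq]

instance (π : Equiv.Perm (Fin 4)) : AlgSeq (winFactor π) := ⟨fun k => by
  have h := goldenRatio_isAlgebraic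
  unfold winFactor
  split_ifs with hk
  · generalize π ⟨k - 1, _⟩ = i
    fin_cases i <;> simp [factor, isAlgebraic_one, h, h.neg, isAlgebraic_one.neg]
  · exact isAlgebraic_zero⟩

section

variable {γ : Type} [Ctx γ]

@[fun_prop] theorem Comp.rmod {T : γ → ℕ} (D : ℕ) {x : γ → ℝ} (hT : Comp T) (hx : Comp x) :
    Comp (fun g => PenroseTomography.rmod (T g) D (x g)) := by
  unfold PenroseTomography.rmod; fun_prop

@[fun_prop] theorem Comp.cosT {j : γ → ℕ} (hj : Comp j) :
    Comp (fun g => PenroseTomography.cosT (j g)) := by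
  unfold PenroseTomography.cosT; fun_prop

@[fun_prop] theorem Comp.sinT {j : γ → ℕ} (hj : Comp j) :
    Comp (fun g => PenroseTomography.sinT (j g)) := by
  unfold PenroseTomography.sinT; fun_prop

@[fun_prop] theorem Comp.starRe {z : γ → Fin 4 → ℝ} (hz : ∀ k, Comp (fun g => z g k)) :
    Comp (fun g => PenroseTomography.starRe (z g)) := by
  unfold PenroseTomography.starRe; fun_prop

@[fun_prop] theorem Comp.starIm {z : γ → Fin 4 → ℝ} (hz : ∀ k, Comp (fun g => z g k)) :
    Comp (fun g => PenroseTomography.starIm (z g)) := by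
  unfold PenroseTomography.starIm; fun_prop

@[fun_prop] theorem Comp.resT {T r : γ → ℕ} {z : γ → Fin 4 → ℝ} (hT : Comp T) (hr : Comp r)
    (hz : ∀ k, Comp (fun g => z g k)) :
    Comp (fun g => PenroseTomography.resT (T g) (r g) (z g)) := by
  unfold PenroseTomography.resT; fun_prop

@[fun_prop] theorem Comp.facT (π : Equiv.Perm (Fin 4)) {T r : γ → ℕ} {z : γ → Fin 4 → ℝ}
    (hT : Comp T) (hr : Comp r) (hz : ∀ k, Comp (fun g => z g k)) :
    Comp (fun g => PenroseTomography.facT π (T g) (r g) (z g)) := by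
  unfold PenroseTomography.facT; fun_prop

@[fun_prop] theorem Comp.inside (π : Equiv.Perm (Fin 4)) {T r : γ → ℕ} {z : γ → Fin 4 → ℝ}
    {x y : γ → ℝ} (hT : Comp T) (hr : Comp r) (hz : ∀ k, Comp (fun g => z g k)) (hx : Comp x)
    (hy : Comp y) : Comp (fun g => Inside π (T g) (r g) (z g) (x g) (y g)) := by
  unfold Inside; fun_prop

end

theorem cosT_eq {j : ℕ} (hj : j < 5) : cosT j = (zeta ^ j).re := if_pos hj

theorem sinT_eq {j : ℕ} (hj : j < 5) : sinT j = (zeta ^ j).im := if_pos hj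

theorem cosT_ne_zero {j : ℕ} (hj : j < 5) : cosT j ≠ 0 := by
  rw [cosT_eq hj]; exact zeta_pow_re_ne_zero j

theorem starRe_eq (a : Coords) : starRe (fun k => a k) = (conj2 a).re := by
  simp only [starRe, conj2, Complex.re_sum]
  refine Finset.sum_congr rfl fun k _ => ?_
  rw [← Complex.ofReal_intCast, Complex.re_ofReal_mul]

theorem starIm_eq (a : Coords) : starIm (fun k => a k) = (conj2 a).im := by
  simp only [starIm, conj2, Complex.im_sum]
  refine Finset.sum_congr rfl fun k _ => ?_
  rw [← Complex.ofReal_intCast, Complex.im_ofReal_mul]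

theorem resT_eq {T r : ℕ} {a : Coords} (h : |∑ k, a k + r| < 5 * 2 ^ T) :
    resT T r (fun k => a k) = (residue a + r : ZMod 5).val := by
  have e : (∑ k, ((a k : ℤ) : ℝ) + (r : ℝ)) = ((∑ k, a k + r : ℤ) : ℝ) := by push_cast; rfl
  have e' : residue a + r = ((∑ k, a k + r : ℤ) : ZMod 5) := by simp [residue]
  rw [resT, e, rmod_intCast (by exact_mod_cast h), e', ← Int.cast_natCast (ZMod.val _),
    ZMod.val_intCast]

theorem facT_eq {π : Equiv.Perm (Fin 4)} {T r : ℕ} {a : Coords}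
    (h : |∑ k, a k + r| < 5 * 2 ^ T) :
    facT π T r (fun k => a k) = winFactor π (residue a + r : ZMod 5).val := by
  have hlt := ZMod.val_lt (residue a + r : ZMod 5)
  rw [facT, resT_eq h, natOf_natCast hlt.le, table, if_pos hlt]

/-- For integer coordinates, the machine decides membership in the interior of the window. -/
theorem inside_iff {π : Equiv.Perm (Fin 4)} {T r : ℕ} {a : Coords}
    (h : |∑ k, a k + r| < 5 * 2 ^ T) (x y : ℝ) :
    Inside π T r (fun k => a k) x y ↔
      conj2 a - ⟨x, y⟩ ∈ interior (window π (residue a + r)) := by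
  rw [Inside, starRe_eq, starIm_eq, facT_eq h, resT_eq h]
  have hw := mem_interior_window (π := π) (ZMod.val_lt (residue a + r : ZMod 5))
    (w := conj2 a - ⟨x, y⟩)
  rw [ZMod.natCast_zmod_val] at hw
  rw [hw, Nat.cast_pos, Nat.pos_iff_ne_zero]
  refine and_congr_right fun _ => forall₂_congr fun j hj => ?_
  beta_reduce
  rw [cosT_eq hj, sinT_eq hj, Complex.mul_re]
  rfl

end

end PenroseTomography

/-! ### Candidates for the position of the window -/

namespace PenroseTomography

noncomputable section

open Function

/-- The digit number `k` of `c` to the base `Q`. -/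
def digit (Q : ℕ) : ℕ → ℕ → ℕ
  | 0, c => c % Q
  | k + 1, c => digit Q k (c / Q)

theorem exists_digits {Q : ℕ} (n : ℕ) (d : ℕ → ℕ) (hd : ∀ k, d k < Q) :
    ∃ c < Q ^ n, ∀ k < n, digit Q k c = d k := by
  induction n generalizing d with
  | zero => exact ⟨0, by simp, by simp⟩
  | succ n ih =>
    obtain ⟨c, hc, h⟩ := ih (fun k => d (k + 1)) fun k => hd _
    have hQ : 0 < Q := (Nat.zero_le _).trans_lt (hd 0)
    refine ⟨d 0 + Q * c, ?_, fun k hk => ?_⟩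
    · calc d 0 + Q * c < Q + Q * c := Nat.add_lt_add_right (hd 0) _
        _ = Q * (c + 1) := by ring
        _ ≤ Q * Q ^ n := Nat.mul_le_mul_left _ hc
        _ = Q ^ (n + 1) := by ring
    · cases k with
      | zero => rw [digit, Nat.add_mul_mod_self_left, Nat.mod_eq_of_lt (hd 0)]
      | succ k =>
        rw [digit, Nat.add_mul_div_left _ _ hQ, Nat.div_eq_of_lt (hd 0), zero_add,
          h k (by omega)]

/-- The difference of the cells `e` and `e₀`, in coordinates. -/
def quot (D : ℕ) (X : ℕ → Fin 4 → ℝ) (e₀ e : ℕ) (k : Fin 4) : ℝ := (X e k - X e₀ k) / D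

/-- The slope of the boundary line `k` of the admissible positions of the centre; this is the line
for the cell `k / 5` and for the edge `k % 5` of the pentagon. -/
def slope (k : ℕ) : ℝ := sinT (k % 5) / cosT (k % 5)

/-- The intercept of the boundary line `k`. -/
def intercept (π : Equiv.Perm (Fin 4)) (T r : ℕ) (z : ℕ → Fin 4 → ℝ) (k : ℕ) : ℝ :=
  starRe (z (k / 5)) - slope k * starIm (z (k / 5)) -
    cosTwo * facT π T r (z (k / 5)) / cosT (k % 5)

/-- The imaginary part of the centre for the candidate `c`. -/
def centreIm (m κ : ℕ → ℝ) (Q c : ℕ) : ℝ :=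
  (crossing m κ (digit Q 2 c) (digit Q 3 c) + crossing m κ (digit Q 4 c) (digit Q 5 c)) / 2

/-- The real part of the centre for the candidate `c`. -/
def centreRe (m κ : ℕ → ℝ) (Q c : ℕ) : ℝ :=
  ((κ (digit Q 6 c) + m (digit Q 6 c) * centreIm m κ Q c) +
    (κ (digit Q 7 c) + m (digit Q 7 c) * centreIm m κ Q c)) / 2

/-- The base for the digits of the candidates, for `M` cells. -/
def base (M : ℕ) : ℕ := 5 * M + 5

/-- The number of candidates. -/
def candidates (M : ℕ) : ℕ :=
  base M * base M * (base M * base M) * (base M * base M * (base M * base M))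

theorem candidates_eq (M : ℕ) : candidates M = base M ^ 8 := by rw [candidates]; ring

/-- The cell `e` is allowed for the candidate `c`. The digits of `c` are a reference cell, the
residue class of this cell, and the six boundary lines that determine the centre of the window. -/
def Allowed (π : Equiv.Perm (Fin 4)) (D T M : ℕ) (X : ℕ → Fin 4 → ℝ) (ok : ℕ → Prop)
    (c e : ℕ) : Prop :=
  ok e ∧ digit (base M) 0 c < M ∧ digit (base M) 1 c < 5 ∧
    ∑ k, rmod T D (X e k - X (digit (base M) 0 c) k) = 0 ∧
    Inside π T (digit (base M) 1 c) (quot D X (digit (base M) 0 c) e)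
      (centreRe slope (intercept π T (digit (base M) 1 c) (quot D X (digit (base M) 0 c)))
        (base M) c)
      (centreIm slope (intercept π T (digit (base M) 1 c) (quot D X (digit (base M) 0 c)))
        (base M) c)

section

variable {γ : Type} [Ctx γ]

@[fun_prop] theorem Comp.digit (k : ℕ) {Q c : γ → ℕ} (hQ : Comp Q) (hc : Comp c) :
    Comp (fun g => PenroseTomography.digit (Q g) k (c g)) := by
  induction k generalizing c with
  | zero => simp only [PenroseTomography.digit]; fun_prop
  | succ k ih => exact ih (c := fun g => c g / Q g) (by fun_prop)

@[fun_prop] theorem Comp.quot (D : ℕ) {X : γ → ℕ → Fin 4 → ℝ} {e₀ e : γ → ℕ}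
    (hX : ∀ k, Comp (fun p : γ × ℕ => X p.1 p.2 k)) (he₀ : Comp e₀) (he : Comp e) (k : Fin 4) :
    Comp (fun g => PenroseTomography.quot D (X g) (e₀ g) (e g) k) := by
  unfold PenroseTomography.quot
  have h1 : Comp (fun g => X g (e g) k) :=
    Comp.comp (f := fun p : γ × ℕ => X p.1 p.2 k) (g := fun x => (x, e x)) (hX k) (by fun_prop)
  have h2 : Comp (fun g => X g (e₀ g) k) :=
    Comp.comp (f := fun p : γ × ℕ => X p.1 p.2 k) (g := fun x => (x, e₀ x)) (hX k) (by fun_prop)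
  fun_prop

@[fun_prop] theorem Comp.slope {k : γ → ℕ} (hk : Comp k) :
    Comp (fun g => PenroseTomography.slope (k g)) := by
  unfold PenroseTomography.slope; fun_prop

@[fun_prop] theorem Comp.intercept (π : Equiv.Perm (Fin 4)) {T r k : γ → ℕ}
    {z : γ → ℕ → Fin 4 → ℝ} (hT : Comp T) (hr : Comp r)
    (hz : ∀ k, Comp (fun p : γ × ℕ => z p.1 p.2 k)) (hk : Comp k) :
    Comp (fun g => PenroseTomography.intercept π (T g) (r g) (z g) (k g)) := by
  unfold PenroseTomography.intercept
  have h1 : ∀ l, Comp (fun g => z g (k g / 5) l) := fun l =>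
    Comp.comp (f := fun p : γ × ℕ => z p.1 p.2 l) (g := fun x => (x, k x / 5)) (hz l) (by fun_prop)
  fun_prop

@[fun_prop] theorem Comp.crossing {m κ : γ → ℕ → ℝ} {k l : γ → ℕ}
    (hm : Comp (fun p : γ × ℕ => m p.1 p.2)) (hκ : Comp (fun p : γ × ℕ => κ p.1 p.2))
    (hk : Comp k) (hl : Comp l) :
    Comp (fun g => PenroseTomography.crossing (m g) (κ g) (k g) (l g)) := by
  unfold PenroseTomography.crossing
  have h1 : ∀ {i : γ → ℕ}, Comp i → Comp (fun g => m g (i g)) := fun {i} hi =>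
    Comp.comp (f := fun p : γ × ℕ => m p.1 p.2) (g := fun x => (x, i x)) hm (by fun_prop)
  have h2 : ∀ {i : γ → ℕ}, Comp i → Comp (fun g => κ g (i g)) := fun {i} hi =>
    Comp.comp (f := fun p : γ × ℕ => κ p.1 p.2) (g := fun x => (x, i x)) hκ (by fun_prop)
  exact ((h2 hl).sub (h2 hk)).div ((h1 hk).sub (h1 hl))

@[fun_prop] theorem Comp.centreIm {m κ : γ → ℕ → ℝ} {Q c : γ → ℕ}
    (hm : Comp (fun p : γ × ℕ => m p.1 p.2)) (hκ : Comp (fun p : γ × ℕ => κ p.1 p.2))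
    (hQ : Comp Q) (hc : Comp c) :
    Comp (fun g => PenroseTomography.centreIm (m g) (κ g) (Q g) (c g)) := by
  unfold PenroseTomography.centreIm; fun_prop

@[fun_prop] theorem Comp.centreRe {m κ : γ → ℕ → ℝ} {Q c : γ → ℕ}
    (hm : Comp (fun p : γ × ℕ => m p.1 p.2)) (hκ : Comp (fun p : γ × ℕ => κ p.1 p.2))
    (hQ : Comp Q) (hc : Comp c) :
    Comp (fun g => PenroseTomography.centreRe (m g) (κ g) (Q g) (c g)) := by
  unfold PenroseTomography.centreRe
  have h1 : ∀ {i : γ → ℕ}, Comp i → Comp (fun g => m g (i g)) := fun {i} hi =>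
    Comp.comp (f := fun p : γ × ℕ => m p.1 p.2) (g := fun x => (x, i x)) hm (by fun_prop)
  have h2 : ∀ {i : γ → ℕ}, Comp i → Comp (fun g => κ g (i g)) := fun {i} hi =>
    Comp.comp (f := fun p : γ × ℕ => κ p.1 p.2) (g := fun x => (x, i x)) hκ (by fun_prop)
  have h3 := h1 (i := fun g => PenroseTomography.digit (Q g) 6 (c g)) (by fun_prop)
  have h4 := h1 (i := fun g => PenroseTomography.digit (Q g) 7 (c g)) (by fun_prop)
  have h5 := h2 (i := fun g => PenroseTomography.digit (Q g) 6 (c g)) (by fun_prop)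
  have h6 := h2 (i := fun g => PenroseTomography.digit (Q g) 7 (c g)) (by fun_prop)
  fun_prop

@[fun_prop] theorem Comp.base {M : γ → ℕ} (hM : Comp M) :
    Comp (fun g => PenroseTomography.base (M g)) := by
  unfold PenroseTomography.base; fun_prop

@[fun_prop] theorem Comp.candidates {M : γ → ℕ} (hM : Comp M) :
    Comp (fun g => PenroseTomography.candidates (M g)) := by
  unfold PenroseTomography.candidates; fun_prop

@[fun_prop] theorem Comp.allowed (π : Equiv.Perm (Fin 4)) (D : ℕ) {T M c e : γ → ℕ}
    {X : γ → ℕ → Fin 4 → ℝ} {ok : γ → ℕ → Prop} (hT : Comp T) (hM : Comp M)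
    (hX : ∀ k, Comp (fun p : γ × ℕ => X p.1 p.2 k)) (hok : Comp (fun p : γ × ℕ => ok p.1 p.2))
    (hc : Comp c) (he : Comp e) :
    Comp (fun g => Allowed π D (T g) (M g) (X g) (ok g) (c g) (e g)) := by
  unfold Allowed
  have h1 : ∀ {i : γ → ℕ}, Comp i → ∀ k, Comp (fun g => X g (i g) k) := fun {i} hi k =>
    Comp.comp (f := fun p : γ × ℕ => X p.1 p.2 k) (g := fun x => (x, i x)) (hX k) (by fun_prop)
  have h2 := h1 he
  have h3 := h1 (i := fun g => PenroseTomography.digit (PenroseTomography.base (M g)) 0 (c g))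
    (by fun_prop)
  have h4 : Comp fun g => ok g (e g) :=
    Comp.comp (f := fun p : γ × ℕ => ok p.1 p.2) (g := fun x => (x, e x)) hok (by fun_prop)
  fun_prop

end

variable {π : Equiv.Perm (Fin 4)} {D T M : ℕ} {X : ℕ → Fin 4 → ℝ} {X' : ℕ → Coords}
  {ok : ℕ → Prop} {g : ℕ → ℂ}

/-- Divisibility by `D` is tested with remainders. -/
theorem sum_rmod_eq_zero_iff (hD : 0 < D) {x : Coords} (hx : ∀ k, |x k| < D * 2 ^ T) :
    ∑ k, rmod T D (x k) = 0 ↔ ∃ z : Coords, x = (D : ℤ) • z := by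
  have hD' : (D : ℤ) ≠ 0 := by exact_mod_cast hD.ne'
  simp only [rmod_intCast (hx _)]
  rw [Finset.sum_eq_zero_iff_of_nonneg fun k _ => by exact_mod_cast Int.emod_nonneg _ hD']
  constructor
  · intro h
    refine ⟨fun k => x k / D, funext fun k => ?_⟩
    have := h k (Finset.mem_univ k)
    norm_cast at this
    exact (Int.mul_ediv_cancel' (Int.dvd_of_emod_eq_zero this)).symm
  · rintro ⟨z, rfl⟩ k -
    simp

theorem coords_diff (hX : ∀ e < M, ∀ k, X e k = X' e k)
    (hT : ∀ e < M, ∀ k, 8 * |X' e k| + 5 ≤ 2 ^ T) {e e₀ : ℕ} (he : e < M) (he₀ : e₀ < M)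
    (k : Fin 4) : X e k - X e₀ k = ((X' e - X' e₀) k : ℤ) ∧
      4 * |(X' e - X' e₀) k| + 5 ≤ 2 ^ T := by
  constructor
  · rw [hX e he, hX e₀ he₀, Pi.sub_apply]; push_cast; rfl
  · have h3 := hT e he k
    have h4 := hT e₀ he₀ k
    have := abs_sub (X' e k) (X' e₀ k)
    rw [Pi.sub_apply]; linarith

theorem quot_eq (hD : 0 < D) (hX : ∀ e < M, ∀ k, X e k = X' e k)
    (hT : ∀ e < M, ∀ k, 8 * |X' e k| + 5 ≤ 2 ^ T) {e e₀ r : ℕ} (he : e < M) (he₀ : e₀ < M)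
    (hr : r < 5) {z : Coords} (hz : X' e - X' e₀ = (D : ℤ) • z) :
    (quot D X e₀ e = fun k => (z k : ℝ)) ∧ |∑ k, z k + r| < 5 * 2 ^ T := by
  have hD' : (1 : ℤ) ≤ D := by exact_mod_cast hD
  have hp : (0 : ℤ) < 2 ^ T := by positivity
  have hzk : ∀ k, (X' e - X' e₀) k = D * z k := fun k => by rw [hz]; rfl
  constructor
  · funext k
    rw [quot, (coords_diff hX hT he he₀ k).1, hzk]
    push_cast
    exact mul_div_cancel_left₀ _ (by exact_mod_cast hD.ne')
  · have h3 : ∀ k, 4 * |z k| + 5 ≤ 2 ^ T := fun k => by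
      have := (coords_diff hX hT he he₀ k).2
      rw [hzk, abs_mul, Nat.abs_cast] at this
      nlinarith [abs_nonneg (z k)]
    have h4 := Finset.abs_sum_le_sum_abs z Finset.univ
    rw [Fin.sum_univ_four (fun k => |z k|)] at h4
    have h5 := abs_add_le (∑ k, z k) r
    rw [Nat.abs_cast] at h5
    have h6 : (r : ℤ) < 5 := by exact_mod_cast hr
    linarith [h3 0, h3 1, h3 2, h3 3]

/-- The allowed cells belong to the class of the reference cell modulo `ℤ[ζ₅]` and to the window. -/
theorem allowed_iff (hD : 0 < D) (hX : ∀ e < M, ∀ k, X e k = X' e k)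
    (hT : ∀ e < M, ∀ k, 8 * |X' e k| + 5 ≤ 2 ^ T) {c e e₀ r : ℕ} {x y : ℝ} (he : e < M)
    (h₀ : digit (base M) 0 c = e₀) (hr : digit (base M) 1 c = r)
    (hx : x = centreRe slope (intercept π T r (quot D X e₀)) (base M) c)
    (hy : y = centreIm slope (intercept π T r (quot D X e₀)) (base M) c) :
    Allowed π D T M X ok c e ↔ ok e ∧ e₀ < M ∧ r < 5 ∧ ∃ z : Coords,
      X' e - X' e₀ = (D : ℤ) • z ∧
        conj2 z - ⟨x, y⟩ ∈ interior (window π (residue z + r)) := by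
  rw [Allowed, h₀, hr, ← hx, ← hy]
  refine and_congr_right fun _ => and_congr_right fun h1 => and_congr_right fun h2 => ?_
  have hD' : (1 : ℤ) ≤ D := by exact_mod_cast hD
  have hp : (0 : ℤ) < 2 ^ T := by positivity
  simp only [(coords_diff hX hT he h1 _).1]
  rw [sum_rmod_eq_zero_iff hD fun k => by
    nlinarith [(coords_diff hX hT he h1 k).2, abs_nonneg ((X' e - X' e₀) k)]]
  constructor
  · rintro ⟨⟨z, hz⟩, h3⟩
    obtain ⟨h4, h5⟩ := quot_eq hD hX hT he h1 h2 hz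
    rw [h4, inside_iff h5] at h3
    exact ⟨z, hz, h3⟩
  · rintro ⟨z, hz, h3⟩
    obtain ⟨h4, h5⟩ := quot_eq hD hX hT he h1 h2 hz
    rw [h4, inside_iff h5]
    exact ⟨⟨z, hz⟩, h3⟩

theorem inPenrose_of_allowed (hD : 0 < D) (hX : ∀ e < M, ∀ k, X e k = X' e k)
    (hT : ∀ e < M, ∀ k, 8 * |X' e k| + 5 ≤ 2 ^ T) (hg : ∀ e, D * g e = point (X' e)) {c : ℕ}
    {Z : Finset ℕ} (hZ : ∀ e ∈ Z, e < M ∧ Allowed π D T M X ok c e) :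
    InPenrose π (Z.image g) := by
  have h : ∀ e ∈ Z, _ := fun e he =>
    (allowed_iff hD hX hT (hZ e he).1 rfl rfl rfl rfl).1 (hZ e he).2
  choose! z hz using fun e he => (h e he).2.2.2
  exact inPenrose_of_window hD (fun e _ => hg e) _ (fun e he => (hz e he).1) _ _
    fun e he => (hz e he).2

/-- An inequality for the pentagon, solved for the real part `x` of the centre: this is possible as
the factor `p` of `x`, the real part of a fifth root of unity, does not vanish. -/
theorem cut_iff {p q f zx zy x y c : ℝ} (hp : p ≠ 0) (hf : f ≠ 0) :
    0 < p / f * ((zx - q / p * zy - c * f / p) - (x - q / p * y)) ↔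
      c < ((zx - x) * p - (zy - y) * q) / f := by
  have : p / f * ((zx - q / p * zy - c * f / p) - (x - q / p * y)) =
      ((zx - x) * p - (zy - y) * q) / f - c := by
    field_simp; ring
  rw [this, sub_pos]

/-- Every subset of the grid that is contained in a Penrose model set is allowed for one of the
candidates: the admissible centres form a nonempty, open and bounded polygon, which contains a point
that is determined by six of the boundary lines. -/
theorem exists_allowed (hD : 0 < D) (hX : ∀ e < M, ∀ k, X e k = X' e k)
    (hT : ∀ e < M, ∀ k, 8 * |X' e k| + 5 ≤ 2 ^ T) (hg : ∀ e, D * g e = point (X' e))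
    {Z : Finset ℕ} (hZ : ∀ e ∈ Z, e < M ∧ ok e) (h : InPenrose π (Z.image g)) :
    ∃ c < candidates M, ∀ e ∈ Z, Allowed π D T M X ok c e := by
  classical
  rcases Z.eq_empty_or_nonempty with rfl | ⟨e₀, he₀⟩
  · exact ⟨0, by simp [candidates, base], by simp⟩
  have hM : 0 < M := by have := (hZ e₀ he₀).1; omega
  obtain ⟨z, r, u, hr, hz, hu⟩ := exists_window (fun e _ => hg e) h he₀
  have he₀M := (hZ e₀ he₀).1
  have hq : ∀ e ∈ Z, _ := fun e he => quot_eq hD hX hT (hZ e he).1 he₀M hr (hz e he)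
  set q := quot D X e₀
  have hin : ∀ e ∈ Z, ∀ x y, Inside π T r (q e) x y ↔
      conj2 (z e) - ⟨x, y⟩ ∈ interior (window π (residue (z e) + r)) := fun e he x y => by
    rw [(hq e he).1, inside_iff (hq e he).2]
  have hres : ∀ e ∈ Z, 0 < resT T r (q e) := fun e he => ((hin e he u.re u.im).2 (hu e he)).1
  have hf : ∀ e ∈ Z, facT π T r (q e) ≠ 0 := fun e he => by
    have h1 := hres e he
    rw [(hq e he).1, resT_eq (hq e he).2, Nat.cast_pos] at h1
    rw [(hq e he).1, facT_eq (hq e he).2]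
    exact winFactor_ne_zero h1.ne' (ZMod.val_lt _)
  -- the centre is admissible if it solves five inequalities for each cell of `Z`
  set κ := intercept π T r q
  set K := (Finset.range (5 * M)).filter fun k => k / 5 ∈ Z with hK
  set s : ℕ → ℝ := fun k => cosT (k % 5) / facT π T r (q (k / 5))
  have h5 : ∀ k, k % 5 < 5 := fun k => Nat.mod_lt _ (by norm_num)
  have hKZ : ∀ k ∈ K, k / 5 ∈ Z := fun k hk => (Finset.mem_filter.1 hk).2
  have hsys : ∀ x y, (∀ e ∈ Z, Inside π T r (q e) x y) ↔
      ∀ k ∈ K, 0 < s k * (κ k - (x - slope k * y)) := by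
    intro x y
    constructor
    · intro H k hk
      exact (cut_iff (cosT_ne_zero (h5 k)) (hf _ (hKZ k hk))).2
        ((H _ (hKZ k hk)).2 _ (h5 k))
    · intro H e he
      refine ⟨hres e he, fun j hj => ?_⟩
      have e1 : (5 * e + j) / 5 = e := by omega
      have e2 : (5 * e + j) % 5 = j := by omega
      have heM := (hZ e he).1
      have h1 := H (5 * e + j) (by
        rw [hK, Finset.mem_filter, Finset.mem_range, e1]
        exact ⟨by omega, he⟩)
      have h2 := (cut_iff (cosT_ne_zero (h5 _)) (by rw [e1]; exact hf _ he)).1 h1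
      rwa [e1, e2] at h2
  obtain ⟨k₁, h₁, k₂, h₂, k₃, h₃, k₄, h₄, k₅, h₅, k₆, h₆, H⟩ := exists_six K slope κ s
    (fun k hk => div_ne_zero (cosT_ne_zero (h5 k)) (hf _ (hKZ k hk)))
    (x₀ := u.re) (y₀ := u.im) (R := ‖conj2 (z e₀)‖ + 2)
    ((hsys _ _).1 fun e he => (hin e he _ _).2 (hu e he)) fun x y hxy => by
      have h1 := norm_le_of_mem_window (interior_subset
        ((hin e₀ he₀ x y).1 ((hsys x y).2 hxy e₀ he₀)))
      have h2 : ‖(⟨x, y⟩ : ℂ)‖ ≤ ‖conj2 (z e₀)‖ + 2 := by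
        rw [← norm_neg] at h1
        have := norm_add_le (conj2 (z e₀)) (-(conj2 (z e₀) - ⟨x, y⟩))
        rw [neg_sub, add_sub_cancel] at this
        rw [neg_sub] at h1
        linarith
      exact ⟨(Complex.abs_re_le_norm ⟨x, y⟩).trans h2, (Complex.abs_im_le_norm ⟨x, y⟩).trans h2⟩
  have hKlt : ∀ k ∈ K, k < base M := fun k hk => by
    have := Finset.mem_range.1 (Finset.mem_filter.1 hk).1
    unfold base; omega
  obtain ⟨c, hc, hdig⟩ := exists_digits (Q := base M) 8
    (fun k => [e₀, r, k₁, k₂, k₃, k₄, k₅, k₆].getD k 0) (fun k => by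
      have hb : 5 ≤ base M ∧ M ≤ base M := by unfold base; omega
      rcases Nat.lt_or_ge k 8 with h | h
      · interval_cases k
        exacts [he₀M.trans_le hb.2, hr.trans_le hb.1, hKlt _ h₁, hKlt _ h₂, hKlt _ h₃, hKlt _ h₄,
          hKlt _ h₅, hKlt _ h₆]
      · rw [List.getD_eq_default _ _ (by simpa using h)]
        omega)
  have d0 := hdig 0 (by norm_num)
  have d1 := hdig 1 (by norm_num)
  have d2 := hdig 2 (by norm_num)
  have d3 := hdig 3 (by norm_num)
  have d4 := hdig 4 (by norm_num)
  have d5 := hdig 5 (by norm_num)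
  have d6 := hdig 6 (by norm_num)
  have d7 := hdig 7 (by norm_num)
  refine ⟨c, by rwa [candidates_eq], fun e he => ?_⟩
  refine (allowed_iff hD hX hT (hZ e he).1 d0 d1 rfl rfl).2
    ⟨(hZ e he).2, he₀M, hr, z e, hz e he, (hin e he _ _).1 ?_⟩
  refine (hsys _ _).2 (H _ _ ?_ ?_) e he
  · unfold centreIm; rw [d2, d3, d4, d5]; rfl
  · unfold centreRe; rw [d6, d7]; rfl

end

end PenroseTomography

/-! ### The combinatorial algorithm -/

namespace PenroseTomography

noncomputable section

open Function ComplexConjugate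

/-- The numerators of the coordinates of the grid point in the cell `e`, where `a` and `b` are the
coordinates of points on the lines of the rows and columns. -/
def gridCoord (A B : Fin 4 → Fin 4 → ℤ) (C : ℕ) (a b : ℕ → Fin 4 → ℝ) (e : ℕ) (k : Fin 4) : ℝ :=
  ∑ l, A l k * a (e / C) l + ∑ l, B l k * b (e % C) l

/-- The filling for the candidate `c` is a solution. -/
def Possible (π : Equiv.Perm (Fin 4)) (D T R C : ℕ) (X : ℕ → Fin 4 → ℝ) (ok : ℕ → Prop)
    (p q : ℕ → ℝ) (c : ℕ) : Prop :=
  Feasible R C (Allowed π D T (R * C) X ok c) p q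

/-- The cell `e` belongs to the solution for the candidate `c`. -/
def InSolution (π : Equiv.Perm (Fin 4)) (D T R C : ℕ) (X : ℕ → Fin 4 → ℝ) (ok : ℕ → Prop)
    (p q : ℕ → ℝ) (c e : ℕ) : Prop :=
  Selected R C (Allowed π D T (R * C) X ok c) p q e

/-- The problem with `R` rows, `C` columns, grid points `X`, admissible cells `ok`, row sums `p` and
column sums `q` has a solution. -/
def Solvable (π : Equiv.Perm (Fin 4)) (D T R C : ℕ) (X : ℕ → Fin 4 → ℝ) (ok : ℕ → Prop)
    (p q : ℕ → ℝ) : Prop :=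
  rsum R p = rsum C q ∧ bex (candidates (R * C)) fun c => Possible π D T R C X ok p q c

section

variable {γ : Type} [Ctx γ]

@[fun_prop] theorem Comp.gridCoord (A B : Fin 4 → Fin 4 → ℤ) {C e : γ → ℕ}
    {a b : γ → ℕ → Fin 4 → ℝ} (hC : Comp C) (ha : ∀ k, Comp (fun p : γ × ℕ => a p.1 p.2 k))
    (hb : ∀ k, Comp (fun p : γ × ℕ => b p.1 p.2 k)) (he : Comp e) (k : Fin 4) :
    Comp (fun g => PenroseTomography.gridCoord A B (C g) (a g) (b g) (e g) k) := by
  unfold PenroseTomography.gridCoord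
  have h1 : ∀ l, Comp (fun g => a g (e g / C g) l) := fun l =>
    Comp.comp (f := fun p : γ × ℕ => a p.1 p.2 l) (g := fun x => (x, e x / C x)) (ha l)
      (by fun_prop)
  have h2 : ∀ l, Comp (fun g => b g (e g % C g) l) := fun l =>
    Comp.comp (f := fun p : γ × ℕ => b p.1 p.2 l) (g := fun x => (x, e x % C x)) (hb l)
      (by fun_prop)
  fun_prop

variable (π : Equiv.Perm (Fin 4)) (D : ℕ) {T R C c e : γ → ℕ} {X : γ → ℕ → Fin 4 → ℝ}
  {ok : γ → ℕ → Prop} {p q : γ → ℕ → ℝ}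

@[fun_prop] theorem Comp.possible (hT : Comp T) (hR : Comp R) (hC : Comp C)
    (hX : ∀ k, Comp (fun p : γ × ℕ => X p.1 p.2 k)) (hok : Comp (fun p : γ × ℕ => ok p.1 p.2))
    (hp : Comp (fun x : γ × ℕ => p x.1 x.2)) (hq : Comp (fun x : γ × ℕ => q x.1 x.2))
    (hc : Comp c) :
    Comp (fun g => Possible π D (T g) (R g) (C g) (X g) (ok g) (p g) (q g) (c g)) := by
  unfold Possible; fun_prop

@[fun_prop] theorem Comp.inSolution (hT : Comp T) (hR : Comp R) (hC : Comp C)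
    (hX : ∀ k, Comp (fun p : γ × ℕ => X p.1 p.2 k)) (hok : Comp (fun p : γ × ℕ => ok p.1 p.2))
    (hp : Comp (fun x : γ × ℕ => p x.1 x.2)) (hq : Comp (fun x : γ × ℕ => q x.1 x.2))
    (hc : Comp c) (he : Comp e) :
    Comp (fun g => InSolution π D (T g) (R g) (C g) (X g) (ok g) (p g) (q g) (c g) (e g)) := by
  unfold InSolution; fun_prop

@[fun_prop] theorem Comp.solvable (hT : Comp T) (hR : Comp R) (hC : Comp C)
    (hX : ∀ k, Comp (fun p : γ × ℕ => X p.1 p.2 k)) (hok : Comp (fun p : γ × ℕ => ok p.1 p.2))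
    (hp : Comp (fun x : γ × ℕ => p x.1 x.2)) (hq : Comp (fun x : γ × ℕ => q x.1 x.2)) :
    Comp (fun g => Solvable π D (T g) (R g) (C g) (X g) (ok g) (p g) (q g)) := by
  unfold Solvable; fun_prop

end

/-- For all integer data `a`, `b` for the rows and columns, the points of the grid have coordinates
`gridCoord A B C a b e k / D`, with numerators that have at most `κ` digits more than the data. -/
def GridFormula (u₁ u₂ : ℂ) (D κ : ℕ) (A B : Fin 4 → Fin 4 → ℤ) : Prop :=
  ∀ (C : ℕ) (a b : ℕ → Coords), ∃ (g : ℕ → ℂ) (X : ℕ → Coords), Grid u₁ u₂ C a b D g X ∧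
    (∀ a' b' : ℕ → Fin 4 → ℝ, ∀ e, (∀ l, a' (e / C) l = a (e / C) l) →
      (∀ l, b' (e % C) l = b (e % C) l) → ∀ k, gridCoord A B C a' b' e k = X e k) ∧
    ∀ N e, (∀ l, |a (e / C) l| ≤ 2 ^ N) → (∀ l, |b (e % C) l| ≤ 2 ^ N) →
      ∀ k, 8 * |X e k| + 5 ≤ 2 ^ (N + κ)

theorem exists_gridFormula {u₁ u₂ : ℂ} (h₁ : IsCycloDirection u₁) (h₂ : IsCycloDirection u₂)
    (hne : LinearIndependent ℝ ![u₁, u₂]) :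
    ∃ (D κ : ℕ) (A B : Fin 4 → Fin 4 → ℤ), GridFormula u₁ u₂ D κ A B := by
  obtain ⟨D, hD, A, B, H⟩ := exists_grid h₁ h₂ hne
  set K := ∑ k, ∑ l, ((A l k).natAbs + (B l k).natAbs) with hK
  refine ⟨D, 8 * K + 5, A, B, fun C a b => ?_⟩
  choose g hg₁ hg₂ using fun e =>
    exists_mem_lines h₂.1 hne (point (a (e / C))) (point (b (e % C)))
  refine ⟨g, fun e j => ∑ k, A k j * a (e / C) k + ∑ k, B k j * b (e % C) k,
    ⟨hg₁, hg₂, hD, fun e => H _ _ _ (hg₁ e) (hg₂ e), fun e z hz₁ hz₂ => ?_⟩, ?_, ?_⟩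
  · have hD' : (D : ℂ) ≠ 0 := by exact_mod_cast hD.ne'
    exact mul_left_cancel₀ hD' ((H _ _ _ hz₁ hz₂).trans (H _ _ _ (hg₁ e) (hg₂ e)).symm)
  · intro a' b' e ha hb k
    simp only [gridCoord, ha, hb]
    push_cast; rfl
  · intro N e ha hb k
    have h3 : |∑ l, A l k * a (e / C) l + ∑ l, B l k * b (e % C) l| ≤ K * 2 ^ N := by
      calc _ ≤ ∑ l, |A l k * a (e / C) l| + ∑ l, |B l k * b (e % C) l| :=
            (abs_add_le _ _).trans (add_le_add (Finset.abs_sum_le_sum_abs _ _)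
              (Finset.abs_sum_le_sum_abs _ _))
        _ ≤ ∑ l, ((A l k).natAbs : ℤ) * 2 ^ N + ∑ l, ((B l k).natAbs : ℤ) * 2 ^ N := by
            refine add_le_add (Finset.sum_le_sum fun l _ => ?_) (Finset.sum_le_sum fun l _ => ?_)
            · rw [abs_mul, Int.natCast_natAbs]
              exact mul_le_mul_of_nonneg_left (ha l) (abs_nonneg _)
            · rw [abs_mul, Int.natCast_natAbs]
              exact mul_le_mul_of_nonneg_left (hb l) (abs_nonneg _)
        _ = ((∑ l, ((A l k).natAbs + (B l k).natAbs) : ℕ) : ℤ) * 2 ^ N := by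
            push_cast; rw [← Finset.sum_mul, ← Finset.sum_mul, ← add_mul, Finset.sum_add_distrib]
        _ ≤ K * 2 ^ N := by
            refine mul_le_mul_of_nonneg_right ?_ (by positivity)
            exact_mod_cast Finset.single_le_sum
              (f := fun k => ∑ l, ((A l k).natAbs + (B l k).natAbs)) (fun _ _ => Nat.zero_le _)
              (Finset.mem_univ k)
    have h4 : ((8 * K + 5 : ℕ) : ℤ) ≤ 2 ^ (8 * K + 5) := by exact_mod_cast Nat.lt_two_pow_self.le
    have h5 : (1 : ℤ) ≤ 2 ^ N := one_le_pow₀ (by norm_num)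
    calc _ ≤ 8 * (K * 2 ^ N) + 5 * (2 : ℤ) ^ N := by linarith
      _ = ((8 * K + 5 : ℕ) : ℤ) * 2 ^ N := by push_cast; ring
      _ ≤ 2 ^ (8 * K + 5) * 2 ^ N := mul_le_mul_of_nonneg_right h4 (by positivity)
      _ = _ := by rw [← pow_add, add_comm]

/-- The real data describe the problem to find a finite subset of a Penrose model set that has the
X-rays `p₁` and `p₂`, and that contains no point of `E`. -/
structure Describes (u₁ u₂ : ℂ) (p₁ : Lines u₁ → ℕ) (p₂ : Lines u₂ → ℕ) (E : Set ℂ)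
    (D T R C : ℕ) (X : ℕ → Fin 4 → ℝ) (ok : ℕ → Prop) (p q : ℕ → ℝ) (g : ℕ → ℂ)
    (X' : ℕ → Coords) : Prop where
  exists_data : ∃ act₁ act₂ a b P Q, LineData u₁ R act₁ a P p₁ ∧ LineData u₂ C act₂ b Q p₂ ∧
    Grid u₁ u₂ C a b D g X' ∧ (∀ i < R, p i = P i) ∧ (∀ j < C, q j = Q j) ∧
    ∀ e < R * C, ok e ↔ ActiveCell R C act₁ act₂ e ∧ g e ∉ E
  coords : ∀ e < R * C, ∀ k, X e k = X' e k
  bound : ∀ e < R * C, ∀ k, 8 * |X' e k| + 5 ≤ 2 ^ T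

variable {π : Equiv.Perm (Fin 4)} {u₁ u₂ : ℂ} {p₁ : Lines u₁ → ℕ} {p₂ : Lines u₂ → ℕ} {E : Set ℂ}
  {D T R C : ℕ} {X : ℕ → Fin 4 → ℝ} {ok : ℕ → Prop} {p q : ℕ → ℝ} {g : ℕ → ℂ} {X' : ℕ → Coords}

theorem Describes.isSolution (h : Describes u₁ u₂ p₁ p₂ E D T R C X ok p q g X')
    (hpq : rsum R p = rsum C q) {c : ℕ} (hc : Possible π D T R C X ok p q c) {Z : Finset ℕ}
    (hZ : ∀ e, e ∈ Z ↔ e < R * C ∧ InSolution π D T R C X ok p q c e) :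
    IsSolution π u₁ u₂ p₁ p₂ (Z.image g) ∧ (∀ f ∈ Z.image g, f ∉ E) ∧ Set.InjOn g Z := by
  obtain ⟨act₁, act₂, a, b, P, Q, h₁, h₂, hG, hp, hq, hok⟩ := h.exists_data
  have hS : ∀ e ∈ Z, e < R * C ∧ Allowed π D T (R * C) X ok c e := fun e he =>
    ⟨((hZ e).1 he).1, ((hZ e).1 he).2.1⟩
  have hact : ∀ e ∈ Z, ActiveCell R C act₁ act₂ e ∧ g e ∉ E := fun e he =>
    (hok e (hS e he).1).1 (hS e he).2.1
  have hsum : ∑ i ∈ Finset.range R, P i = ∑ j ∈ Finset.range C, Q j := by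
    rw [rsum, rsum, Finset.sum_congr rfl fun i hi => hp i (Finset.mem_range.1 hi),
      Finset.sum_congr rfl fun j hj => hq j (Finset.mem_range.1 hj)] at hpq
    exact_mod_cast hpq
  refine ⟨⟨inPenrose_of_allowed hG.denom h.coords h.bound hG.coords hS,
    (hG.xray_iff h₁ h₂ Z fun e he => (hact e he).1).2 (filling_of_feasible hp hq hc hsum Z hZ)⟩,
    fun f hf => ?_, (hG.injOn h₁ h₂).mono fun e he => (hact e he).1⟩
  obtain ⟨e, he, rfl⟩ := Finset.mem_image.1 hf
  exact (hact e he).2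

/-- The algorithm finds a solution if there is any, as one of the candidates for the window fits. -/
theorem Describes.solvable (h : Describes u₁ u₂ p₁ p₂ E D T R C X ok p q g X') {F : Finset ℂ}
    (hF : IsSolution π u₁ u₂ p₁ p₂ F) (hE : ∀ f ∈ F, f ∉ E) : Solvable π D T R C X ok p q := by
  obtain ⟨act₁, act₂, a, b, P, Q, h₁, h₂, hG, hp, hq, hok⟩ := h.exists_data
  obtain ⟨Z, hZ, rfl⟩ := hG.exists_cells h₁ h₂ hF.2.1 hF.2.2
  obtain ⟨hP, hQ⟩ := (hG.xray_iff h₁ h₂ Z hZ).1 hF.2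
  have hZ' : ∀ e ∈ Z, e < R * C ∧ ok e := fun e he =>
    ⟨(hZ e he).1, (hok e (hZ e he).1).2 ⟨hZ e he, hE _ (Finset.mem_image_of_mem g he)⟩⟩
  constructor
  · rw [rsum, rsum, Finset.sum_congr rfl fun i hi => hp i (Finset.mem_range.1 hi),
      Finset.sum_congr rfl fun j hj => hq j (Finset.mem_range.1 hj)]
    exact_mod_cast sum_filter_card_eq (fun e he => (hZ e he).1) hP hQ
  · obtain ⟨c, hc, hall⟩ := exists_allowed hG.denom h.coords h.bound hG.coords hZ' hF.1
    exact ⟨c, hc, feasible_of_filling hp hq Z (fun e he => ⟨(hZ' e he).1, hall e he⟩) hP hQ⟩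

theorem Describes.solvable_iff (h : Describes u₁ u₂ p₁ p₂ E D T R C X ok p q g X') :
    Solvable π D T R C X ok p q ↔ ∃ F, IsSolution π u₁ u₂ p₁ p₂ F ∧ ∀ f ∈ F, f ∉ E := by
  classical
  constructor
  · rintro ⟨hpq, c, -, hc⟩
    have := h.isSolution hpq hc (Z := (Finset.range (R * C)).filter fun e =>
      InSolution π D T R C X ok p q c e) (by simp)
    exact ⟨_, this.1, this.2.1⟩
  · rintro ⟨F, hF, hE⟩
    exact h.solvable hF hE

end

end PenroseTomography

/-! ### Reading the data of Consistency and Reconstruction -/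

namespace PenroseTomography

noncomputable section

open Function

theorem length_flatMap_of_length {α : Type} (f : α → List ℝ) (m : ℕ) (hf : ∀ x, (f x).length = m)
    (l : List α) : (l.flatMap f).length = m * l.length := by
  induction l with
  | nil => simp
  | cons x l ih => rw [List.flatMap_cons, List.length_append, ih, hf, List.length_cons]; ring

theorem getD_flatMap {α : Type} (f : α → List ℝ) (m : ℕ) (hf : ∀ x, (f x).length = m) (x₀ : α)
    (l : List α) {i k : ℕ} (hi : i < l.length) (hk : k < m) :
    (l.flatMap f).getD (m * i + k) 0 = (f (l.getD i x₀)).getD k 0 := by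
  induction l generalizing i with
  | nil => simp at hi
  | cons x l ih =>
    rw [List.flatMap_cons]
    cases i with
    | zero =>
      rw [List.getD_append _ _ _ _ (by rw [hf]; simpa using hk)]
      simp
    | succ i =>
      rw [List.getD_append_right _ _ _ _ (by rw [hf]; nlinarith), hf,
        show m * (i + 1) + k - m = m * i + k by rw [mul_add, mul_one]; omega,
        ih (by simpa using hi)]
      simp

theorem length_coordsWord (a : Coords) : (coordsWord a).length = 4 := by simp [coordsWord]

theorem getD_coordsWord (a : Coords) (k : Fin 4) : (coordsWord a).getD k 0 = a k := by
  fin_cases k <;> simp [coordsWord]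

theorem length_dataWord (l : List (Coords × ℕ)) : (dataWord l).length = 5 * l.length + 1 := by
  rw [dataWord, List.length_cons, length_flatMap_of_length _ 5 (by simp [length_coordsWord])]

theorem dataWord_zero (l : List (Coords × ℕ)) : (dataWord l).getD 0 0 = l.length := rfl

theorem dataWord_coords (l : List (Coords × ℕ)) {i : ℕ} (hi : i < l.length) (k : Fin 4) :
    (dataWord l).getD (5 * i + k + 1) 0 = (l.getD i 0).1 k := by
  rw [dataWord, List.getD_cons_succ, getD_flatMap _ 5 (by simp [length_coordsWord]) 0 l hi
    (by omega), List.getD_append _ _ _ _ (by rw [length_coordsWord]; exact k.2), getD_coordsWord]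

theorem dataWord_value (l : List (Coords × ℕ)) {i : ℕ} (hi : i < l.length) :
    (dataWord l).getD (5 * i + 4 + 1) 0 = (l.getD i 0).2 := by
  rw [dataWord, List.getD_cons_succ, getD_flatMap _ 5 (by simp [length_coordsWord]) 0 l hi
    (by omega), List.getD_append_right _ _ _ _ (by rw [length_coordsWord]), length_coordsWord]
  simp

/-- The number of rows, read from the memory `g.2`; the number `g.1` is a bound for it. -/
def rowNum (g : ℕ × (ℕ → ℝ)) : ℕ := natOf g.1 (rd g.2 1)

/-- The number of columns. -/
def colNum (g : ℕ × (ℕ → ℝ)) : ℕ := natOf g.1 (rd g.2 (5 * rowNum g + 2))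

/-- The coordinates for the row `i`. -/
def rowPt (g : ℕ × (ℕ → ℝ)) (i : ℕ) (k : Fin 4) : ℝ := rd g.2 (5 * i + (k : ℕ) + 2)

/-- The coordinates for the column `j`. -/
def colPt (g : ℕ × (ℕ → ℝ)) (j : ℕ) (k : Fin 4) : ℝ :=
  rd g.2 (5 * rowNum g + (5 * j + (k : ℕ) + 3))

/-- The value at the row `i`. -/
def rowVal (g : ℕ × (ℕ → ℝ)) (i : ℕ) : ℝ := rd g.2 (5 * i + 4 + 2)

/-- The value at the column `j`. -/
def colVal (g : ℕ × (ℕ → ℝ)) (j : ℕ) : ℝ := rd g.2 (5 * rowNum g + (5 * j + 4 + 3))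

section

variable {γ : Type} [Ctx γ] {g : γ → ℕ × (ℕ → ℝ)} {i : γ → ℕ}

@[fun_prop] theorem Comp.rowNum (hg : Comp g) : Comp (fun x => PenroseTomography.rowNum (g x)) := by
  unfold PenroseTomography.rowNum; fun_prop

@[fun_prop] theorem Comp.colNum (hg : Comp g) : Comp (fun x => PenroseTomography.colNum (g x)) := by
  unfold PenroseTomography.colNum; fun_prop

@[fun_prop] theorem Comp.rowPt (hg : Comp g) (hi : Comp i) (k : Fin 4) :
    Comp (fun x => PenroseTomography.rowPt (g x) (i x) k) := by
  unfold PenroseTomography.rowPt; fun_prop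

@[fun_prop] theorem Comp.colPt (hg : Comp g) (hi : Comp i) (k : Fin 4) :
    Comp (fun x => PenroseTomography.colPt (g x) (i x) k) := by
  unfold PenroseTomography.colPt; fun_prop

@[fun_prop] theorem Comp.rowVal (hg : Comp g) (hi : Comp i) :
    Comp (fun x => PenroseTomography.rowVal (g x) (i x)) := by
  unfold PenroseTomography.rowVal; fun_prop

@[fun_prop] theorem Comp.colVal (hg : Comp g) (hi : Comp i) :
    Comp (fun x => PenroseTomography.colVal (g x) (i x)) := by
  unfold PenroseTomography.colVal; fun_prop

end

theorem lineData_of_encodes {u : ℂ} {p : Lines u → ℕ} {l : List (Coords × ℕ)}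
    (h : EncodesData u p l) : LineData u l.length (fun _ => True) (fun i => (l.getD i 0).1)
      (fun i => (l.getD i 0).2) p where
  inj i hi i' hi' _ _ e := by
    refine (h.1.getElem_inj_iff (hi := by simpa using hi) (hj := by simpa using hi')).1 ?_
    rw [List.getD_eq_getElem _ _ hi, List.getD_eq_getElem _ _ hi'] at e
    simpa using e
  val i hi _ := by
    rw [List.getD_eq_getElem _ _ hi]; exact h.2.1 _ (List.getElem_mem hi)
  zero i _ hi := absurd trivial hi
  cover ℓ hℓ := by
    obtain ⟨e, he, rfl⟩ := h.2.2 ℓ hℓ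
    obtain ⟨i, hi, rfl⟩ := List.getElem_of_mem he
    exact ⟨i, hi, trivial, by rw [List.getD_eq_getElem _ _ hi]⟩

variable {u₁ u₂ : ℂ}

/-- The data of an instance of Consistency or Reconstruction, in the memory `initial w` with a
bound `N` for the numbers of digits. -/
theorem DataInstance.describes {D κ : ℕ} {A B : Fin 4 → Fin 4 → ℤ} (hG : GridFormula u₁ u₂ D κ A B)
    (x : DataInstance u₁ u₂) {w : List ℝ} (hw : w = dataWord x.l₁ ++ dataWord x.l₂) {N : ℕ}
    (hN : w.length ≤ N) (hb : ∀ i, 1 ≤ i → |initial w i| ≤ 2 ^ N) {G : ℕ × (ℕ → ℝ)}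
    (hGw : G = (N, initial w)) :
    rowNum G = x.l₁.length ∧ colNum G = x.l₂.length ∧
    ∃ g X', Describes u₁ u₂ x.p₁ x.p₂ ∅ D (N + κ) (rowNum G) (colNum G)
      (gridCoord A B (colNum G) (rowPt G) (colPt G)) (fun _ => True) (rowVal G) (colVal G) g
        X' := by
  have hinit : ∀ i, rd G.2 (i + 1) = w.getD i 0 := fun i => by rw [hGw]; rfl
  have hlen : w.length = 5 * x.l₁.length + 1 + (5 * x.l₂.length + 1) := by
    rw [hw, List.length_append, length_dataWord, length_dataWord]
  have hleft : ∀ i, i < 5 * x.l₁.length + 1 → rd G.2 (i + 1) = (dataWord x.l₁).getD i 0 :=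
    fun i hi => by
      rw [hinit, hw, List.getD_append _ _ _ _ (by rw [length_dataWord]; exact hi)]
  have hright : ∀ i, rd G.2 (5 * x.l₁.length + (i + 2)) = (dataWord x.l₂).getD i 0 := fun i => by
    rw [show 5 * x.l₁.length + (i + 2) = 5 * x.l₁.length + 1 + i + 1 by ring, hinit, hw,
      List.getD_append_right _ _ _ _ (by rw [length_dataWord]; omega), length_dataWord,
      Nat.add_sub_cancel_left]
  have hN' : G.1 = N := by rw [hGw]
  have hR : rowNum G = x.l₁.length := by
    rw [rowNum, hleft 0 (by omega), dataWord_zero, hN', natOf_natCast (by omega)]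
  have hC : colNum G = x.l₂.length := by
    rw [colNum, hR, hright 0, dataWord_zero, hN', natOf_natCast (by omega)]
  have hrow : ∀ i < x.l₁.length, ∀ k, rowPt G i k = (x.l₁.getD i 0).1 k := fun i hi k => by
    rw [rowPt, hleft (5 * i + k + 1) (by omega), dataWord_coords _ hi]
  have hcol : ∀ j < x.l₂.length, ∀ k, colPt G j k = (x.l₂.getD j 0).1 k := fun j hj k => by
    rw [colPt, hR, hright (5 * j + k + 1), dataWord_coords _ hj]
  have hrowV : ∀ i < x.l₁.length, rowVal G i = (x.l₁.getD i 0).2 := fun i hi => by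
    rw [rowVal, hleft (5 * i + 4 + 1) (by omega), dataWord_value _ hi]
  have hcolV : ∀ j < x.l₂.length, colVal G j = (x.l₂.getD j 0).2 := fun j hj => by
    rw [colVal, hR, hright (5 * j + 4 + 1), dataWord_value _ hj]
  have hbd : ∀ i, 1 ≤ i → |rd G.2 i| ≤ 2 ^ N := fun i hi => by rw [hGw]; exact hb i hi
  obtain ⟨g, X', h1, h2, h3⟩ := hG x.l₂.length (fun i => (x.l₁.getD i 0).1)
    (fun i => (x.l₂.getD i 0).1)
  refine ⟨hR, hC, g, X', ⟨⟨_, _, _, _, _, _, hR ▸ lineData_of_encodes x.encodes₁,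
    hC ▸ lineData_of_encodes x.encodes₂, hC ▸ h1, ?_, ?_, ?_⟩, ?_, ?_⟩⟩
  · rw [hR]; exact hrowV
  · rw [hC]; exact hcolV
  · intro e he
    simp [ActiveCell, he]
  · rw [hR, hC]
    intro e he k
    exact h2 _ _ _ (hrow _ (row_lt he)) (hcol _ (col_lt he)) k
  · rw [hR, hC]
    intro e he
    refine h3 N e (fun l => ?_) (fun l => ?_)
    · have := hbd (5 * (e / x.l₂.length) + (l : ℕ) + 2) (by omega)
      have h4 := hrow _ (row_lt he) l
      rw [rowPt] at h4
      rw [h4] at this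
      exact_mod_cast this
    · have := hbd (5 * rowNum G + (5 * (e % x.l₂.length) + (l : ℕ) + 3)) (by omega)
      have h4 := hcol _ (col_lt he) l
      rw [colPt] at h4
      rw [h4] at this
      exact_mod_cast this

end

end PenroseTomography

/-! ### Reading the data of Uniqueness -/

namespace PenroseTomography

noncomputable section

open Function ComplexConjugate

/-- The points with coordinates `x` and `y` lie on a line in the direction with the normal form
`c`. -/
def OnLine (c x y : Fin 4 → ℝ) : Prop := ∑ k, (x k - y k) * c k = 0

/-- The linear form `c` on coordinates vanishes exactly in the direction `u`. -/
def IsNormal (u : ℂ) (c : Fin 4 → ℝ) : Prop :=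
  (∀ k, IsAlgebraic ℚ (c k)) ∧ ∀ x y : Coords,
    OnLine c (fun k => x k) (fun k => y k) ↔ point x ∈ line u (point y)

theorem exists_isNormal {u : ℂ} (hu : IsCycloDirection u) : ∃ c, IsNormal u c := by
  obtain ⟨hu1, v, hv, hv0, s, hs⟩ := hu
  refine ⟨fun k => (zeta ^ (k : ℕ) * conj v).im, fun k => ?_, fun x y => ?_⟩
  · exact (isAlgebraic_re_im (isAlgebraic_of_mem
      (mem_cycloInts_mul (zeta_pow_mem_cycloInts k) (mem_cycloInts_conj hv)))).2
  · have hs0 : s ≠ 0 := by rintro rfl; simp [hs] at hv0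
    have e1 : ∑ k : Fin 4, (((x k : ℤ) : ℝ) - ((y k : ℤ) : ℝ)) * (zeta ^ (k : ℕ) * conj v).im =
        ((point x - point y) * conj v).im := by
      rw [← point_sub, point, Finset.sum_mul, Complex.im_sum]
      refine Finset.sum_congr rfl fun k _ => ?_
      rw [mul_assoc, ← Complex.ofReal_intCast, Complex.im_ofReal_mul, Pi.sub_apply]
      push_cast; rfl
    have hu2 : conj u * u = 1 := by
      rw [mul_comm, Complex.mul_conj, Complex.normSq_eq_norm_sq, hu1]; simp
    rw [OnLine, e1, hs, map_mul, Complex.conj_ofReal, mul_left_comm, Complex.im_ofReal_mul,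
      mul_eq_zero, or_iff_right hs0]
    constructor
    · intro h
      refine ⟨((point x - point y) * conj u).re, ?_⟩
      have : (point x - point y) * conj u = (((point x - point y) * conj u).re : ℂ) := by
        apply Complex.ext <;> simp [h]
      rw [← this]
      linear_combination (point y - point x) * hu2
    · rintro ⟨r, hr⟩
      rw [hr, add_sub_cancel_left, mul_assoc, mul_comm u, hu2]
      simp

/-- The number of points, read from the memory `g.2`; the number `g.1` is a bound for it. -/
def ptNum (g : ℕ × (ℕ → ℝ)) : ℕ := (natOf g.1 (rd g.2 0) - 2) / 4

/-- The coordinates of the point `i`. -/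
def pt (g : ℕ × (ℕ → ℝ)) (i : ℕ) (k : Fin 4) : ℝ := rd g.2 (4 * i + (k : ℕ) + 3)

/-- The point `i` is the first one on its line. -/
def IsFirst (c : Fin 4 → ℝ) (g : ℕ × (ℕ → ℝ)) (i : ℕ) : Prop :=
  ball i fun i' => ¬ OnLine c (pt g i') (pt g i)

open Classical in
/-- The number of points on the line through the point `i`, if this is the first one on the line,
and zero otherwise. -/
def lineNum (c : Fin 4 → ℝ) (g : ℕ × (ℕ → ℝ)) (i : ℕ) : ℝ :=
  if IsFirst c g i then
    ((nsum (ptNum g) fun i' => if OnLine c (pt g i') (pt g i) then 1 else 0 : ℕ) : ℝ) else 0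

/-- The row and the column of the cell `e` are represented by their first points, and the cell does
not contain the point `f`. -/
def OkWithout (c₁ c₂ : Fin 4 → ℝ) (g : ℕ × (ℕ → ℝ)) (f e : ℕ) : Prop :=
  (IsFirst c₁ g (e / ptNum g) ∧ IsFirst c₂ g (e % ptNum g)) ∧
    ¬ (OnLine c₁ (pt g f) (pt g (e / ptNum g)) ∧ OnLine c₂ (pt g f) (pt g (e % ptNum g)))

section

variable {γ : Type} [Ctx γ] {g : γ → ℕ × (ℕ → ℝ)} {i e f : γ → ℕ} (c c₁ c₂ : Fin 4 → ℝ)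

@[fun_prop] theorem Comp.onLine [hc : ∀ k, AlgConst (c k)] {x y : γ → Fin 4 → ℝ}
    (hx : ∀ k, Comp fun g => x g k) (hy : ∀ k, Comp fun g => y g k) :
    Comp (fun g => OnLine c (x g) (y g)) := by
  unfold OnLine; fun_prop

@[fun_prop] theorem Comp.ptNum (hg : Comp g) : Comp (fun x => PenroseTomography.ptNum (g x)) := by
  unfold PenroseTomography.ptNum; fun_prop

@[fun_prop] theorem Comp.pt (hg : Comp g) (hi : Comp i) (k : Fin 4) :
    Comp (fun x => PenroseTomography.pt (g x) (i x) k) := by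
  unfold PenroseTomography.pt; fun_prop

@[fun_prop] theorem Comp.isFirst [∀ k, AlgConst (c k)] (hg : Comp g) (hi : Comp i) :
    Comp (fun x => IsFirst c (g x) (i x)) := by
  unfold IsFirst; fun_prop

@[fun_prop] theorem Comp.lineNum [∀ k, AlgConst (c k)] (hg : Comp g) (hi : Comp i) :
    Comp (fun x => PenroseTomography.lineNum c (g x) (i x)) := by
  unfold PenroseTomography.lineNum; fun_prop

@[fun_prop] theorem Comp.okWithout [∀ k, AlgConst (c₁ k)] [∀ k, AlgConst (c₂ k)] (hg : Comp g)
    (hf : Comp f) (he : Comp e) : Comp (fun x => OkWithout c₁ c₂ (g x) (f x) (e x)) := by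
  unfold OkWithout; fun_prop

end

theorem length_setWord (t : ℂ) (l : List Coords) : (setWord t l).length = 4 * l.length + 2 := by
  rw [setWord, List.length_cons, List.length_cons, length_flatMap_of_length _ 4 length_coordsWord]

theorem setWord_coords (t : ℂ) (l : List Coords) {i : ℕ} (hi : i < l.length) (k : Fin 4) :
    (setWord t l).getD (4 * i + k + 2) 0 = l.getD i 0 k := by
  rw [setWord, List.getD_cons_succ, List.getD_cons_succ, getD_flatMap _ 4 length_coordsWord 0 l hi
    k.2, getD_coordsWord]

/-- The set of points with coordinates in the list. -/
def pointSet (l : List Coords) : Finset ℂ := by classical exact l.toFinset.image point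

theorem mem_pointSet {l : List Coords} {z : ℂ} : z ∈ pointSet l ↔ ∃ a ∈ l, point a = z := by
  simp [pointSet]

theorem pointSet_eq_image {l : List Coords} :
    pointSet l = (Finset.range l.length).image fun i => point (l.getD i 0) := by
  ext z
  rw [mem_pointSet]
  simp only [Finset.mem_image, Finset.mem_range]
  constructor
  · rintro ⟨a, ha, rfl⟩
    obtain ⟨i, hi, rfl⟩ := List.getElem_of_mem ha
    exact ⟨i, hi, by rw [List.getD_eq_getElem _ _ hi]⟩
  · rintro ⟨i, hi, rfl⟩
    exact ⟨_, by rw [List.getD_eq_getElem _ _ hi]; exact List.getElem_mem hi, rfl⟩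

theorem injOn_getD {l : List Coords} (hl : l.Nodup) :
    Set.InjOn (fun i => point (l.getD i 0)) (Finset.range l.length) := by
  intro i hi i' hi' h
  rw [Finset.mem_coe, Finset.mem_range] at hi hi'
  have := point_injective h
  rw [List.getD_eq_getElem _ _ hi, List.getD_eq_getElem _ _ hi'] at this
  exact (hl.getElem_inj_iff).1 this

open Classical in
theorem lineData_pointSet {u : ℂ} {l : List Coords} (hl : l.Nodup) :
    LineData u l.length (fun i => ∀ i' < i, point (l.getD i' 0) ∉ line u (point (l.getD i 0)))
      (fun i => l.getD i 0) (fun i =>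
        if ∀ i' < i, point (l.getD i' 0) ∉ line u (point (l.getD i 0)) then
          nsum l.length fun i' => if point (l.getD i' 0) ∈ line u (point (l.getD i 0)) then 1 else 0
        else 0) (xray u (pointSet l)) where
  inj i hi i' hi' h h' e := by
    by_contra hne
    rcases lt_or_gt_of_ne hne with hlt | hlt
    · exact h' i hlt (mem_line_of_eq e (mem_line_self _ _))
    · exact h i' hlt (mem_line_of_eq e.symm (mem_line_self _ _))
  val i hi h := by
    rw [if_pos h, nsum, ← Finset.sum_filter, Finset.sum_const, smul_eq_mul, mul_one, xray_apply,
      pointSet_eq_image, Finset.filter_image, Finset.card_image_of_injOn]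
    · rfl
    · exact (injOn_getD hl).mono fun e he => (Finset.mem_filter.1 (Finset.mem_coe.1 he)).1
  zero i hi h := if_neg h
  cover ℓ hℓ := by
    rw [xray_apply, Ne, Finset.card_eq_zero] at hℓ
    obtain ⟨z, hz⟩ := Finset.nonempty_iff_ne_empty.2 hℓ
    rw [Finset.mem_filter, pointSet_eq_image, Finset.mem_image] at hz
    obtain ⟨⟨i₀, hi₀, rfl⟩, hzℓ⟩ := hz
    rw [Finset.mem_range] at hi₀
    have hex : ∃ i, i < l.length ∧ point (l.getD i 0) ∈ ℓ.1 := ⟨i₀, hi₀, hzℓ⟩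
    obtain ⟨h1, h2⟩ := Nat.find_spec hex
    have h3 : ℓ = cycloLine u (l.getD (Nat.find hex) 0) := by
      obtain ⟨ℓ, z, rfl⟩ := ℓ
      exact Subtype.ext (line_eq_of_mem h2)
    refine ⟨_, h1, fun i' hi' hmem => Nat.find_min hex hi' ⟨by omega, ?_⟩, h3⟩
    rw [h3]; exact hmem

/-- The data of an instance of Uniqueness, in the memory `initial w` with a bound `N` for the
numbers of digits. -/
theorem describes_pointSet {u₁ u₂ : ℂ} {D κ : ℕ} {A B : Fin 4 → Fin 4 → ℤ}
    (hG : GridFormula u₁ u₂ D κ A B) {c₁ c₂ : Fin 4 → ℝ} (h₁ : IsNormal u₁ c₁)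
    (h₂ : IsNormal u₂ c₂) {t : ℂ} {l : List Coords} (hl : l.Nodup) {N : ℕ}
    (hN : (setWord t l).length ≤ N) (hb : ∀ i, 3 ≤ i → |initial (setWord t l) i| ≤ 2 ^ N)
    {G : ℕ × (ℕ → ℝ)} (hGw : G = (N, initial (setWord t l))) :
    ptNum G = l.length ∧ ∀ f < l.length,
    ∃ g X', Describes u₁ u₂ (xray u₁ (pointSet l)) (xray u₂ (pointSet l)) {point (l.getD f 0)}
      D (N + κ) (ptNum G) (ptNum G) (gridCoord A B (ptNum G) (pt G) (pt G))
      (OkWithout c₁ c₂ G f) (lineNum c₁ G) (lineNum c₂ G) g X' := by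
  classical
  have hm : ptNum G = l.length := by
    have : rd G.2 0 = ((4 * l.length + 2 : ℕ) : ℝ) := by
      rw [hGw, ← length_setWord t l]; rfl
    rw [ptNum, this, hGw, natOf_natCast (by rwa [← length_setWord t l])]
    omega
  refine ⟨hm, fun f hf => ?_⟩
  have hpt : ∀ i < l.length, pt G i = fun k => ((l.getD i 0 k : ℤ) : ℝ) := fun i hi => by
    funext k
    rw [← setWord_coords t l hi k, pt, hGw]; rfl
  have hfirst : ∀ {u c}, IsNormal u c → ∀ i < l.length, IsFirst c G i ↔
      ∀ i' < i, point (l.getD i' 0) ∉ line u (point (l.getD i 0)) := fun {u c} hc i hi => by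
    refine forall₂_congr fun i' hi' => not_congr ?_
    rw [hpt i' (by omega), hpt i hi, hc.2]
  have hnum : ∀ {u c}, IsNormal u c → ∀ i < l.length, lineNum c G i = ((if ∀ i' < i,
      point (l.getD i' 0) ∉ line u (point (l.getD i 0)) then nsum l.length fun i' =>
        if point (l.getD i' 0) ∈ line u (point (l.getD i 0)) then 1 else 0 else 0 : ℕ) : ℝ) :=
    fun {u c} hc i hi => by
      rw [lineNum, hm, Nat.cast_ite, Nat.cast_zero]
      refine if_congr (hfirst hc i hi) (congrArg _ (Finset.sum_congr rfl fun i' hi' => ?_)) rfl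
      beta_reduce
      rw [hpt i' (Finset.mem_range.1 hi'), hpt i hi]
      exact if_congr (hc.2 _ _) rfl rfl
  obtain ⟨g, X', h4, h5, h6⟩ := hG l.length (fun i => l.getD i 0) (fun i => l.getD i 0)
  refine ⟨g, X', ⟨⟨_, _, _, _, _, _, hm ▸ lineData_pointSet hl, hm ▸ lineData_pointSet hl,
    hm ▸ h4, ?_, ?_, ?_⟩, ?_, ?_⟩⟩
  · rw [hm]; exact hnum h₁
  · rw [hm]; exact hnum h₂
  · rw [hm]
    intro e he
    rw [OkWithout, hm, ActiveCell, hfirst h₁ _ (row_lt he), hfirst h₂ _ (col_lt he),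
      hpt f hf, hpt _ (row_lt he), hpt _ (col_lt he), h₁.2, h₂.2, Set.mem_singleton_iff]
    refine and_congr (by simp [he]) (not_congr ⟨fun h => (h4.unique e _ h.1 h.2).symm, fun h => ?_⟩)
    rw [← h]
    exact ⟨h4.row_mem e, h4.col_mem e⟩
  · rw [hm]
    intro e he k
    exact h5 _ _ _ (fun l' => by rw [hpt _ (row_lt he)]) (fun l' => by rw [hpt _ (col_lt he)]) k
  · rw [hm]
    intro e he
    have hbd : ∀ i < l.length, ∀ k, |l.getD i 0 k| ≤ 2 ^ N := fun i hi k => by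
      have := hb (4 * i + (k : ℕ) + 3) (by omega)
      rw [show initial (setWord t l) (4 * i + (k : ℕ) + 3) = l.getD i 0 k from
        setWord_coords t l hi k] at this
      exact_mod_cast this
    exact h6 N e (hbd _ (row_lt he)) (hbd _ (col_lt he))

end

end PenroseTomography

/-! ### The output word of Reconstruction -/

namespace PenroseTomography

noncomputable section

open Function

open Classical in
/-- The least number that satisfies `p`, if there is one below `n`. -/
def least (n : ℕ) (p : ℕ → Prop) : ℕ := nsum n fun i => if ball (i + 1) fun j => ¬ p j then 1 else 0

theorem least_spec {n : ℕ} {p : ℕ → Prop} (h : bex n p) : p (least n p) := by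
  classical
  obtain ⟨m, hm, hp⟩ := h
  have hex : ∃ m, p m := ⟨m, hp⟩
  have : least n p = Nat.find hex := by
    rw [least, nsum, ← Finset.sum_filter, Finset.sum_const, smul_eq_mul, mul_one]
    conv_rhs => rw [← Finset.card_range (Nat.find hex)]
    congr 1
    ext i
    rw [Finset.mem_filter, Finset.mem_range, Finset.mem_range, Nat.lt_find_iff]
    have : Nat.find hex ≤ m := Nat.find_min' hex hp
    constructor
    · rintro ⟨-, h⟩ j hj
      exact h j (by omega)
    · intro h
      refine ⟨?_, fun j hj => h j (by omega)⟩
      by_contra hi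
      exact h m (by omega) hp
  rw [this]
  exact Nat.find_spec hex

open Classical in
/-- The number of elements of `S` below `e`. -/
def rank (S : ℕ → Prop) (e : ℕ) : ℕ := nsum e fun i => if S i then 1 else 0

open Classical in
/-- The entry `i` of the sequence of the coordinates `z e` of the elements `e < M` of `S`. -/
def coordsSeq (S : ℕ → Prop) (z : ℕ → Fin 4 → ℝ) (M i : ℕ) : ℝ :=
  rsum M fun e => ∑ k : Fin 4, if S e ∧ i = 4 * rank S e + (k : ℕ) then z e k else 0

open Classical in
/-- The letter `i` of the output, counted from one: first the position of the reference cell, then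
the coordinates of the selected cells. -/
def outLetter (D M : ℕ) (x₀ : Fin 4 → ℝ) (S : ℕ → Prop) (z : ℕ → Fin 4 → ℝ) (i : ℕ) : ℝ :=
  if i = 1 then (∑ k, x₀ k * (zeta ^ (k : ℕ)).re) / D else
  if i = 2 then (∑ k, x₀ k * (zeta ^ (k : ℕ)).im) / D else coordsSeq S z M (i - 3)

section

variable {γ : Type} [Ctx γ]

@[fun_prop] theorem Comp.least {n : γ → ℕ} {p : γ → ℕ → Prop} (hn : Comp n)
    (hp : Comp fun x : γ × ℕ => p x.1 x.2) :
    Comp (fun g => PenroseTomography.least (n g) (p g)) := by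
  unfold PenroseTomography.least; fun_prop

@[fun_prop] theorem Comp.rank {S : γ → ℕ → Prop} {e : γ → ℕ}
    (hS : Comp fun x : γ × ℕ => S x.1 x.2) (he : Comp e) :
    Comp (fun g => PenroseTomography.rank (S g) (e g)) := by
  unfold PenroseTomography.rank; fun_prop

@[fun_prop] theorem Comp.coordsSeq {S : γ → ℕ → Prop} {z : γ → ℕ → Fin 4 → ℝ} {M i : γ → ℕ}
    (hS : Comp fun x : γ × ℕ => S x.1 x.2) (hz : ∀ k, Comp fun x : γ × ℕ => z x.1 x.2 k)
    (hM : Comp M) (hi : Comp i) :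
    Comp (fun g => PenroseTomography.coordsSeq (S g) (z g) (M g) (i g)) := by
  unfold PenroseTomography.coordsSeq; fun_prop

@[fun_prop] theorem Comp.outLetter (D : ℕ) {M : γ → ℕ} {x₀ : γ → Fin 4 → ℝ} {S : γ → ℕ → Prop}
    {z : γ → ℕ → Fin 4 → ℝ} {i : γ → ℕ} (hM : Comp M) (hx : ∀ k, Comp fun g => x₀ g k)
    (hS : Comp fun x : γ × ℕ => S x.1 x.2) (hz : ∀ k, Comp fun x : γ × ℕ => z x.1 x.2 k)
    (hi : Comp i) :
    Comp (fun g => PenroseTomography.outLetter D (M g) (x₀ g) (S g) (z g) (i g)) := by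
  unfold PenroseTomography.outLetter; fun_prop

end

theorem getD_append_eq_add (l₁ l₂ : List ℝ) (i : ℕ) :
    (l₁ ++ l₂).getD i 0 = l₁.getD i 0 + if l₁.length ≤ i then l₂.getD (i - l₁.length) 0 else 0 := by
  split_ifs with h
  · rw [List.getD_append_right _ _ _ _ h, List.getD_eq_default _ _ h, zero_add]
  · rw [List.getD_append _ _ _ _ (not_le.1 h), add_zero]

theorem rank_succ (S : ℕ → Prop) [DecidablePred S] (M : ℕ) :
    rank S (M + 1) = rank S M + if S M then 1 else 0 := by
  rw [rank, nsum, Finset.sum_range_succ]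
  congr

theorem length_filter_range (S : ℕ → Prop) [DecidablePred S] (M : ℕ) :
    ((List.range M).filter fun e => S e).length = rank S M := by
  induction M with
  | zero => rfl
  | succ M ih =>
    rw [List.range_succ, List.filter_append, List.length_append, ih, rank_succ]
    by_cases h : S M <;> simp [h]

/-- The sequence of coordinates is that of the list of the elements of `S`. -/
theorem coordsSeq_eq (S : ℕ → Prop) [DecidablePred S] {z : ℕ → Fin 4 → ℝ} {z' : ℕ → Coords} {M : ℕ}
    (hz : ∀ e < M, S e → ∀ k, z e k = z' e k) (i : ℕ) :
    coordsSeq S z M i =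
      ((((List.range M).filter fun e => S e).map z').flatMap coordsWord).getD i 0 := by
  classical
  induction M with
  | zero => rfl
  | succ M ih =>
    have hlen : ((((List.range M).filter fun e => S e).map z').flatMap coordsWord).length =
        4 * rank S M := by
      rw [length_flatMap_of_length _ 4 length_coordsWord, List.length_map, length_filter_range]
    rw [coordsSeq, rsum, Finset.sum_range_succ, List.range_succ, List.filter_append,
      List.map_append, List.flatMap_append, getD_append_eq_add, ← ih fun e he => hz e (by omega), hlen]
    congr 1
    by_cases h : S M
    · simp only [h, true_and, List.filter_cons, decide_true, if_true, List.filter_nil,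
        List.map_cons, List.map_nil, List.flatMap_cons, List.flatMap_nil, List.append_nil]
      split_ifs with hi
      · obtain ⟨j, rfl⟩ := Nat.exists_eq_add_of_le hi
        simp only [Nat.add_left_cancel_iff, Nat.add_sub_cancel_left]
        by_cases hj : j < 4
        · have := getD_coordsWord (z' M) ⟨j, hj⟩
          simp only at this
          rw [this, Finset.sum_eq_single (⟨j, hj⟩ : Fin 4)]
          · rw [if_pos rfl, hz M (by omega) h]
          · intro k _ hk
            rw [if_neg fun e => hk (Fin.ext e.symm)]
          · simp
        · rw [List.getD_eq_default _ _ (by rw [length_coordsWord]; omega)]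
          exact Finset.sum_eq_zero fun k _ => if_neg (by omega)
      · exact Finset.sum_eq_zero fun k _ => if_neg (by omega)
    · simp [h]

/-- The letters of the output word. -/
theorem outLetter_eq (D : ℕ) (S : ℕ → Prop) [DecidablePred S] {x₀ : Fin 4 → ℝ}
    {z : ℕ → Fin 4 → ℝ} {z' : ℕ → Coords} {M : ℕ}
    (hz : ∀ e < M, S e → ∀ k, z e k = z' e k) (i : ℕ) :
    outLetter D M x₀ S z (i + 1) = (setWord ⟨(∑ k, x₀ k * (zeta ^ (k : ℕ)).re) / D,
      (∑ k, x₀ k * (zeta ^ (k : ℕ)).im) / D⟩ (((List.range M).filter fun e => S e).map z')).getD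
        i 0 := by
  rcases i with _ | _ | i
  · simp [outLetter, setWord]
  · simp [outLetter, setWord]
  · rw [outLetter, if_neg (by omega), if_neg (by omega), setWord, List.getD_cons_succ,
      List.getD_cons_succ, ← coordsSeq_eq S hz]
    rfl

variable {π : Equiv.Perm (Fin 4)} {u₁ u₂ : ℂ} {p₁ : Lines u₁ → ℕ} {p₂ : Lines u₂ → ℕ}
  {D T R C : ℕ} {X : ℕ → Fin 4 → ℝ} {ok : ℕ → Prop} {p q : ℕ → ℝ} {g : ℕ → ℂ} {X' : ℕ → Coords}

/-- The output word for the first possible candidate encodes a solution. -/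
theorem Describes.exists_output (h : Describes u₁ u₂ p₁ p₂ ∅ D T R C X ok p q g X')
    (hs : Solvable π D T R C X ok p q) :
    ∃ (F : Finset ℂ) (t : ℂ) (l : List Coords), IsSolution π u₁ u₂ p₁ p₂ F ∧ EncodesSet F t l ∧
      (setWord t l).length = 4 * rank (InSolution π D T R C X ok p q
        (least (candidates (R * C)) fun c => Possible π D T R C X ok p q c)) (R * C) + 2 ∧
      ∀ i, (setWord t l).getD i 0 = outLetter D (R * C)
        (X (digit (base (R * C)) 0
          (least (candidates (R * C)) fun c => Possible π D T R C X ok p q c)))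
        (InSolution π D T R C X ok p q
          (least (candidates (R * C)) fun c => Possible π D T R C X ok p q c))
        (quot D X (digit (base (R * C)) 0
          (least (candidates (R * C)) fun c => Possible π D T R C X ok p q c))) (i + 1) := by
  classical
  have hc := least_spec hs.2
  set c := least (candidates (R * C)) fun c => Possible π D T R C X ok p q c
  set e₀ := digit (base (R * C)) 0 c with he₀
  set S := InSolution π D T R C X ok p q c with hS
  set Z := (Finset.range (R * C)).filter S with hZ
  obtain ⟨act₁, act₂, a, b, P, Q, -, -, hG, -⟩ := h.exists_data
  obtain ⟨hsol, -, hinj⟩ := h.isSolution hs.1 hc (Z := Z) (by simp [hZ, hS])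
  have hall : ∀ e, e < R * C ∧ S e → _ := fun e he =>
    (allowed_iff hG.denom h.coords h.bound he.1 rfl rfl rfl rfl).1 he.2.1
  choose! z' hz' using fun e he => (hall e he).2.2.2
  have hq : ∀ e < R * C, S e → ∀ k, quot D X e₀ e k = z' e k := fun e he hSe k => by
    obtain ⟨-, h1, h2, -⟩ := hall e ⟨he, hSe⟩
    rw [(quot_eq hG.denom h.coords h.bound he h1 h2 (hz' e ⟨he, hSe⟩).1).1]
  set t : ℂ := ⟨(∑ k, X e₀ k * (zeta ^ (k : ℕ)).re) / D,
      (∑ k, X e₀ k * (zeta ^ (k : ℕ)).im) / D⟩ with ht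
  have hD : (D : ℂ) ≠ 0 := by exact_mod_cast hG.denom.ne'
  have hpt : ∀ e ∈ Z, g e = t + point (z' e) := fun e he => by
    have he' : e < R * C ∧ S e := by simpa [hZ] using he
    have h1 := (hall e he').2.1
    have ht' : D * t = point (X' e₀) := by
      have hD' : (D : ℝ) ≠ 0 := by exact_mod_cast hG.denom.ne'
      rw [point]
      apply Complex.ext
      · rw [← Complex.ofReal_natCast, Complex.re_ofReal_mul, ht, Complex.re_sum]
        simp only
        rw [mul_div_cancel₀ _ hD']
        refine Finset.sum_congr rfl fun k _ => ?_
        rw [h.coords _ h1, ← Complex.ofReal_intCast, Complex.re_ofReal_mul]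
      · rw [← Complex.ofReal_natCast, Complex.im_ofReal_mul, ht, Complex.im_sum]
        simp only
        rw [mul_div_cancel₀ _ hD']
        refine Finset.sum_congr rfl fun k _ => ?_
        rw [h.coords _ h1, ← Complex.ofReal_intCast, Complex.im_ofReal_mul]
    refine mul_left_cancel₀ hD ?_
    have h2 := congrArg point (hz' e he').1
    rw [point_sub, point_smul] at h2
    rw [hG.coords, mul_add, ht']
    push_cast at h2
    linear_combination h2
  have hmem : ∀ e, e ∈ (List.range (R * C)).filter (fun e => S e) ↔ e ∈ Z := fun e => by
    simp [hZ]
  refine ⟨Z.image g, t, ((List.range (R * C)).filter fun e => S e).map z', hsol, ⟨?_, ?_⟩, ?_,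
    fun i => (outLetter_eq D S hq i).symm⟩
  · refine List.Nodup.map_on (fun e he e' he' hee => ?_) (List.nodup_range.filter _)
    rw [hmem] at he he'
    exact hinj he he' (by rw [hpt e he, hpt e' he', hee])
  · ext w
    simp only [Finset.coe_image, Set.mem_image, Finset.mem_coe, List.mem_map, Set.mem_ofPred_eq]
    constructor
    · rintro ⟨e, he, rfl⟩
      exact ⟨_, ⟨e, (hmem e).2 he, rfl⟩, hpt e he⟩
    · rintro ⟨-, ⟨e, he, rfl⟩, rfl⟩
      exact ⟨e, (hmem e).1 he, hpt e ((hmem e).1 he)⟩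
  · rw [length_setWord, List.length_map, length_filter_range]

end

end PenroseTomography

/-! ### From the input word to a computation, and back -/

namespace PenroseTomography

noncomputable section

open Function

/-- Move the letters one, two and three of the input to the cells `4 * n`, `4 * n + 1` and
`4 * n + 2`, where `n` is the length of the word, and start the array area at `16 * n ^ 2`. Below
this address there is room for the output. -/
def clearRegs : Prog :=
  straight [Instr.add 0 0 0, Instr.add 0 0 0, Instr.store 0 1, Instr.const 1 (natConst 1),
    Instr.add 0 0 1, Instr.store 0 2, Instr.add 0 0 1, Instr.store 0 3, Instr.const 2 (natConst 2),
    Instr.sub 3 0 2, Instr.mul 0 3 3]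

/-- The low memory after `clearRegs`. -/
def lowMem (w : List ℝ) (i : ℕ) : ℝ :=
  if 4 * w.length ≤ i ∧ i < 4 * w.length + 3 then initial w (i - 4 * w.length + 1) else initial w i

theorem initial_eq_zero {w : List ℝ} {i : ℕ} (h : w.length < i) : initial w i = 0 := by
  cases i with
  | zero => omega
  | succ i => exact List.getD_eq_default _ _ (by omega)

theorem exec_clearRegs {w : List ℝ} (hw : 2 ≤ w.length) :
    ∃ M, Exec clearRegs (initial w) 11 M ∧ M 3 = ((4 * w.length : ℕ) : ℝ) ∧
      Lay (16 * w.length ^ 2) (fun c => if c.1 = 0 then lowMem w c.2 else 0) M := by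
  set n := w.length with hn
  have h0 : initial w 0 = n := rfl
  have hn0 : n ≠ 0 := by omega
  refine ⟨_, exec_cons (Step.add ..) (exec_cons (Step.add ..) (exec_cons
    (Step.store _ _ _ (4 * n) ?_) (exec_cons (Step.const ..) (exec_cons (Step.add ..) (exec_cons
    (Step.store _ _ _ (4 * n + 1) ?_) (exec_cons (Step.add ..) (exec_cons
    (Step.store _ _ _ (4 * n + 2) ?_) (exec_cons (Step.const ..) (exec_cons (Step.sub ..)
    (exec_cons (Step.mul ..) (exec_nil _))))))))))), ?_, ?_⟩
  · simp [h0]; ring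
  · have h1 : 0 ≠ 4 * n := by omega
    simp [h0, natConst, h1]; ring
  · have h1 : 0 ≠ 4 * n := by omega
    have h2 : 1 ≠ 4 * n := by omega
    simp [update_apply, h0, natConst, h1, hn0]; ring
  · have h1 : 0 ≠ 4 * n := by omega
    have h2 : 1 ≠ 4 * n := by omega
    simp [update_apply, h0, natConst, h1, hn0]; ring
  · have h1 : 0 ≠ 4 * n := by omega
    have h2 : 1 ≠ 4 * n := by omega
    have h3 : 2 ≠ 4 * n := by omega
    have h4 : 3 ≠ 4 * n := by omega
    have h5 : 2 ≠ 4 * n + 1 := by omega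
    refine ⟨by nlinarith, ?_, ?_⟩
    · simp [h0, natConst, h1, hn0]; ring
    · rintro ⟨k, i⟩ hv
      have h6 := four_le_addr (by nlinarith : 4 ≤ 16 * n ^ 2) hv
      generalize ha : addr (16 * n ^ 2) (k, i) = x at h6
      have h7 : x ≠ 0 ∧ x ≠ 1 ∧ x ≠ 2 ∧ x ≠ 3 := by omega
      have hL : (if k = 0 then lowMem w i else 0) = lowMem w x := by
        simp only [addr] at ha
        split_ifs at ha ⊢ with hk
        · rw [ha]
        · have : 16 * n ^ 2 < x := by
            rw [← ha]; exact Nat.lt_add_of_pos_right (by positivity)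
          have : 4 * n + 3 < x := by nlinarith
          rw [lowMem, if_neg (by omega), initial_eq_zero (by omega)]
      rw [hL, lowMem, ← hn]
      simp only [update_apply, natConst]
      simp only [h7.1, h7.2.1, h7.2.2.1, h7.2.2.2, if_false]
      split_ifs <;> first | rfl | omega | (exfalso; assumption) | (congr 1; omega)

/-- `7 := 0[6]`, for an index from four on; for a smaller index `i`, the entry `4 * n - 1 + i` is
read instead. The scalar `2` holds the number `4 * n`. -/
def fetch : Prog :=
  Prog.seq (setC 8 (natConst 4)) (ifLt 6 8
    (Prog.seq (arith Op.add 9 6 2) (Prog.seq (setC 8 (natConst 1)) (Prog.seq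
      (arith Op.sub 9 9 8) (Prog.seq (readA 7 0 9) (Prog.seq (setC 8 (natConst 0))
        (setC 9 (natConst 0)))))))
    (Prog.seq (readA 7 0 6) (setC 8 (natConst 0))))

theorem runsTo_fetch {B n t : ℕ} {σ : Store} (h6 : σ (6, 0) = t) (h2 : σ (2, 0) = ((4 * n : ℕ) : ℝ))
    (h8 : σ (8, 0) = 0) (h9 : σ (9, 0) = 0) (hn : 2 ≤ n) (ht : t ≤ n) (hB : 16 * n ≤ B) :
    RunsTo B fetch σ 55
      (update σ (7, 0) (if t < 4 then σ (0, 4 * n - 1 + t) else σ (0, t))) := by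
  refine ((runsTo_setC B _ (by simp) _).seq (runsTo_ifLt (n := 44) (by simp) (by simp)
    (fun hlt => ?_) (fun hlt => ?_))).mono (by norm_num)
  · have ht4 : t < 4 := by
      simp [natConst, h6] at hlt
      exact_mod_cast hlt
    refine ((runsTo_arith B _ Op.add (by simp) (by simp) (by simp) (by simp)).seq
      ((runsTo_setC B _ (by simp) _).seq ((runsTo_arith B _ Op.sub (by simp) (by simp) (by simp)
      (by simp)).seq ((runsTo_readA (i := 4 * n - 1 + t) (by simp) (by simp) ?_ ?_).seq
      ((runsTo_setC B _ (by simp) _).seq (runsTo_setC B _ (by simp) _)))))).congr ?_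
    · have : ((4 * n - 1 + t : ℕ) : ℝ) = t + 4 * n - 1 := by
        rw [Nat.cast_add, Nat.cast_sub (by omega)]; push_cast; ring
      rw [this]
      simp [natConst, Op.val, h2, h6]
    · intro _
      simp only
      omega
    · rw [if_pos ht4]
      funext ⟨k, i⟩
      simp only [update_apply, natConst, Prod.mk.injEq, Nat.cast_zero]
      by_cases hk : k = 7 ∨ k = 8 ∨ k = 9
      · rcases hk with rfl | rfl | rfl <;> by_cases hi : i = 0 <;> simp [hi, h8, h9]
      · push Not at hk
        simp [hk]
  · have ht4 : ¬ t < 4 := by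
      simp [natConst, h6] at hlt
      simpa using (by exact_mod_cast hlt : 4 ≤ t)
    refine (((runsTo_readA (i := t) (by simp) (by simp) ?_ ?_).seq
      (runsTo_setC B _ (by simp) _)).mono (by norm_num)).congr ?_
    · simp [h6]
    · intro _
      simp only
      omega
    · rw [if_neg ht4]
      funext ⟨k, i⟩
      simp only [update_apply, natConst, Prod.mk.injEq, Nat.cast_zero]
      by_cases hk : k = 7 ∨ k = 8
      · rcases hk with rfl | rfl <;> by_cases hi : i = 0 <;> simp [hi, h8]
      · push Not at hk
        simp [hk]

/-- `3 := 4; 4 := 2 / 3; 5 := 1; 5 := 5 + 4`, so that the scalar `4` holds the length of the input. -/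
def readLength : Prog :=
  Prog.seq (setC 3 (natConst 4)) (Prog.seq (arith Op.div 4 2 3)
    (Prog.seq (setC 5 (natConst 1)) (arith Op.add 5 5 4)))

/-- Copy the input to the array `1`, with its length in the scalar `4`. The entry `0` is put in
place separately. -/
def copyInput : Prog := Prog.seq readLength (Prog.seq (tabulate 1 5 6 fetch) (mov 1 4))

/-- The store after `copyInput`. -/
structure Copied (w : List ℝ) (σ : Store) : Prop where
  word : ∀ i, σ (1, i) = initial w i
  length : σ (4, 0) = w.length
  clean : Clean 6 σ

theorem runsTo_copyInput {w : List ℝ} (hw : 2 ≤ w.length) :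
    ∃ σ, RunsTo (16 * w.length ^ 2) copyInput (update (fun c => if c.1 = 0 then lowMem w c.2 else 0)
      (2, 0) ((4 * w.length : ℕ) : ℝ)) (96 * w.length + 141) σ ∧ Copied w σ := by
  set n := w.length with hn
  set B := 16 * n ^ 2
  have hB' : 16 * n ≤ B := by change _ ≤ 16 * n ^ 2; nlinarith
  set σ₀ : Store := update (fun c => if c.1 = 0 then lowMem w c.2 else 0)
      (2, 0) ((4 * n : ℕ) : ℝ) with hσ₀
  have hlow : ∀ i, σ₀ (0, i) = lowMem w i := fun i => by simp [hσ₀]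
  have hz : ∀ k i, k ≠ 0 → k ≠ 2 → σ₀ (k, i) = 0 := fun k i hk hk' => by
    simp [hσ₀, hk, hk']
  have h2 : σ₀ (2, 0) = ((4 * n : ℕ) : ℝ) := by simp [hσ₀]
  clear_value σ₀
  set σ₁ : Store := update (update (update (update σ₀ (3, 0) 4) (4, 0) n) (5, 0) 1) (5, 0)
    ((n + 1 : ℕ) : ℝ) with hσ₁
  have r₁ : RunsTo B readLength σ₀ (4 + (10 + (4 + 10))) σ₁ := by
    refine ((runsTo_setC B σ₀ (d := 3) (by simp) _).seq ((runsTo_arith B _ Op.div (by simp)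
      (by simp) (by simp) ?_).seq ((runsTo_setC B _ (by simp) _).seq (runsTo_arith B _ Op.add
      (by simp) (by simp) (by simp) (by simp))))).congr ?_
    · simp [natConst]
    · have : ((4 * n : ℕ) : ℝ) / 4 = n := by push_cast; field_simp
      simp [hσ₁, natConst, Op.val, h2, add_comm]
  have hc₁ : Clean 6 σ₁ := fun k i hk => by
    have h3 : k ≠ 3 := by omega
    have h4 : k ≠ 4 := by omega
    have h5 : k ≠ 5 := by omega
    simp [hσ₁, h3, h4, h5, hz k i (by omega) (by omega)]
  have hl₁ : ∀ i, σ₁ (0, i) = lowMem w i := fun i => by simp [hσ₁, hlow]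
  have h1₁ : ∀ i, σ₁ (1, i) = 0 := fun i => by simp [hσ₁, hz]
  have h2₁ : σ₁ (2, 0) = ((4 * n : ℕ) : ℝ) := by simp [hσ₁, h2]
  have h4₁ : σ₁ (4, 0) = n := by simp [hσ₁]
  have h5₁ : σ₁ (5, 0) = ((n + 1 : ℕ) : ℝ) := by simp [hσ₁]
  clear_value σ₁
  set v : ℕ → ℝ := fun i => if i < 4 then lowMem w (4 * n - 1 + i) else lowMem w i with hv
  have r₂ := runsTo_tabulate (B := B) (a := 1) (l := 5) (j := 6) (L := n + 1) (c := 55)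
    (P := fetch) (by simp) (by simp) (by simp) (by simp) (by simp) v h5₁ hc₁ (fun t ht => by
      have := runsTo_fetch (B := B) (n := n) (t := t) (σ := update (setArr σ₁ 1 t v) (6, 0) t)
        (by simp) (by rw [update_of_ne (by simp), setArr_of_ne _ _ _ _ (by simp), h2₁])
        (by rw [update_of_ne (by simp), setArr_of_ne _ _ _ _ (by simp), hc₁ _ _ (by simp)])
        (by rw [update_of_ne (by simp), setArr_of_ne _ _ _ _ (by simp), hc₁ _ _ (by simp)])
        hw (by omega) hB'
      simpa [setArr_of_ne _ _ _ _ (show (0 : ℕ) ≠ 1 by simp), hl₁] using this)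
  have r₃ := runsTo_mov B (setArr σ₁ 1 (n + 1) v) (d := 1) (a := 4) (by simp) (by simp)
  rw [setArr_of_ne _ _ _ _ (by simp), h4₁] at r₃
  refine ⟨_, (r₁.seq (r₂.seq r₃)).mono (by ring_nf; omega), fun i => ?_, ?_, fun k i hk => ?_⟩
  · rcases Nat.eq_zero_or_pos i with rfl | hi
    · rw [update_self]; rfl
    · rw [update_of_ne (by simp; omega)]
      by_cases hin : i < n + 1
      · rw [show setArr σ₁ 1 (n + 1) v (1, i) = v i from if_pos ⟨rfl, hin⟩, hv]
        simp only [lowMem, ← hn]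
        by_cases hi4 : i < 4
        · rw [if_pos hi4, if_pos (by omega)]
          congr 1; omega
        · rw [if_neg hi4, if_neg (by omega)]
      · rw [show setArr σ₁ 1 (n + 1) v (1, i) = σ₁ (1, i) from if_neg fun h => hin h.2, h1₁,
          initial_eq_zero (by omega)]
  · rw [update_of_ne (by simp), setArr_of_ne _ _ _ _ (by simp), h4₁]
  · rw [update_of_ne (by simp; omega), setArr_of_ne _ _ _ _ (by omega), hc₁ k i hk]

end

end PenroseTomography

/-! ### Programs for decision problems -/

namespace PenroseTomography

noncomputable section

open Function

open Classical in
/-- One plus the sum of the squares of the entries from `start` on. -/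
def sqSum (start : ℕ) (g : ℕ × (ℕ → ℝ)) : ℝ :=
  1 + rsum (g.1 + 1) fun i => if start ≤ i then rd g.2 i * rd g.2 i else 0

theorem comp_sqSum (start : ℕ) : Comp (sqSum start) := by
  unfold sqSum; fun_prop

/-- `7 := 1; 8 := 4; 9 := 1; while 7 < 6 do { 7 := 7 + 7; 8 := 8 + 9 }` -/
def countDigits : Prog :=
  Prog.seq (setC 7 (natConst 1)) (Prog.seq (mov 8 4) (Prog.seq (setC 9 (natConst 1))
    (whileLt 7 6 (Prog.seq (arith Op.add 7 7 7) (arith Op.add 8 8 9)))))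

theorem runsTo_countDigits (B : ℕ) {σ : Store} {s : ℝ} {n T : ℕ} (h6 : σ (6, 0) = s)
    (h4 : σ (4, 0) = n) (hT : s ≤ 2 ^ T) (hlt : ∀ t < T, (2 : ℝ) ^ t < s) :
    RunsTo B countDigits σ (27 * T + 21)
      (update (update (update σ (7, 0) (2 ^ T)) (8, 0) ((n + T : ℕ) : ℝ)) (9, 0) 1) := by
  set S : ℕ → Store := fun t =>
    update (update (update σ (7, 0) (2 ^ t)) (8, 0) ((n + t : ℕ) : ℝ)) (9, 0) 1 with hS
  obtain ⟨σ', r, rfl⟩ := runsTo_whileLt (B := B) (a := 7) (b := 6) (c := 20) (T := T)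
    (P := Prog.seq (arith Op.add 7 7 7) (arith Op.add 8 8 9)) (by simp) (by simp)
    (fun t σ => σ = S t)
    (fun t ht σ e => by simpa [e, hS, h6] using hlt t ht)
    (fun σ e => by simpa [e, hS, h6] using hT)
    (fun t ht σ e => ⟨_, (runsTo_arith B _ Op.add (by simp) (by simp) (by simp) (by simp)).seq
      (runsTo_arith B _ Op.add (by simp) (by simp) (by simp) (by simp)), by
        rw [e]
        funext ⟨k, i⟩
        simp only [hS, update_apply, Prod.mk.injEq, Op.val]
        by_cases hk : k = 7 ∨ k = 8 ∨ k = 9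
        · rcases hk with rfl | rfl | rfl <;> by_cases hi : i = 0 <;>
            simp [hi, pow_succ, ← two_mul, mul_comm, add_assoc]
        · push Not at hk
          simp [hk]⟩)
    (σ := S 0) rfl
  have e : S 0 = update (update (update σ (7, 0) (natConst 1)) (8, 0)
      (update σ (7, 0) (natConst 1) (4, 0))) (9, 0) (natConst 1) := by
    simp [hS, natConst, h4]
  rw [e] at r
  exact ((runsTo_setC B σ (d := 7) (by simp) _).seq ((runsTo_mov B _ (by simp) (by simp)).seq
    ((runsTo_setC B _ (by simp) _).seq r))).mono (by ring_nf; omega)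

/-- The common part of all programs: after it, the scalar `8` holds a number `N` that bounds the
length of the input and the numbers of digits, and the array `1` holds the input. -/
theorem exists_readInput (start : ℕ) : ∃ (P : Prog) (q : Polynomial ℕ), ∀ (w : List ℝ) (b : ℕ),
    2 ≤ w.length → sqSum start (w.length, initial w) ≤ 2 ^ b →
      ∃ N, w.length ≤ N ∧ N ≤ w.length + b ∧ (∀ i, start ≤ i → |initial w i| ≤ 2 ^ N) ∧
        ∃ m M σ, Exec P (initial w) m M ∧ m ≤ q.eval (w.length + b) ∧
          Lay (16 * w.length ^ 2) σ M ∧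
          Ctx.Rep (γ := ℕ × (ℕ → ℝ)) ((8, 1) : ℕ × ℕ) (N, initial w) σ ∧ Clean 10 σ := by
  obtain ⟨Q, qs, HQ⟩ := (comp_sqSum start).eval ((4, 1) : ℕ × ℕ) (d := 6) (by simp)
    ⟨⟨by simp, by simp⟩, ⟨by simp, by simp⟩⟩
  refine ⟨Prog.seq clearRegs (Prog.seq (streg 3 1 2) (Prog.seq copyInput
    (Prog.seq Q countDigits))), 123 * Polynomial.X + 200 + qs, fun w b hw hb => ?_⟩
  have hex : ∃ T : ℕ, sqSum start (w.length, initial w) ≤ 2 ^ T := ⟨b, hb⟩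
  classical
  set T := Nat.find hex with hT
  have hTb : T ≤ b := Nat.find_min' hex hb
  have hTs : sqSum start (w.length, initial w) ≤ 2 ^ T := Nat.find_spec hex
  refine ⟨w.length + T, by omega, by omega, fun i hi => ?_, ?_⟩
  · have h1 : (1 : ℝ) + initial w i * initial w i ≤ 2 ^ T := by
      refine le_trans ?_ hTs
      by_cases hiw : i < w.length + 1
      · have := Finset.single_le_sum (f := fun i => if start ≤ i then
          rd (initial w) i * rd (initial w) i else 0) (s := Finset.range (w.length + 1))
          (fun i _ => by split_ifs; exacts [mul_self_nonneg _, le_rfl]) (Finset.mem_range.2 hiw)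
        simp only [hi, if_true] at this
        exact add_le_add_right this 1
      · rw [initial_eq_zero (by omega), mul_zero, add_zero]
        exact le_add_of_nonneg_right (Finset.sum_nonneg fun i _ => by
          split_ifs; exacts [mul_self_nonneg _, le_rfl])
    have h2 : (2 : ℝ) ^ T ≤ 2 ^ (w.length + T) := pow_le_pow_right₀ (by norm_num) (by omega)
    rw [abs_le]
    constructor <;> nlinarith
  · obtain ⟨M₁, e₁, h3, L₁⟩ := exec_clearRegs hw
    obtain ⟨M₂, e₂, L₂⟩ := exec_streg (r := 3) (r' := 1) (k := 2) L₁ (by simp) (by simp) (by simp)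
      (by simp)
    rw [h3] at L₂
    obtain ⟨σ, r, hσ⟩ := runsTo_copyInput hw
    have hrep : Ctx.Rep (γ := ℕ × (ℕ → ℝ)) ((4, 1) : ℕ × ℕ) (w.length, initial w) σ :=
      ⟨hσ.length, hσ.word⟩
    have r' := r.seq ((HQ _ _ σ hrep hσ.clean).seq (runsTo_countDigits (16 * w.length ^ 2)
      (s := sqSum start (w.length, initial w)) (n := w.length) (T := T) (by simp [Scal.val])
      (by rw [update_of_ne (by simp), hσ.length]) hTs
      fun t ht => not_le.1 (Nat.find_min hex ht)))
    obtain ⟨m, hm, M₃, e₃, L₃⟩ := r' _ L₂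
    refine ⟨_, M₃, _, Exec.seq e₁ (Exec.seq e₂ e₃), ?_, L₃, ⟨?_, fun i => ?_⟩, fun k i hk => ?_⟩
    · have h4 := eval_mono qs (show Ctx.size (γ := ℕ × (ℕ → ℝ)) (w.length, initial w) ≤
        w.length + b from Nat.add_le_add_left (Nat.zero_le b) _)
      simp only [Polynomial.eval_add, Polynomial.eval_mul, Polynomial.eval_X,
        Polynomial.eval_ofNat]
      omega
    · exact (update_of_ne (by simp) _ _).trans (update_self _ _ _)
    · rw [update_of_ne (by simp), update_of_ne (by simp), update_of_ne (by simp),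
        update_of_ne (by simp), hσ.word]
      rfl
    · rw [update_of_ne (by simp; omega), update_of_ne (by simp; omega),
        update_of_ne (by simp; omega), update_of_ne (by simp; omega), hσ.clean k i (by omega)]

/-- A computable predicate can be decided by a program. -/
theorem exists_decider {f : ℕ × (ℕ → ℝ) → Prop} (hf : Comp f) (start : ℕ) :
    ∃ (P : Prog) (q : Polynomial ℕ), ∀ (w : List ℝ) (b : ℕ),
      2 ≤ w.length → sqSum start (w.length, initial w) ≤ 2 ^ b →
        ∃ N, w.length ≤ N ∧ (∀ i, start ≤ i → |initial w i| ≤ 2 ^ N) ∧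
          ∃ m M, Exec P (initial w) m M ∧ m ≤ q.eval (w.length + b) ∧
            Answers M (f (N, initial w)) := by
  obtain ⟨P, q, H⟩ := exists_readInput start
  obtain ⟨P', q', H'⟩ := hf.eval ((8, 1) : ℕ × ℕ) (d := 10) (by simp)
    ⟨⟨by simp, by simp⟩, ⟨by simp, by simp⟩⟩
  refine ⟨Prog.seq P (Prog.seq P' (Prog.seq (ldreg 1 10)
    (straight [Instr.const 0 (natConst 0), Instr.add 0 0 1]))), q + q' + 5, fun w b hw hb => ?_⟩
  obtain ⟨N, hN, hNb, hdig, m, M, σ, e, hm, L, hrep, hc⟩ := H w b hw hb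
  obtain ⟨m', hm', M', e', L'⟩ := H' _ _ σ hrep hc M L
  refine ⟨N, hN, hdig, _, _, Exec.seq e (Exec.seq e' (Exec.seq (exec_ldreg L' (by simp) (by simp)
    (by simp)) (exec_cons (Step.const ..) (exec_cons (Step.add ..) (exec_nil _))))), ?_, ?_⟩
  · have h4 := eval_mono q' (show Ctx.size (γ := ℕ × (ℕ → ℝ)) (N, initial w) ≤ w.length + b from
      (Nat.add_le_add_left (Nat.zero_le 0) _).trans hNb)
    simp only [Polynomial.eval_add, Polynomial.eval_ofNat]
    omega
  · by_cases h : f (N, initial w) <;> simp [Answers, h, natConst, Scal.val]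

end

end PenroseTomography

/-! ### Programs for the construction of words -/

namespace PenroseTomography

noncomputable section

open Function

/-- `for 15 < 10 do 0[15 + 4] := 14[15]` -/
def copyOutput : Prog :=
  forLoop 15 10 16 (Prog.seq (setC 16 (natConst 4)) (Prog.seq (arith Op.add 16 15 16)
    (Prog.seq (readA 17 14 15) (Prog.seq (writeA 0 16 17) (Prog.seq (setC 16 (natConst 0))
      (setC 17 (natConst 0)))))))

theorem runsTo_copyOutput {B L : ℕ} {σ : Store} {v : ℕ → ℝ} (h10 : σ (10, 0) = L)
    (hc : Clean 15 σ) (hB : L + 4 ≤ B) (hv : ∀ i < L, σ (14, i) = v i) :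
    ∃ σ', RunsTo B copyOutput σ (L * (46 + 25) + 11) σ' ∧
      (∀ k i, k ≠ 0 → σ' (k, i) = σ (k, i)) ∧ ∀ i < L, σ' (0, i + 4) = v i := by
  set S : ℕ → Store := fun t c => if c.1 = 0 ∧ 4 ≤ c.2 ∧ c.2 < t + 4 then v (c.2 - 4) else σ c
    with hS
  have e0 : S 0 = σ := by
    funext c
    exact if_neg (by omega)
  have := runsTo_forLoop (B := B) (j := 15) (l := 10) (o := 16) (L := L) (c := 46)
    (P := Prog.seq (setC 16 (natConst 4)) (Prog.seq (arith Op.add 16 15 16)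
      (Prog.seq (readA 17 14 15) (Prog.seq (writeA 0 16 17) (Prog.seq (setC 16 (natConst 0))
      (setC 17 (natConst 0))))))) (by simp) (by simp) (by simp) (by simp) (by simp) S
    (fun t _ => by simp [hS, h10]) (fun t _ => by simp [hS, hc 15 0 (by simp)])
    (fun t _ => by simp [hS, hc 16 0 (by simp)])
    (fun t ht => by
      have h16 := hc 16 0 (by simp)
      have h17 := hc 17 0 (by simp)
      have hvt := hv t ht
      refine ((runsTo_setC B _ (by simp) _).seq ((runsTo_arith B _ Op.add (by simp) (by simp)
        (by simp) (by simp)).seq ((runsTo_readA (i := t) (by simp) (by simp) (by simp)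
        (fun h => absurd h (by simp))).seq ((runsTo_writeA (i := t + 4) (by simp) (by simp)
        (by simp [Op.val, natConst]) (fun _ => ⟨by simp, by simp; omega⟩)).seq
        ((runsTo_setC B _ (by simp) _).seq (runsTo_setC B _ (by simp) _)))))).congr ?_
      funext ⟨k, i⟩
      simp only [update_apply, Prod.mk.injEq, natConst, hS, Op.val]
      by_cases hk : k = 0
      · subst hk
        by_cases hi : i = t + 4
        · subst hi; simp [hvt]
        · have h1 : (4 ≤ i ∧ i < t + 4) ↔ (4 ≤ i ∧ i < t + 1 + 4) := by omega
          simp [hi, h1]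
      · by_cases h1 : k = 16 ∨ k = 17
        · rcases h1 with rfl | rfl <;> by_cases hi : i = 0 <;> simp [hi, h16, h17]
        · push Not at h1
          simp [hk, h1])
  refine ⟨S L, e0 ▸ this, fun k i hk => if_neg (by simp [hk]), fun i hi => ?_⟩
  rw [hS]
  dsimp only
  rw [if_pos ⟨rfl, by omega, by omega⟩, Nat.add_sub_cancel]

/-- The cell at the start of the array area belongs to no array. -/
theorem Lay.setBase {B : ℕ} {σ : Store} {M : Memory} (h : Lay B σ M) (x : ℝ) :
    Lay B σ (update M B x) := by
  refine ⟨h.base, ?_, fun c hc => ?_⟩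
  · rw [update_of_ne (by have := h.base; omega), h.reg]
  · rw [update_of_ne, h.mem c hc]
    unfold addr
    split_ifs with hk
    · exact (hc hk).2.ne
    · have : 0 < 2 ^ c.1 * (2 * c.2 + 1) := by positivity
      omega

/-- The cells `0, …, 3` are the last to be written, as they serve as registers. The first one is
kept in the cell at the start of the array area in the meantime. -/
def finish : Prog :=
  Prog.seq (ldreg 1 10) (Prog.seq (straight [Instr.store 0 1]) (Prog.seq (ldreg 1 11)
    (Prog.seq (ldreg 2 12) (Prog.seq (ldreg 3 13) (straight [Instr.load 0 0])))))

theorem exec_finish {B L : ℕ} {σ : Store} {M : Memory} {v : ℕ → ℝ} (h : Lay B σ M)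
    (h10 : σ (10, 0) = L) (h11 : σ (11, 0) = v 1) (h12 : σ (12, 0) = v 2) (h13 : σ (13, 0) = v 3)
    (hB : L + 4 ≤ B) (hv : ∀ i < L, σ (0, i + 4) = v (i + 4)) :
    ∃ M', Exec finish M 14 M' ∧ M' 0 = L ∧ ∀ i, 1 ≤ i → i ≤ L → M' i = v i := by
  have h1 := h.setReg (r := 1) (by simp) (by simp) (σ (10, 0))
  have h2 := h1.setBase (σ (10, 0))
  have h3 := h2.setReg (r := 1) (by simp) (by simp) (σ (11, 0))
  have h4 := h3.setReg (r := 2) (by simp) (by simp) (σ (12, 0))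
  have h5 := h4.setReg (r := 3) (by simp) (by simp) (σ (13, 0))
  have hb := h.base
  have hB1 : B ≠ 1 ∧ B ≠ 2 ∧ B ≠ 3 ∧ 0 ≠ B := by omega
  refine ⟨_, Exec.seq (n := 11) (exec_ldreg h (by simp) (by simp) (by simp)) (Exec.seq (m := 1)
    (n := 10) (exec_cons (n := 0) (N := update (update M 1 (σ (10, 0))) B (σ (10, 0))) ?_
      (exec_nil _))
    (Exec.seq (n := 7) (exec_ldreg h2 (by simp) (by simp) (by simp))
    (Exec.seq (n := 4) (exec_ldreg h3 (by simp) (by simp) (by simp)) (Exec.seq (n := 1)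
    (exec_ldreg h4 (by simp) (by simp) (by simp)) (exec_cons (n := 0)
    (Step.load _ 0 0 B h5.reg) (exec_nil _)))))), ?_, fun i hi hiL => ?_⟩
  · have := Step.store (update M 1 (σ (10, 0))) 0 1 B h1.reg
    rwa [update_self] at this
  · simp [hB1, h10]
  · rcases (by omega : i = 1 ∨ i = 2 ∨ i = 3 ∨ 4 ≤ i) with rfl | rfl | rfl | hi4
    · simp [h11]
    · simp [h12]
    · simp [h13]
    · rw [update_of_ne (by omega)]
      have := h5.mem (0, i) fun _ => ⟨hi4, by dsimp only; omega⟩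
      rw [addr, if_pos rfl] at this
      rw [this]
      obtain ⟨j, rfl⟩ := Nat.exists_eq_add_of_le' hi4
      exact hv j (by omega)

/-- A computable word can be constructed by a program, if it is not too long for the low memory. -/
theorem exists_constructor {len : ℕ × (ℕ → ℝ) → ℕ} {out : (ℕ × (ℕ → ℝ)) × ℕ → ℝ}
    (hlen : Comp len) (hout : Comp out) (start : ℕ) :
    ∃ (P : Prog) (q : Polynomial ℕ), ∀ (w : List ℝ) (b : ℕ),
      2 ≤ w.length → sqSum start (w.length, initial w) ≤ 2 ^ b →
        ∃ N, w.length ≤ N ∧ (∀ i, start ≤ i → |initial w i| ≤ 2 ^ N) ∧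
          (len (N, initial w) + 4 ≤ 16 * w.length ^ 2 →
            ∃ m M, Exec P (initial w) m M ∧ m ≤ q.eval (w.length + b) ∧
              M 0 = len (N, initial w) ∧
              ∀ i, 1 ≤ i → i ≤ len (N, initial w) → M i = out ((N, initial w), i)) := by
  obtain ⟨P, q, H⟩ := exists_readInput start
  have below : ∀ d, 10 ≤ d → Ctx.Below (γ := ℕ × (ℕ → ℝ)) ((8, 1) : ℕ × ℕ) d := fun d hd =>
    ⟨⟨by simp, by omega⟩, ⟨by simp, by omega⟩⟩
  have hout' : ∀ k, Comp fun g : ℕ × (ℕ → ℝ) => out (g, k) := fun k =>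
    hout.comp (Comp.id.prodMk (Comp.const k))
  have houts : Comp fun p : (ℕ × (ℕ → ℝ)) × ℕ => out (p.1, p.2 + 4) := by
    refine hout.comp (f := out) (g := fun p : (ℕ × (ℕ → ℝ)) × ℕ => (p.1, p.2 + 4)) ?_
    fun_prop
  obtain ⟨P₀, q₀, H₀⟩ := hlen.eval ((8, 1) : ℕ × ℕ) (d := 10) (by simp) (below _ (by simp))
  obtain ⟨P₁, q₁, H₁⟩ := (hout' 1).eval ((8, 1) : ℕ × ℕ) (d := 11) (by simp) (below _ (by simp))
  obtain ⟨P₂, q₂, H₂⟩ := (hout' 2).eval ((8, 1) : ℕ × ℕ) (d := 12) (by simp) (below _ (by simp))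
  obtain ⟨P₃, q₃, H₃⟩ := (hout' 3).eval ((8, 1) : ℕ × ℕ) (d := 13) (by simp) (below _ (by simp))
  obtain ⟨Pa, qa, Ha⟩ := houts.eval (((8, 1), 15) : (ℕ × ℕ) × ℕ) (d := 16) (by simp)
    ⟨below _ (by simp), by simp, by simp⟩
  obtain ⟨ql, hql⟩ := hlen.1
  refine ⟨Prog.seq P (Prog.seq (Prog.seq P₀ (Prog.seq P₁ (Prog.seq P₂ (Prog.seq P₃
    (Prog.seq (tabulate 14 10 15 Pa) copyOutput))))) finish),
    q + q₀ + q₁ + q₂ + q₃ + ql * (qa.comp (Polynomial.X + ql) + 112) + 36, fun w b hw hb => ?_⟩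
  obtain ⟨N, hN, hNb, hdig, m, M, σ, e, hm, lay, hrep, hc⟩ := H w b hw hb
  refine ⟨N, hN, hdig, fun hL => ?_⟩
  set g : ℕ × (ℕ → ℝ) := (N, initial w) with hg
  set L := len g with hLdef
  set B := 16 * w.length ^ 2 with hB
  -- the letters `0, …, 3` and the length are kept in scalars
  have r₀ := H₀ B g σ hrep hc
  have c₁ := (hc.mono (Nat.le_succ _)).update (Nat.lt_succ_self 10) 0 (Scal.val (len g))
  have i₁ := rep_update (below 10 le_rfl) hrep (le_refl 10) 0 (Scal.val (len g))
  have r₁ := H₁ B g _ i₁ c₁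
  have c₂ := (c₁.mono (Nat.le_succ _)).update (Nat.lt_succ_self 11) 0 (Scal.val (out (g, 1)))
  have i₂ := rep_update (below 11 (by simp)) i₁ (le_refl 11) 0 (Scal.val (out (g, 1)))
  have r₂ := H₂ B g _ i₂ c₂
  have c₃ := (c₂.mono (Nat.le_succ _)).update (Nat.lt_succ_self 12) 0 (Scal.val (out (g, 2)))
  have i₃ := rep_update (below 12 (by simp)) i₂ (le_refl 12) 0 (Scal.val (out (g, 2)))
  have r₃ := H₃ B g _ i₃ c₃
  have c₄ := (c₃.mono (Nat.le_succ _)).update (Nat.lt_succ_self 13) 0 (Scal.val (out (g, 3)))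
  have i₄ := rep_update (below 13 (by simp)) i₃ (le_refl 13) 0 (Scal.val (out (g, 3)))
  set τ := update (update (update (update σ (10, 0) (Scal.val (len g))) (11, 0)
    (Scal.val (out (g, 1)))) (12, 0) (Scal.val (out (g, 2)))) (13, 0) (Scal.val (out (g, 3)))
    with hτ
  have t₀ : τ (10, 0) = L := by simp [hτ, Scal.val, hLdef]
  have t₁ : τ (11, 0) = out (g, 1) := by simp [hτ, Scal.val]
  have t₂ : τ (12, 0) = out (g, 2) := by simp [hτ, Scal.val]
  have t₃ : τ (13, 0) = out (g, 3) := by simp [hτ, Scal.val]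
  clear_value τ
  have r₅ := runsTo_tabulate (B := B) (a := 14) (l := 10) (j := 15) (L := L)
    (c := qa.eval (Ctx.size g + L)) (P := Pa) (by simp) (by simp) (by simp) (by simp) (by simp)
    (fun i => out (g, i + 4)) t₀ (c₄.mono (by simp)) (fun t ht => by
      refine (Ha B (g, t) _ ⟨?_, ?_⟩ ?_).mono (eval_mono _ (Nat.add_le_add_left ht.le _))
      · refine Ctx.rep_congr (below 10 le_rfl) (fun k hk i => ?_) i₄
        rw [update_of_ne (by rintro ⟨⟩; omega), setArr_of_ne _ _ _ _ (by omega)]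
      · exact update_self ..
      · refine Clean.update ?_ (by simp) _ _
        intro k i hk
        rw [setArr_of_ne _ _ _ _ (by omega), c₄ k i (by omega)])
  obtain ⟨σ', r₆, hσ', hout0⟩ := runsTo_copyOutput (B := B) (L := L)
    (σ := setArr τ 14 L fun i => out (g, i + 4)) (v := fun i => out (g, i + 4))
    (by rw [setArr_of_ne _ _ _ _ (by simp), t₀])
    (fun k i hk => by rw [setArr_of_ne _ _ _ _ (by omega), c₄ k i (by omega)]) hL
    (fun i hi => if_pos ⟨rfl, hi⟩)
  obtain ⟨m', hm', M', e', lay'⟩ :=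
    (r₀.seq (r₁.seq (r₂.seq (r₃.seq (r₅.seq r₆))))) M lay
  have hs : ∀ k, k ≠ 0 → k ≠ 14 → σ' (k, 0) = τ (k, 0) := fun k h h' => by
    rw [hσ' k 0 h, setArr_of_ne _ _ _ _ h']
  obtain ⟨M'', e'', h0, hM⟩ := exec_finish (v := fun i => out (g, i)) lay'
    (by rw [hs _ (by simp) (by simp), t₀]) (by rw [hs _ (by simp) (by simp), t₁])
    (by rw [hs _ (by simp) (by simp), t₂]) (by rw [hs _ (by simp) (by simp), t₃]) hL hout0
  refine ⟨_, M'', Exec.seq e (Exec.seq e' e''), ?_, h0, hM⟩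
  have hg' : Ctx.size g ≤ w.length + b := (Nat.add_le_add_left (Nat.zero_le 0) _).trans hNb
  have b₀ := eval_mono q₀ hg'
  have b₁ := eval_mono q₁ hg'
  have b₂ := eval_mono q₂ hg'
  have b₃ := eval_mono q₃ hg'
  have bL : L ≤ ql.eval (w.length + b) := (hql g).trans (eval_mono ql hg')
  have ba := eval_mono qa (Nat.add_le_add hg' bL)
  have bm : L * (qa.eval (Ctx.size g + L) + 112) ≤ ql.eval (w.length + b) *
      (qa.eval (w.length + b + ql.eval (w.length + b)) + 112) :=
    Nat.mul_le_mul bL (Nat.add_le_add_right ba _)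
  have bs : L * (qa.eval (Ctx.size g + L) + 41) + L * (46 + 25) =
      L * (qa.eval (Ctx.size g + L) + 112) := by ring
  simp only [Polynomial.eval_add, Polynomial.eval_mul, Polynomial.eval_comp, Polynomial.eval_X,
    Polynomial.eval_ofNat]
  omega

end

end PenroseTomography

/-! ### Words and sizes of inputs -/

namespace PenroseTomography

noncomputable section

/-- The sum of the squares of the entries of the word `w` is less than `4 ^ b`. -/
def SqBound (w : List ℝ) (b : ℕ) : Prop := 1 + (w.map fun x => x ^ 2).sum ≤ 4 ^ b

theorem SqBound.nil : SqBound [] 0 := by simp [SqBound]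

theorem SqBound.append {w w' : List ℝ} {b b' : ℕ} (h : SqBound w b) (h' : SqBound w' b') :
    SqBound (w ++ w') (b + b') := by
  unfold SqBound at *
  have nonneg : ∀ v : List ℝ, 0 ≤ (v.map fun x => x ^ 2).sum := fun v => by
    refine List.sum_nonneg fun x hx => ?_
    obtain ⟨y, -, rfl⟩ := List.mem_map.1 hx
    positivity
  rw [List.map_append, List.sum_append, pow_add]
  have h1 := mul_le_mul h h' (by have := nonneg w'; positivity) (by positivity)
  have h2 := mul_nonneg (nonneg w) (nonneg w')
  linarith

theorem SqBound.mono {w : List ℝ} {b b' : ℕ} (h : SqBound w b) (hb : b ≤ b') : SqBound w b' :=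
  h.trans (pow_le_pow_right₀ (by norm_num) hb)

theorem SqBound.intCast (a : ℤ) : SqBound [(a : ℝ)] a.natAbs.size := by
  have h1 : a.natAbs + 1 ≤ 2 ^ a.natAbs.size := Nat.lt_size_self _
  have h2 : (|(a : ℝ)| + 1) ≤ 2 ^ a.natAbs.size := by
    rw [← Int.cast_abs, Int.abs_eq_natAbs]
    exact_mod_cast h1
  have h3 : (4 : ℝ) ^ a.natAbs.size = (2 ^ a.natAbs.size) ^ 2 := by
    rw [← pow_mul, mul_comm, pow_mul]; norm_num
  simp only [SqBound, List.map_cons, List.map_nil, List.sum_cons, List.sum_nil, add_zero, h3]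
  nlinarith [abs_nonneg (a : ℝ), sq_abs (a : ℝ)]

theorem SqBound.natCast (n : ℕ) : SqBound [(n : ℝ)] n.size := by
  simpa using SqBound.intCast (n : ℤ)

theorem SqBound.flatMap {α : Type} {f : α → List ℝ} {c : α → ℕ} (h : ∀ e, SqBound (f e) (c e))
    (l : List α) : SqBound (l.flatMap f) (l.map c).sum := by
  induction l with
  | nil => exact SqBound.nil
  | cons e l ih => rw [List.flatMap_cons, List.map_cons, List.sum_cons]; exact (h e).append ih

theorem SqBound.coordsWord (a : Coords) : SqBound (coordsWord a) (coordsSize a) := by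
  have := (SqBound.intCast (a 0)).append ((SqBound.intCast (a 1)).append
    ((SqBound.intCast (a 2)).append (SqBound.intCast (a 3))))
  refine SqBound.mono (b := _)
    (by simpa [PenroseTomography.coordsWord, List.ofFn_succ] using this) ?_
  simp only [coordsSize, Fin.sum_univ_four]
  omega

theorem four_le_coordsSize (a : Coords) : 4 ≤ coordsSize a := by
  simp only [coordsSize, Fin.sum_univ_four]
  omega

theorem five_mul_length_le_dataSize (l : List (Coords × ℕ)) : 5 * l.length ≤ dataSize l := by
  unfold dataSize
  induction l with
  | nil => simp
  | cons e l ih =>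
    have := four_le_coordsSize e.1
    rw [List.length_cons, List.map_cons, List.sum_cons]
    omega

theorem SqBound.dataWord (l : List (Coords × ℕ)) : SqBound (dataWord l) (2 * dataSize l) := by
  have h1 := SqBound.flatMap
    (f := fun e : Coords × ℕ => PenroseTomography.coordsWord e.1 ++ [(e.2 : ℝ)])
    (fun e => ((SqBound.coordsWord e.1).append (SqBound.natCast e.2)).mono
      (b' := coordsSize e.1 + (e.2.size + 1)) (by omega)) l
  have h2 := (SqBound.natCast l.length).append h1
  have h3 : l.length.size ≤ l.length := Nat.size_le.2 Nat.lt_two_pow_self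
  have h4 := five_mul_length_le_dataSize l
  exact SqBound.mono h2 (by unfold dataSize at *; omega)

theorem four_mul_length_le_setSize (l : List Coords) : 4 * l.length + 2 ≤ setSize l := by
  unfold setSize
  induction l with
  | nil => simp
  | cons e l ih =>
    have := four_le_coordsSize e
    rw [List.length_cons, List.map_cons, List.sum_cons]
    omega

theorem sum_getD_eq_sum_drop (w : List ℝ) (k : ℕ) :
    (∑ i ∈ Finset.range w.length, if k ≤ i then w.getD i 0 * w.getD i 0 else 0) =
      ((w.drop k).map fun x => x ^ 2).sum := by
  induction w generalizing k with
  | nil => simp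
  | cons x w ih =>
    rw [List.length_cons, Finset.sum_range_succ']
    cases k with
    | zero =>
      have := ih 0
      simp only [Nat.zero_le, if_true, List.drop_zero] at this
      simp only [Nat.zero_le, if_true, List.drop_zero, List.map_cons, List.sum_cons,
        List.getD_cons_succ, List.getD_cons_zero, this]
      ring
    | succ k =>
      have := ih k
      simp only [Nat.succ_le_succ_iff, List.drop_succ_cons,
        List.getD_cons_succ, this]
      simp

/-- The letters before the number `start` may be arbitrary real numbers. -/
theorem sqSum_le {w : List ℝ} {k b : ℕ} (h : SqBound (w.drop k) b) :
    sqSum (k + 1) (w.length, initial w) ≤ 2 ^ (2 * b) := by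
  have h4 : (2 : ℝ) ^ (2 * b) = 4 ^ b := by rw [pow_mul]; norm_num
  rw [h4]
  refine le_of_eq_of_le ?_ h
  rw [sqSum, rsum, Finset.sum_range_succ', ← sum_getD_eq_sum_drop]
  simp only [Nat.add_le_add_iff_right, nonpos_iff_eq_zero, Nat.succ_ne_zero, if_false, add_zero]
  rfl

end

end PenroseTomography

/-! ### Translations and uniqueness -/

namespace PenroseTomography

noncomputable section

variable {π : Equiv.Perm (Fin 4)} {u u₁ u₂ : ℂ}

/-- The translate `t + F`. -/
def translate (t : ℂ) (F : Finset ℂ) : Finset ℂ := F.map (addLeftEmbedding t)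

theorem coe_translate (t : ℂ) (F : Finset ℂ) : (translate t F : Set ℂ) = (fun z => t + z) '' F := by
  simp [translate]

theorem translate_neg_translate (t : ℂ) (F : Finset ℂ) : translate (-t) (translate t F) = F := by
  rw [← Finset.coe_inj, coe_translate, coe_translate, Set.image_image]
  simp

theorem translate_translate_neg (t : ℂ) (F : Finset ℂ) : translate t (translate (-t) F) = F := by
  simpa using translate_neg_translate (-t) F

theorem InPenrose.translate {F : Finset ℂ} (h : InPenrose π F) (t : ℂ) :
    InPenrose π (translate t F) := by
  obtain ⟨_, ⟨s, t', hs, rfl⟩, hF⟩ := h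
  refine ⟨_, ⟨s, t + t', hs, rfl⟩, ?_⟩
  rw [coe_translate]
  rintro _ ⟨z, hz, rfl⟩
  obtain ⟨z', hz', rfl⟩ := hF hz
  exact ⟨z', hz', add_assoc ..⟩

theorem xray_translate (t : ℂ) (F : Finset ℂ) (z : ℂ) :
    xray u (translate t F) ⟨line u z, z, rfl⟩ = xray u F ⟨line u (z - t), z - t, rfl⟩ := by
  have : (translate t F : Set ℂ) ∩ line u z =
      (fun w => t + w) '' ((F : Set ℂ) ∩ line u (z - t)) := by
    rw [coe_translate]
    ext w
    constructor
    · rintro ⟨⟨v, hv, rfl⟩, s, hs⟩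
      exact ⟨v, ⟨hv, s, by linear_combination hs⟩, rfl⟩
    · rintro ⟨v, ⟨hv, s, hs⟩, rfl⟩
      exact ⟨⟨v, hv, rfl⟩, s, by linear_combination hs⟩
  rw [xray, xray, this, Set.ncard_image_of_injective _ (add_right_injective t)]

theorem xray_translate_congr {F G : Finset ℂ} (h : xray u F = xray u G) (t : ℂ) :
    xray u (translate t F) = xray u (translate t G) := by
  funext ⟨ℓ, z, hz⟩
  subst hz
  rw [xray_translate, xray_translate, h]

/-- A set with the same X-ray that contains `F` equals `F`, as there is no room for another point
on any line. -/
theorem eq_of_subset_of_xray_eq {F F' : Finset ℂ} (h : F ⊆ F') (hx : xray u F' = xray u F) :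
    F' = F := by
  refine (h.antisymm fun z hz => ?_).symm
  by_contra hzF
  have hlt : ((F : Set ℂ) ∩ line u z).ncard < ((F' : Set ℂ) ∩ line u z).ncard := by
    refine Set.ncard_lt_ncard ⟨fun w hw => ⟨h hw.1, hw.2⟩, fun hsub => hzF ?_⟩
      (F'.finite_toSet.inter_of_left _)
    exact (hsub ⟨hz, 0, by simp⟩).1
  exact hlt.ne' (congrFun hx ⟨line u z, z, rfl⟩)

/-- Another set with the same X-rays misses some point of the given one. The translation vector
plays no role, so it can be ignored by the program. -/
theorem exists_ne_iff (t : ℂ) (F : Finset ℂ) :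
    (∃ F', F' ≠ translate t F ∧ InPenrose π F' ∧ xray u₁ F' = xray u₁ (translate t F) ∧
      xray u₂ F' = xray u₂ (translate t F)) ↔
    ∃ f ∈ F, ∃ F', IsSolution π u₁ u₂ (xray u₁ F) (xray u₂ F) F' ∧ f ∉ F' := by
  constructor
  · rintro ⟨F', hne, hP, h₁, h₂⟩
    have h₁' := xray_translate_congr h₁ (-t)
    have h₂' := xray_translate_congr h₂ (-t)
    rw [translate_neg_translate] at h₁' h₂'
    by_contra! H
    have := eq_of_subset_of_xray_eq (fun f hf => H f hf _ ⟨hP.translate (-t), h₁', h₂'⟩) h₁'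
    rw [← this, translate_translate_neg] at hne
    exact hne rfl
  · rintro ⟨f, hf, F', ⟨hP, h₁, h₂⟩, hfF'⟩
    refine ⟨translate t F', fun h => hfF' ?_, hP.translate t, xray_translate_congr h₁ t,
      xray_translate_congr h₂ t⟩
    rw [← translate_neg_translate t F', h, translate_neg_translate]
    exact hf

theorem EncodesSet.eq_translate {F : Finset ℂ} {t : ℂ} {l : List Coords} (h : EncodesSet F t l) :
    F = translate t (pointSet l) := by
  rw [← Finset.coe_inj, h.2, coe_translate]
  ext z
  constructor
  · rintro ⟨a, ha, rfl⟩
    exact ⟨_, mem_pointSet.2 ⟨a, ha, rfl⟩, rfl⟩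
  · rintro ⟨y, hy, rfl⟩
    obtain ⟨a, ha, rfl⟩ := mem_pointSet.1 hy
    exact ⟨a, ha, rfl⟩

end

/-! ### The three problems -/

noncomputable section

variable {u₁ u₂ : ℂ}

theorem rank_le (S : ℕ → Prop) (e : ℕ) : rank S e ≤ e := by
  refine (Finset.sum_le_card_nsmul (Finset.range e) _ 1 fun i _ => ?_).trans (by simp)
  beta_reduce
  split_ifs <;> simp

/-- The length and the entries of the input word are bounded in terms of the size. -/
theorem dataWord_bounds (l₁ l₂ : List (Coords × ℕ)) :
    2 ≤ (dataWord l₁ ++ dataWord l₂).length ∧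
    (dataWord l₁ ++ dataWord l₂).length ≤ dataSize l₁ + dataSize l₂ + 2 ∧
    sqSum 1 ((dataWord l₁ ++ dataWord l₂).length, initial (dataWord l₁ ++ dataWord l₂)) ≤
      2 ^ (4 * (dataSize l₁ + dataSize l₂)) := by
  have h₁ := five_mul_length_le_dataSize l₁
  have h₂ := five_mul_length_le_dataSize l₂
  refine ⟨?_, ?_, ?_⟩
  · rw [List.length_append, length_dataWord, length_dataWord]; omega
  · rw [List.length_append, length_dataWord, length_dataWord]; omega
  · have := sqSum_le (k := 0) ((SqBound.dataWord l₁).append (SqBound.dataWord l₂))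
    convert this using 2
    ring

theorem Answers.congr {M : Memory} {Q Q' : Prop} (h : Answers M Q) (e : Q ↔ Q') : Answers M Q' :=
  ⟨fun h' => h.1 (e.2 h'), fun h' => h.2 fun hQ => h' (e.1 hQ)⟩

theorem inPolyTime_consistency (π : Equiv.Perm (Fin 4)) (hu₁ : IsCycloDirection u₁)
    (hu₂ : IsCycloDirection u₂) (hne : LinearIndependent ℝ ![u₁, u₂]) :
    (consistency π u₁ u₂).InPolyTime := by
  obtain ⟨D, κ, A, B, hG⟩ := exists_gridFormula hu₁ hu₂ hne
  obtain ⟨P, q, H⟩ := exists_decider (f := fun g => Solvable π D (g.1 + κ) (rowNum g) (colNum g)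
    (gridCoord A B (colNum g) (rowPt g) (colPt g)) (fun _ => True) (rowVal g) (colVal g))
    (by fun_prop) 1
  refine ⟨P, q.comp (5 * Polynomial.X + 2), fun x => ?_⟩
  obtain ⟨h2, hl, hb⟩ := dataWord_bounds x.l₁ x.l₂
  obtain ⟨N, hN, hdig, m, M, e, hm, hM⟩ := H _ _ h2 hb
  obtain ⟨-, -, g, X', hD⟩ := x.describes hG rfl hN hdig rfl
  refine ⟨m, M, e, ?_, ?_⟩
  · refine hm.trans ?_
    simp only [Polynomial.eval_comp, Polynomial.eval_add, Polynomial.eval_mul, Polynomial.eval_X,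
      Polynomial.eval_ofNat]
    exact eval_mono q (by simp only [consistency]; omega)
  · have := hD.solvable_iff (π := π)
    simp only [Set.mem_empty_iff_false, not_false_eq_true, implies_true, and_true] at this
    exact Answers.congr hM this

theorem inPolyTime_reconstruction (π : Equiv.Perm (Fin 4)) (hu₁ : IsCycloDirection u₁)
    (hu₂ : IsCycloDirection u₂) (hne : LinearIndependent ℝ ![u₁, u₂]) :
    (reconstruction π u₁ u₂).InPolyTime := by
  obtain ⟨D, κ, A, B, hG⟩ := exists_gridFormula hu₁ hu₂ hne
  set X : ℕ × (ℕ → ℝ) → ℕ → Fin 4 → ℝ := fun g => gridCoord A B (colNum g) (rowPt g) (colPt g)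
    with hX
  set c : ℕ × (ℕ → ℝ) → ℕ := fun g => least (candidates (rowNum g * colNum g)) fun c =>
    Possible π D (g.1 + κ) (rowNum g) (colNum g) (X g) (fun _ => True) (rowVal g) (colVal g) c
    with hc
  set S : ℕ × (ℕ → ℝ) → ℕ → Prop := fun g => InSolution π D (g.1 + κ) (rowNum g) (colNum g) (X g)
    (fun _ => True) (rowVal g) (colVal g) (c g) with hS
  have cX : ∀ k, Comp fun p : (ℕ × (ℕ → ℝ)) × ℕ => X p.1 p.2 k := fun k => by
    simp only [hX]; fun_prop
  have cc : Comp c := by simp only [hc]; fun_prop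
  have cS : Comp fun p : (ℕ × (ℕ → ℝ)) × ℕ => S p.1 p.2 := by simp only [hS]; fun_prop
  obtain ⟨P, q, H⟩ := exists_constructor (len := fun g => 4 * rank (S g) (rowNum g * colNum g) + 2)
    (out := fun p => outLetter D (rowNum p.1 * colNum p.1)
      (X p.1 (digit (base (rowNum p.1 * colNum p.1)) 0 (c p.1))) (S p.1)
      (quot D (X p.1) (digit (base (rowNum p.1 * colNum p.1)) 0 (c p.1))) p.2)
    (by fun_prop) (by fun_prop) 1
  refine ⟨P, q.comp (5 * Polynomial.X + 2), fun x => ?_⟩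
  obtain ⟨h2, hl, hb⟩ := dataWord_bounds x.l₁ x.l₂
  obtain ⟨N, hN, hdig, H'⟩ := H _ _ h2 hb
  obtain ⟨hR, hC, g, X', hD⟩ := x.describes hG rfl hN hdig rfl
  obtain ⟨m, M, e, hm, hM0, hM⟩ := H' (by
    have h1 : rank (S (N, initial (dataWord x.l₁ ++ dataWord x.l₂)))
        (x.l₁.length * x.l₂.length) ≤ x.l₁.length * x.l₂.length := rank_le ..
    rw [hR, hC, List.length_append, length_dataWord, length_dataWord]
    nlinarith)
  refine ⟨m, M, e, ?_, fun hsol => ?_⟩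
  · refine hm.trans ?_
    simp only [Polynomial.eval_comp, Polynomial.eval_add, Polynomial.eval_mul, Polynomial.eval_X,
      Polynomial.eval_ofNat]
    exact eval_mono q (by simp only [reconstruction]; omega)
  · have := hD.solvable_iff (π := π)
    simp only [Set.mem_empty_iff_false, not_false_eq_true, implies_true, and_true] at this
    obtain ⟨F, t, l, hF, hFl, hlen, hget⟩ := hD.exists_output (this.2 hsol)
    refine ⟨F, t, l, hF, hFl, ?_, fun i => ?_⟩
    · rw [hM0, hlen]
    · rw [hM _ (by omega) (by rw [← hlen]; exact i.2), ← hget, List.getD_eq_getElem _ _ i.2]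
      rfl

theorem inPolyTime_uniqueness (π : Equiv.Perm (Fin 4)) (hu₁ : IsCycloDirection u₁)
    (hu₂ : IsCycloDirection u₂) (hne : LinearIndependent ℝ ![u₁, u₂]) :
    (uniqueness π u₁ u₂).InPolyTime := by
  obtain ⟨D, κ, A, B, hG⟩ := exists_gridFormula hu₁ hu₂ hne
  obtain ⟨c₁, hc₁⟩ := exists_isNormal hu₁
  obtain ⟨c₂, hc₂⟩ := exists_isNormal hu₂
  have : ∀ k, AlgConst (c₁ k) := fun k => ⟨hc₁.1 k⟩
  have : ∀ k, AlgConst (c₂ k) := fun k => ⟨hc₂.1 k⟩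
  obtain ⟨P, q, H⟩ := exists_decider (f := fun g => bex (ptNum g) fun f =>
    Solvable π D (g.1 + κ) (ptNum g) (ptNum g) (gridCoord A B (ptNum g) (pt g) (pt g))
      (OkWithout c₁ c₂ g f) (lineNum c₁ g) (lineNum c₂ g)) (by fun_prop) 3
  refine ⟨P, q.comp (3 * Polynomial.X), fun x => ?_⟩
  have hl := four_mul_length_le_setSize x.l
  have hb : SqBound ((setWord x.t x.l).drop 2) (setSize x.l) :=
    (SqBound.flatMap SqBound.coordsWord x.l).mono (Nat.le_add_left _ _)
  obtain ⟨N, hN, hdig, m, M, e, hm, hM⟩ := H _ _ (by rw [length_setWord]; omega) (sqSum_le hb)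
  obtain ⟨hn, hD⟩ := describes_pointSet hG hc₁ hc₂ x.encodes.1 hN hdig rfl
  refine ⟨m, M, e, ?_, ?_⟩
  · refine hm.trans ?_
    simp only [Polynomial.eval_comp, Polynomial.eval_mul, Polynomial.eval_X,
      Polynomial.eval_ofNat]
    rw [length_setWord]
    exact eval_mono q (by simp only [uniqueness]; omega)
  · refine Answers.congr hM ?_
    rw [x.encodes.eq_translate, exists_ne_iff]
    constructor
    · rintro ⟨f, hf, hs⟩
      rw [hn] at hf
      obtain ⟨g, X', h⟩ := hD f hf
      obtain ⟨F', hF', hf'⟩ := h.solvable_iff.1 hs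
      exact ⟨_, mem_pointSet.2 ⟨_, List.getElem_mem hf,
        by rw [List.getD_eq_getElem _ _ hf]⟩, F', hF', fun hmem => hf' _ hmem rfl⟩
    · rintro ⟨_, hf, F', hF', hmiss⟩
      obtain ⟨a, ha, rfl⟩ := mem_pointSet.1 hf
      obtain ⟨i, hi, rfl⟩ := List.getElem_of_mem ha
      obtain ⟨g, X', h⟩ := hD i hi
      refine ⟨i, hn.symm ▸ hi, h.solvable_iff.2 ⟨F', hF', fun f hf' h' => hmiss ?_⟩⟩
      rw [Set.mem_singleton_iff, List.getD_eq_getElem _ _ hi] at h'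
      exact h' ▸ hf'

end

end PenroseTomography
open PenroseTomography
theorem theorem4p1 (π : Equiv.Perm (Fin 4)) (u₁ u₂ : ℂ)
    (hu₁ : IsCycloDirection u₁) (hu₂ : IsCycloDirection u₂)
    (hne : LinearIndependent ℝ ![u₁, u₂]) :
    (consistency π u₁ u₂).InPolyTime ∧ (reconstruction π u₁ u₂).InPolyTime ∧
      (uniqueness π u₁ u₂).InPolyTime :=
  ⟨inPolyTime_consistency π hu₁ hu₂ hne, inPolyTime_reconstruction π hu₁ hu₂ hne,
    inPolyTime_uniqueness π hu₁ hu₂ hne⟩
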